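/- Let $\mathfrak C$ be the Cayley algebra (the octonions): the $8$-dimensional real vector space with basis $e_0=1,e_1,\dots,e_7$, with the bilinear multiplication for which $e_0$ is the unit, $e_i^2=-1$ for $i\ne0$, $e_ie_j=-e_je_i$ for distinct $i,j\neq 0$, and $e_ie_j=e_k$, $e_je_k=e_i$, $e_ke_i=e_j$ for $(i,j,k)=(1,2,3),(3,5,6),(6,7,1),(1,4,5),(3,4,7),(6,4,2),(2,5,7)$. Let $$G_2=\{\alpha\in \mathrm{Iso}_{\mathbb R}(\mathfrak C)\mid \alpha(xy)=(\alpha x)(\alpha y)\ \text{for all } x,y\in\mathfrak C\}$$ be its automorphism group, with the subspace topology from the group $\mathrm{Iso}_{\mathbb R}(\mathfrak C)$ of invertible $\mathbb R$-linear maps of $\mathfrak C$. Put $\mathbb C=\mathbb R\oplus\mathbb Re_1$ and identify $\mathbb C\oplus\mathbb C^3$ with $\mathfrak C$ by $a+(m_1,m_2,m_3)\mapsto a+m_1e_2+m_2e_4+m_3e_6$. Then: 1. $G_2$ is a simply connected compact simple Lie group. That is, $G_2$ is compact and simply connected, and with its topology it carries the structure of a smooth real Lie group, whose inclusion into the endomorphisms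 of $\mathfrak C$ is smooth, and whose Lie algebra is simple (non-abelian, without proper non-zero ideals). 2. The isotropy subgroup $(G_2)_{e_1}=\{\alpha\in G_2\mid\alpha e_1=e_1\}$ is $SU(3)$: there is an isomorphism of topological groups $\varphi: SU(3)\to (G_2)_{e_1}$ with $\varphi(A)(a+\boldsymbol m)=a+A\boldsymbol m$ for $a\in\mathbb C$, $\boldsymbol m\in\mathbb C^3$. 3. $G_2/SU(3)\simeq S^6$: the map $\alpha\,(G_2)_{e_1}\mapsto \alpha e_1$ is a well-defined homeomorphism of $G_2/(G_2)_{e_1}$ onto the unit sphere $S^6$ of $\mathbb Re_1\oplus\dots\oplus\mathbb Re_7\cong\mathbb R^7$. -/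

import Mathlib

open scoped Manifold ContDiff

/-! ### The Cayley algebra (the octonions) -/

/-- The underlying real vector space of the Cayley algebra, with its Euclidean inner product;
the coordinates are those in the basis `e₀ = 1, e₁, …, e₇`. -/
abbrev Octonion : Type := EuclideanSpace ℝ (Fin 8)

/-- The basis vector `eᵢ`. -/
noncomputable def octBasis (i : Fin 8) : Octonion := EuclideanSpace.single i 1

/-- The seven oriented lines of the Fano plane. A line `(i, j, k)` means
`eᵢ eⱼ = eₖ`, `eⱼ eₖ = eᵢ`, `eₖ eᵢ = eⱼ`. -/
def fanoLines : List (Fin 8 × Fin 8 × Fin 8) :=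
  [(1, 2, 3), (3, 5, 6), (6, 7, 1), (1, 4, 5), (3, 4, 7), (6, 4, 2), (2, 5, 7)]

/-- `(i, j, k)` is one of the oriented lines, up to cyclic rotation. -/
abbrev FanoOriented (i j k : Fin 8) : Prop :=
  (i, j, k) ∈ fanoLines ∨ (j, k, i) ∈ fanoLines ∨ (k, i, j) ∈ fanoLines

/-- The coefficient of `eₖ` in the product `eᵢ eⱼ`: `e₀` is the unit, `eᵢ² = -1` for `i ≠ 0`, and
for distinct `i, j ≠ 0` the product is `eₖ` if `(i, j, k)` is an oriented line and `-eₖ` if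
`(j, i, k)` is an oriented line. -/
def octCoeff (i j k : Fin 8) : ℤ :=
  if i = 0 then (if k = j then 1 else 0)
  else if j = 0 then (if k = i then 1 else 0)
  else if i = j then (if k = 0 then -1 else 0)
  else if FanoOriented i j k then 1
  else if FanoOriented j i k then -1
  else 0

/-- The multiplication of the Cayley algebra, extended bilinearly from the basis. -/
noncomputable def octMul (x y : Octonion) : Octonion :=
  WithLp.toLp 2 fun k => ∑ i, ∑ j, (octCoeff i j k : ℝ) * (x i * y j)

/-- The identification `ℂ ⊕ ℂ³ = 𝔒`, `a + m ↦ a + m₁ e₂ + m₂ e₄ + m₃ e₆`, where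
`ℂ = ℝ ⊕ ℝ e₁`, so that `(s + t e₁) e₂ = s e₂ + t e₃`, `(s + t e₁) e₄ = s e₄ + t e₅`,
`(s + t e₁) e₆ = s e₆ + t e₇`. -/
noncomputable def octOfComplex (a : ℂ) (m : Fin 3 → ℂ) : Octonion :=
  !₂[a.re, a.im, (m 0).re, (m 0).im, (m 1).re, (m 1).im, (m 2).re, (m 2).im]

/-! ### The group `G₂` -/

/-- `G₂`, the automorphism group of the Cayley algebra: the invertible real linear maps `α` of the
Cayley algebra with `α (x y) = (α x) (α y)`. As a subgroup of the group of units of the normed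
algebra of endomorphisms it carries the usual (subspace) topology. -/
def G2 : Subgroup (Octonion →L[ℝ] Octonion)ˣ where
  carrier := {α | ∀ x y : Octonion,
    (α : Octonion →L[ℝ] Octonion) (octMul x y) =
      octMul ((α : Octonion →L[ℝ] Octonion) x) ((α : Octonion →L[ℝ] Octonion) y)}
  one_mem' := fun _ _ => rfl
  mul_mem' := by
    intro a b ha hb x y
    have h1 := hb x y
    have h2 := ha ((b : Octonion →L[ℝ] Octonion) x) ((b : Octonion →L[ℝ] Octonion) y)
    simp only [Units.val_mul, mul_apply_eq_comp, h1, h2]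
  inv_mem' := by
    intro a ha x y
    have hl : ∀ z, (↑a⁻¹ : Octonion →L[ℝ] Octonion) ((a : Octonion →L[ℝ] Octonion) z) = z := by
      intro z
      rw [← mul_apply_eq_comp, Units.inv_mul, one_apply_eq_self]
    have hr : ∀ z, (a : Octonion →L[ℝ] Octonion) ((↑a⁻¹ : Octonion →L[ℝ] Octonion) z) = z := by
      intro z
      rw [← mul_apply_eq_comp, Units.mul_inv, one_apply_eq_self]
    have h := ha ((↑a⁻¹ : Octonion →L[ℝ] Octonion) x) ((↑a⁻¹ : Octonion →L[ℝ] Octonion) y)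
    rw [hr, hr] at h
    rw [← h, hl]

/-- The linear map of the Cayley algebra underlying an element of `G₂`. -/
def G2.toEnd (α : G2) : Octonion →L[ℝ] Octonion := ((α : (Octonion →L[ℝ] Octonion)ˣ) : _)

/-- The isotropy subgroup `{α ∈ G₂ | α e₁ = e₁}`. -/
def G2.isotropy : Subgroup G2 where
  carrier := {α | G2.toEnd α (octBasis 1) = octBasis 1}
  one_mem' := rfl
  mul_mem' := by
    intro a b ha hb
    have ha' : G2.toEnd a (octBasis 1) = octBasis 1 := ha
    have hb' : G2.toEnd b (octBasis 1) = octBasis 1 := hb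
    change G2.toEnd a (G2.toEnd b (octBasis 1)) = octBasis 1
    rw [hb', ha']
  inv_mem' := by
    intro a ha
    have ha' : G2.toEnd a (octBasis 1) = octBasis 1 := ha
    have h : G2.toEnd a⁻¹ (G2.toEnd a (octBasis 1)) = octBasis 1 := by
      change ((↑(a : (Octonion →L[ℝ] Octonion)ˣ)⁻¹ : Octonion →L[ℝ] Octonion) *
        (a : (Octonion →L[ℝ] Octonion)ˣ)) (octBasis 1) = octBasis 1
      rw [Units.inv_mul, one_apply_eq_self]
    rwa [ha'] at h

/-! ### Simple Lie groups -/

/-- A smooth real Lie group is smooth enough to have a Lie algebra. -/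
theorem LieGroup.of_infty_minSmoothness {E H : Type*} [NormedAddCommGroup E] [NormedSpace ℝ E]
    [TopologicalSpace H] (I : ModelWithCorners ℝ E H) (G : Type*) [TopologicalSpace G]
    [ChartedSpace H G] [Group G] [LieGroup I ∞ G] : LieGroup I (minSmoothness ℝ 3) G := by
  rw [minSmoothness_of_isRCLikeNormedField]
  infer_instance

/-- A real Lie group is simple if it is connected and its Lie algebra is simple (that is,
non-abelian without proper non-zero ideals). -/
def IsSimpleLieGroup {E H : Type*} [NormedAddCommGroup E] [NormedSpace ℝ E] [CompleteSpace E]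
    [TopologicalSpace H] (I : ModelWithCorners ℝ E H) (G : Type*) [TopologicalSpace G]
    [ChartedSpace H G] [Group G] [LieGroup I ∞ G] : Prop :=
  haveI : LieGroup I (minSmoothness ℝ 3) G := LieGroup.of_infty_minSmoothness I G
  ConnectedSpace G ∧ LieAlgebra.IsSimple ℝ (GroupLieAlgebra I G)

/-! The source of everything is the identity x² = 2x₀x − ‖x‖² (`octMul_self`). It lets the
multiplication determine real part and norm, so unital endomorphisms are isometries; hence `G2` is
closed and bounded among the endomorphisms, and it acts on the unit sphere S⁶ of the imaginary
octonions. By the Moufang identities, conjugation by a with a² = a − 1 (so a³ = −1) is an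
automorphism (`octConj_octMul`). It rotates e₁ by 120° about an axis, and solving for the axis gives
an explicit continuous section of α ↦ α e₁ over the points of first coordinate above −1/2. With a
sign change this yields transitivity, and compactness turns the orbit bijection into a
homeomorphism.

On ℂ ⊕ ℂ³ the product is built from the Hermitian form and the conjugated cross product
(`octMul_octOfComplex`). An automorphism fixing e₁ is therefore complex linear on ℂ³ and preserves
both; the form makes it unitary and the cross product makes its determinant 1. The converse is a
computation.

Simple connectedness comes from `SimplyConnectedSpace.of_sphere_action`: if the orbit map onto a
sphere has sections over two overlapping caps, the group is the union of two open sets of the form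
cap × isotropy group, with path connected intersection, and `SimplyConnectedSpace.of_union` applies.
Induction from SU(1) reaches SU(3), and one more application reaches `G2`.

For the Lie structure, exponentials of derivations are automorphisms, and small logarithms of
automorphisms are derivations (`eventually_derivationDefect_eq_zero`). Logarithmic coordinates and
their left translates thus form an atlas (`exists_lieGroup_of_exp`), and
`mfderiv_bracket_eq_commutator` identifies the Lie algebra with `octDer` under the commutator.
Simplicity is `octDer_le_of_ideal`: the derivations `innerDer a b` with imaginary a, b span
`octDer`, and since 7 is odd a nonzero derivation kills some imaginary unit, which puts one nonzero
`innerDer v b` in any nonzero ideal; further brackets produce all the others. -/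

/-! ### Simple connectedness of a union of two simply connected open sets -/

section VanKampen

variable {X : Type*} [TopologicalSpace X]

/-- A section of the spaces of homotopy classes of paths from `x₀` that is compatible with small
paths is compatible with all paths. -/
theorem Path.Homotopic.Quotient.trans_eq_of_open_cover {ι : Type*} {W : ι → Set X}
    (hW : ∀ i, IsOpen (W i)) (hcov : ∀ x, ∃ i, x ∈ W i) {x₀ : X}
    (c : ∀ x, Path.Homotopic.Quotient x₀ x)
    (hc : ∀ i x y (p : Path x y), Set.range p ⊆ W i → (c x).trans (.mk p) = c y)
    {x y : X} (p : Path x y) : (c x).trans (.mk p) = c y := by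
  -- A Lebesgue subdivision cuts the path into pieces that each lie in one member of the cover.
  obtain ⟨t, ht0, htm, ⟨n, hn⟩, ht⟩ := exists_monotone_Icc_subset_open_cover_unitInterval
    (c := fun i => p ⁻¹' W i) (fun i => (hW i).preimage p.continuous)
    (fun s _ => by simpa using hcov (p s))
  have key : ∀ k, (c (p (t 0))).trans (.mk (p.subpath (t 0) (t k))) = c (p (t k)) := by
    intro k
    induction k with
    | zero => rw [Path.subpath_self, Path.Homotopic.Quotient.mk_refl,
        Path.Homotopic.Quotient.trans_refl]
    | succ k ih =>
      obtain ⟨i, hi⟩ := ht k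
      have h2 : Path.Homotopic.Quotient.mk (p.subpath (t 0) (t (k + 1))) =
          (Path.Homotopic.Quotient.mk (p.subpath (t 0) (t k))).trans
            (.mk (p.subpath (t k) (t (k + 1)))) := by
        rw [← Path.Homotopic.Quotient.mk_trans, Path.Homotopic.Quotient.eq]
        exact ⟨(Path.Homotopy.subpathTransSubpath p _ _ _).symm⟩
      rw [h2, ← Path.Homotopic.Quotient.trans_assoc, ih]
      refine hc i _ _ _ ?_
      rw [Path.range_subpath_of_le _ _ _ (htm (Nat.le_succ k))]
      exact Set.image_subset_iff.2 hi
  -- The equalities t 0 = 0 and t n = 1 are only propositional, while the endpoints occur in types;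
  -- with the parameters generalized they can be substituted.
  have key' : ∀ a b : unitInterval, a = 0 → b = 1 →
      (c (p a)).trans (.mk (p.subpath a b)) = c (p b) →
      (c x).trans (.mk p) = c y := by
    rintro _ _ rfl rfl h
    rw [Path.subpath_zero_one] at h
    obtain ⟨f, h0, h1⟩ := p
    subst h0 h1
    exact h
  exact key' _ _ ht0 (hn n le_rfl) (key n)

theorem IsSimplyConnected.homotopic_of_range_subset {U : Set X} (hU : IsSimplyConnected U)
    {x y : X} (p q : Path x y) (hp : Set.range p ⊆ U) (hq : Set.range q ⊆ U) :
    p.Homotopic q := by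
  have := hU.simplyConnectedSpace
  have hp' : ∀ t, p t ∈ U := fun t => hp ⟨t, rfl⟩
  have hq' : ∀ t, q t ∈ U := fun t => hq ⟨t, rfl⟩
  have hx : x ∈ U := by simpa using hp' 0
  have hy : y ∈ U := by simpa using hp' 1
  let p' : Path (⟨x, hx⟩ : U) ⟨y, hy⟩ :=
    { toFun := fun t => ⟨p t, hp' t⟩
      source' := by simp
      target' := by simp }
  let q' : Path (⟨x, hx⟩ : U) ⟨y, hy⟩ :=
    { toFun := fun t => ⟨q t, hq' t⟩
      source' := by simp
      target' := by simp }
  exact (SimplyConnectedSpace.paths_homotopic p' q').map ⟨Subtype.val, continuous_subtype_val⟩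

/-- A space that is the union of two simply connected open subsets with path connected
intersection is simply connected. -/
theorem SimplyConnectedSpace.of_union {U V : Set X} (hUo : IsOpen U) (hVo : IsOpen V)
    (hU : IsSimplyConnected U) (hV : IsSimplyConnected V) (hUV : IsPathConnected (U ∩ V))
    (hcov : U ∪ V = Set.univ) : SimplyConnectedSpace X := by
  obtain ⟨x₀, hx₀⟩ := hUV.nonempty
  have hcov' : ∀ x, x ∈ U ∨ x ∈ V := fun x => by
    have : x ∈ U ∪ V := hcov ▸ Set.mem_univ x
    exact this
  -- The section: all paths from x₀ to x that stay in one of the two sets have the same class. For a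
  -- path in each set, a third path inside the intersection is homotopic to both.
  have hex : ∀ x, ∃ q : Path.Homotopic.Quotient x₀ x, ∀ p : Path x₀ x,
      (Set.range p ⊆ U ∨ Set.range p ⊆ V) → .mk p = q := by
    have main : ∀ (A B : Set X), IsSimplyConnected A → IsSimplyConnected B →
        IsPathConnected (A ∩ B) → x₀ ∈ A ∩ B → ∀ x ∈ A,
        ∃ q : Path.Homotopic.Quotient x₀ x, ∀ p : Path x₀ x,
          (Set.range p ⊆ A ∨ Set.range p ⊆ B) → .mk p = q := by
      intro A B hA hB hAB h0 x hx
      obtain ⟨r, hr⟩ := hA.isPathConnected.joinedIn x₀ h0.1 x hx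
      refine ⟨.mk r, fun p hp => ?_⟩
      rcases hp with hp | hp
      · exact (Path.Homotopic.Quotient.eq).2
          (hA.homotopic_of_range_subset p r hp (Set.range_subset_iff.2 hr))
      · have hxB : x ∈ B := by simpa using hp ⟨1, rfl⟩
        obtain ⟨s, hs⟩ := hAB.joinedIn x₀ h0 x ⟨hx, hxB⟩
        exact (Path.Homotopic.Quotient.eq).2
          ((hB.homotopic_of_range_subset p s hp (Set.range_subset_iff.2 fun t => (hs t).2)).trans
          (hA.homotopic_of_range_subset s r (Set.range_subset_iff.2 fun t => (hs t).1)
            (Set.range_subset_iff.2 hr)))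
    intro x
    rcases hcov' x with hx | hx
    · exact main U V hU hV hUV hx₀ x hx
    · obtain ⟨q, hq⟩ := main V U hV hU (Set.inter_comm U V ▸ hUV) hx₀.symm x hx
      exact ⟨q, fun p hp => hq p hp.symm⟩
  choose c hc using hex
  have step : ∀ {x y : X} (p : Path x y), (c x).trans (.mk p) = c y := by
    intro x y p
    refine Path.Homotopic.Quotient.trans_eq_of_open_cover (W := fun b : Bool => cond b U V)
      (by rintro (_ | _) <;> assumption)
      (fun x => (hcov' x).elim (fun h => ⟨true, h⟩) fun h => ⟨false, h⟩) c ?_ p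
    have main : ∀ A : Set X, IsPathConnected A → x₀ ∈ A → (A = U ∨ A = V) →
        ∀ (x y : X) (p : Path x y), Set.range p ⊆ A → (c x).trans (.mk p) = c y := by
      intro A hA h0 hAUV x y p hp
      obtain ⟨r, hr⟩ := hA.joinedIn x₀ h0 x (by simpa using hp ⟨0, rfl⟩)
      have hr' : Set.range r ⊆ A := Set.range_subset_iff.2 hr
      rw [← hc x r (by rcases hAUV with rfl | rfl <;> simp [hr']),
        ← hc y (r.trans p) ?_, Path.Homotopic.Quotient.mk_trans]
      have : Set.range (r.trans p) ⊆ A := by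
        rw [Path.trans_range]; exact Set.union_subset hr' hp
      rcases hAUV with rfl | rfl <;> simp [this]
    rintro (_ | _) x y p hp
    · exact main V hV.isPathConnected hx₀.2 (Or.inr rfl) x y p hp
    · exact main U hU.isPathConnected hx₀.1 (Or.inl rfl) x y p hp
  rw [simply_connected_iff_paths_homotopic']
  refine ⟨?_, fun {x y} p q => ?_⟩
  · rw [pathConnectedSpace_iff_univ, ← hcov]
    exact hU.isPathConnected.union hV.isPathConnected hUV.nonempty
  -- Both classes solve c x · [p] = c y, and c x cancels.
  · have h : (c x).trans (.mk p) = (c x).trans (.mk q) := (step p).trans (step q).symm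
    have h' := congrArg (fun z => (c x).symm.trans z) h
    simp only [← Path.Homotopic.Quotient.trans_assoc, Path.Homotopic.Quotient.symm_trans,
      Path.Homotopic.Quotient.refl_trans] at h'
    exact (Path.Homotopic.Quotient.eq).1 h'

instance SimplyConnectedSpace.prod {Y : Type*} [TopologicalSpace Y] [SimplyConnectedSpace X]
    [SimplyConnectedSpace Y] : SimplyConnectedSpace (X × Y) := by
  rw [simply_connected_iff_paths_homotopic']
  refine ⟨inferInstance, fun {x y} p q => ?_⟩
  obtain ⟨F⟩ := SimplyConnectedSpace.paths_homotopic (p.map continuous_fst) (q.map continuous_fst)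
  obtain ⟨G⟩ := SimplyConnectedSpace.paths_homotopic (p.map continuous_snd) (q.map continuous_snd)
  exact ⟨Path.Homotopic.prodHomotopy F G⟩

end VanKampen

/-! ### Groups acting transitively on spheres -/

section SphereAction

open scoped RealInnerProductSpace

variable {E : Type*} [NormedAddCommGroup E] [InnerProductSpace ℝ E]

/-- The open cap of the unit sphere about `e`, of the points at height more than `-c`. -/
def sphereCap (e : E) (c : ℝ) : Set E := {v | ‖v‖ = 1 ∧ -c < ⟪e, v⟫}

theorem ContractibleSpace.of_retract {X Y : Type*} [TopologicalSpace X] [TopologicalSpace Y]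
    [ContractibleSpace X] (r : C(X, Y)) (i : C(Y, X)) (h : ∀ y, r (i y) = y) :
    ContractibleSpace Y := by
  rw [contractible_iff_id_nullhomotopic]
  have h1 := ((id_nullhomotopic X).comp_right r).comp_left i
  have h2 : (r.comp (ContinuousMap.id X)).comp i = ContinuousMap.id Y := by
    ext y; exact h y
  rwa [h2] at h1

/-- The triangle inequality gives −c‖ae + bx‖ ≤ ca − cb‖x‖, and c ≤ 1 bounds ca by a. Convexity
itself can fail: for c = 1 the cone is the complement of the closed ray opposite to e. -/
theorem starConvex_cone {e : E} (he : ‖e‖ = 1) {c : ℝ} (hc : 0 < c) (hc1 : c ≤ 1) :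
    StarConvex ℝ e {x : E | -c * ‖x‖ < ⟪e, x⟫} := by
  intro x hx a b ha hb hab
  simp only [Set.mem_ofPred_eq] at hx ⊢
  rw [inner_add_right, inner_smul_right, inner_smul_right, real_inner_self_eq_norm_sq, he]
  have h1 : ‖b • x‖ ≤ ‖a • e + b • x‖ + ‖a • e‖ := by
    have := norm_sub_le (a • e + b • x) (a • e)
    rwa [add_sub_cancel_left] at this
  rw [norm_smul, norm_smul, he, Real.norm_of_nonneg ha, Real.norm_of_nonneg hb] at h1
  rcases hb.eq_or_lt with rfl | hb'
  · have : a = 1 := by linarith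
    subst this
    simp only [one_smul, zero_smul, add_zero, he]
    linarith
  · have := mul_lt_mul_of_pos_left hx hb'
    nlinarith [mul_le_mul_of_nonneg_left h1 hc.le]

/-- Radial projection retracts the star-shaped cone onto the cap, so the cap is even contractible.
-/
theorem isSimplyConnected_sphereCap {e : E} (he : ‖e‖ = 1) {c : ℝ} (hc : 0 < c) (hc1 : c ≤ 1) :
    IsSimplyConnected (sphereCap e c) := by
  have hne : ({x : E | -c * ‖x‖ < ⟪e, x⟫}).Nonempty :=
    ⟨e, by simp [he]; linarith⟩
  have := (starConvex_cone he hc hc1).contractibleSpace hne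
  have h0 : ∀ x : E, -c * ‖x‖ < ⟪e, x⟫ → ‖x‖ ≠ 0 := by
    intro x hx h
    rw [norm_eq_zero] at h
    simp [h] at hx
  let r : C({x : E | -c * ‖x‖ < ⟪e, x⟫}, sphereCap e c) :=
    { toFun := fun x => ⟨‖(x : E)‖⁻¹ • (x : E), by
        have h := h0 x x.2
        have hp : 0 < ‖(x : E)‖ := lt_of_le_of_ne (norm_nonneg _) h.symm
        refine ⟨by rw [norm_smul, norm_inv, norm_norm, inv_mul_cancel₀ h], ?_⟩
        rw [inner_smul_right]
        have := mul_lt_mul_of_pos_left x.2 (inv_pos.2 hp)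
        calc -c = ‖(x : E)‖⁻¹ * (-c * ‖(x : E)‖) := by field_simp
          _ < _ := this⟩
      continuous_toFun := by
        refine Continuous.subtype_mk (Continuous.smul ?_ continuous_subtype_val) _
        exact (continuous_subtype_val.norm).inv₀ fun x => h0 x x.2 }
  let i : C(sphereCap e c, {x : E | -c * ‖x‖ < ⟪e, x⟫}) :=
    { toFun := fun v => ⟨v, by
        have h := v.2
        simp only [sphereCap, Set.mem_ofPred_eq] at h ⊢
        rw [h.1, mul_one]; exact h.2⟩
      continuous_toFun := by fun_prop }
  have : ContractibleSpace (sphereCap e c) := ContractibleSpace.of_retract r i fun v => by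
    apply Subtype.ext
    change ‖(v : E)‖⁻¹ • (v : E) = v
    rw [v.2.1, inv_one, one_smul]
  exact SimplyConnectedSpace.ofContractible _

/-- The intersection is the band of heights strictly between −c and c. It is a continuous image of
the complement of the line ℝe, which is path connected because that line has codimension at least
two. -/
theorem isPathConnected_sphereCap_inter (hE : 3 ≤ Module.rank ℝ E) {e : E} (he : ‖e‖ = 1) {c : ℝ}
    (hc : 0 < c) (hc1 : c ≤ 1) :
    IsPathConnected (sphereCap e c ∩ sphereCap (-e) c) := by
  set L : Submodule ℝ E := Submodule.span ℝ {e}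
  have hL : 1 < Module.rank ℝ (E ⧸ L) := by
    have h1 := Submodule.rank_quotient_add_rank L
    have h2 : Module.rank ℝ L ≤ 1 := rank_span_le _ |>.trans (by simp)
    by_contra hcon
    rw [not_lt] at hcon
    have h3 : Module.rank ℝ E ≤ 1 + 1 := h1 ▸ add_le_add hcon h2
    have h4 := hE.trans h3
    norm_num at h4
  have hpc := isPathConnected_compl_of_one_lt_codim hL
  let w : E → E := fun x => x - ⟪e, x⟫ • e
  have hee : ⟪e, e⟫ = 1 := by rw [real_inner_self_eq_norm_sq, he]; norm_num
  have hw : ∀ x, ⟪e, w x⟫ = 0 := fun x => by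
    simp [w, inner_sub_right, inner_smul_right, he]
  have hw0 : ∀ x, x ∉ L → ‖w x‖ ≠ 0 := by
    intro x hx h
    rw [norm_eq_zero, sub_eq_zero] at h
    exact hx (Submodule.mem_span_singleton.2 ⟨_, h.symm⟩)
  have hx0 : ∀ x, x ∉ L → ‖x‖ ≠ 0 := by
    intro x hx h
    rw [norm_eq_zero] at h
    exact hx (h ▸ L.zero_mem)
  have hpyth : ∀ (h : ℝ) (u : E), ⟪e, u⟫ = 0 → ‖h • e + u‖ ^ 2 = h ^ 2 + ‖u‖ ^ 2 := by
    intro h u hu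
    rw [norm_add_sq_real, inner_smul_left, hu, norm_smul, he]; simp
  have hlt : ∀ x, x ∉ L → (⟪e, x⟫ / ‖x‖) ^ 2 < 1 := by
    intro x hx
    have h1 := hpyth ⟪e, x⟫ (w x) (hw x)
    rw [show ⟪e, x⟫ • e + w x = x by simp [w]] at h1
    rw [div_pow, div_lt_one (by have := hx0 x hx; positivity), h1]
    have := hw0 x hx
    have : 0 < ‖w x‖ ^ 2 := by positivity
    linarith
  -- Normalize x, multiply its height by c, keep the direction of its component orthogonal to e, and
  -- rescale that component to return to the unit sphere.
  let f : E → E := fun x => (c * (⟪e, x⟫ / ‖x‖)) • e +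
    (√(1 - (c * (⟪e, x⟫ / ‖x‖)) ^ 2) / ‖w x‖) • w x
  have hf : ContinuousOn f (L : Set E)ᶜ := by
    have h1 : ContinuousOn (fun x : E => ⟪e, x⟫ / ‖x‖) (L : Set E)ᶜ :=
      ContinuousOn.div (by fun_prop) (by fun_prop) fun x hx => hx0 x hx
    have h2 : Continuous w := by fun_prop
    refine ContinuousOn.add ((h1.const_smul c).smul continuousOn_const) ?_
    refine ContinuousOn.smul (ContinuousOn.div ?_ (by fun_prop) fun x hx => hw0 x hx) (by fun_prop)
    refine Real.continuous_sqrt.comp_continuousOn ?_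
    exact continuousOn_const.sub ((h1.const_smul c).pow 2)
  convert hpc.image' hf using 1
  have hfe : ∀ x, ⟪e, f x⟫ = c * (⟪e, x⟫ / ‖x‖) := fun x => by
    simp [f, inner_add_right, inner_smul_right, hw, he]
  ext v
  simp only [sphereCap, Set.mem_inter_iff, Set.mem_ofPred_eq, Set.mem_image, inner_neg_left,
    neg_lt_neg_iff]
  constructor
  · rintro ⟨⟨hv, h1⟩, -, h2⟩
    set h := ⟪e, v⟫
    have hh : h ^ 2 < c ^ 2 := by nlinarith
    have hwn : ‖w v‖ ^ 2 = 1 - h ^ 2 := by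
      have h1 := hpyth h (w v) (hw v)
      rw [show h • e + w v = v by simp [w, h], hv] at h1
      linarith
    have hwv : 0 < ‖w v‖ := by
      have : 0 < ‖w v‖ ^ 2 := by rw [hwn]; nlinarith
      exact lt_of_le_of_ne (norm_nonneg _) fun h0 => by rw [← h0] at this; norm_num at this
    have hk : 0 < √(1 - (h / c) ^ 2) := by
      apply Real.sqrt_pos.2
      rw [sub_pos, div_pow, div_lt_one (by positivity)]; exact hh
    set k := √(1 - (h / c) ^ 2) / ‖w v‖
    have hkp : 0 < k := div_pos hk hwv
    -- A preimage of v: the unit vector of height h / c with the same horizontal direction as v.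
    let x : E := (h / c) • e + k • w v
    have hex : ⟪e, x⟫ = h / c := by simp [x, inner_add_right, inner_smul_right, hw, he]
    have hwx : w x = k • w v := by
      simp only [w] at hex ⊢
      rw [hex]; simp only [x, w]; abel
    have hxn : ‖x‖ = 1 := by
      have h1 := hpyth (h / c) (k • w v) (by rw [inner_smul_right, hw, mul_zero])
      rw [norm_smul, Real.norm_of_nonneg hkp.le, div_mul_cancel₀ _ hwv.ne',
        Real.sq_sqrt (Real.sqrt_pos.1 hk).le] at h1
      rw [← sq_eq_sq₀ (norm_nonneg _) zero_le_one]
      change ‖x‖ ^ 2 = _ at h1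
      rw [h1]; ring
    refine ⟨x, fun hxL => ?_, ?_⟩
    · obtain ⟨a, ha⟩ := Submodule.mem_span_singleton.1 hxL
      have : w x = 0 := by rw [← ha]; simp [w, inner_smul_right, he]
      rw [hwx, smul_eq_zero] at this
      rcases this with h' | h'
      · exact hkp.ne' h'
      · rw [h', norm_zero] at hwv; exact lt_irrefl _ hwv
    · simp only [f]
      rw [hex, hxn, hwx, div_one, mul_div_cancel₀ _ hc.ne', norm_smul, Real.norm_of_nonneg hkp.le,
        ← hwn, Real.sqrt_sq hwv.le, smul_smul, div_mul_eq_mul_div, mul_comm k,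
        div_self (mul_pos hwv hkp).ne', one_smul]
      simp [w, h]
  · rintro ⟨x, hx, rfl⟩
    have hl := hlt x hx
    set q := ⟪e, x⟫ / ‖x‖
    have hq1 : q < 1 := by nlinarith
    have hq2 : -1 < q := by nlinarith
    have hn : ‖f x‖ = 1 := by
      have hwx : 0 < ‖w x‖ := lt_of_le_of_ne (norm_nonneg _) (hw0 x hx).symm
      have h1 := hpyth (c * q) ((√(1 - (c * q) ^ 2) / ‖w x‖) • w x)
        (by rw [inner_smul_right, hw, mul_zero])
      rw [norm_smul, Real.norm_of_nonneg (by positivity), div_mul_cancel₀ _ hwx.ne',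
        Real.sq_sqrt (by rw [mul_pow]; nlinarith [sq_nonneg q, sq_nonneg c, mul_pos hc hc])] at h1
      rw [← sq_eq_sq₀ (norm_nonneg _) zero_le_one]
      change ‖f x‖ ^ 2 = _ at h1
      rw [h1]; ring
    rw [hfe]
    exact ⟨⟨hn, by nlinarith⟩, hn, by nlinarith⟩

variable {G : Type*} [Group G] [TopologicalSpace G] [IsTopologicalGroup G]

/-- A continuous section of an orbit map over `W` trivializes it over `W`. -/
def orbitTrivialization (ρ : G →* (E →L[ℝ] E)) {e : E} (hcont : Continuous fun g => ρ g e)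
    (H : Subgroup G) (hH : ∀ g, g ∈ H ↔ ρ g e = e) {W : Set E} {s : E → G} (hs : ContinuousOn s W)
    (hsW : ∀ v ∈ W, ρ (s v) e = v) :
    {g | ρ g e ∈ W} ≃ₜ W × H where
  toFun g := (⟨ρ g e, g.2⟩, ⟨(s (ρ g e))⁻¹ * g, by
    have h := hsW _ g.2
    rw [hH, map_mul, mul_apply_eq_comp]
    conv_lhs => arg 2; rw [← h]
    rw [← mul_apply_eq_comp, ← map_mul, inv_mul_cancel, map_one, one_apply_eq_self]⟩)
  invFun p := ⟨s p.1 * p.2, by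
    change ρ (s p.1 * p.2) e ∈ W
    rw [map_mul, mul_apply_eq_comp, (hH _).1 p.2.2, hsW _ p.1.2]
    exact p.1.2⟩
  left_inv g := Subtype.ext (mul_inv_cancel_left _ _)
  right_inv p := by
    have : ρ (s p.1 * p.2) e = p.1 := by
      rw [map_mul, mul_apply_eq_comp, (hH _).1 p.2.2, hsW _ p.1.2]
    refine Prod.ext (Subtype.ext this) (Subtype.ext ?_)
    change (s (ρ (s p.1 * p.2) e))⁻¹ * (s p.1 * p.2) = p.2
    rw [this, inv_mul_cancel_left]
  continuous_toFun := by
    have h1 : Continuous fun g : {g | ρ g e ∈ W} => ρ (g : G) e :=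
      hcont.comp continuous_subtype_val
    refine Continuous.prodMk (h1.subtype_mk _) (Continuous.subtype_mk ?_ _)
    exact (hs.comp_continuous h1 fun g => g.2).inv.mul continuous_subtype_val
  continuous_invFun := by
    refine Continuous.subtype_mk ?_ _
    exact (hs.comp_continuous (continuous_subtype_val.comp continuous_fst) fun p => p.1.2).mul
      (continuous_subtype_val.comp continuous_snd)

/-- A topological group acting on a sphere of dimension at least two, with local sections over
large caps and a simply connected isotropy subgroup, is simply connected. -/
theorem SimplyConnectedSpace.of_sphere_action (hE : 3 ≤ Module.rank ℝ E)
    (ρ : G →* (E →L[ℝ] E)) (hρ : ∀ g v, ‖ρ g v‖ = ‖v‖) {e : E} (he : ‖e‖ = 1)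
    (hcont : Continuous fun g => ρ g e) (H : Subgroup G) (hH : ∀ g, g ∈ H ↔ ρ g e = e)
    [SimplyConnectedSpace H] {c : ℝ} (hc : 0 < c) (hc1 : c ≤ 1) {s : E → G}
    (hs : ContinuousOn s (sphereCap e c)) (hse : ∀ v ∈ sphereCap e c, ρ (s v) e = v)
    {g₀ : G} (hg₀ : ρ g₀ e = -e) : SimplyConnectedSpace G := by
  have hg₀' : ρ g₀⁻¹ (-e) = e := by
    rw [← hg₀, ← mul_apply_eq_comp, ← map_mul, inv_mul_cancel, map_one, one_apply_eq_self]
  have hinner : ∀ g v w, ⟪ρ g v, ρ g w⟫ = ⟪v, w⟫ := fun g v w => by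
    rw [real_inner_eq_norm_add_mul_self_sub_norm_mul_self_sub_norm_mul_self_div_two,
      real_inner_eq_norm_add_mul_self_sub_norm_mul_self_sub_norm_mul_self_div_two, ← map_add,
      hρ, hρ, hρ]
  have hmaps : Set.MapsTo (ρ g₀⁻¹) (sphereCap (-e) c) (sphereCap e c) := by
    rintro v ⟨hv, h⟩
    refine ⟨by rw [hρ, hv], ?_⟩
    rwa [← hg₀', hinner]
  -- Conjugating by g₀, which takes e to −e, moves the section to the opposite cap.
  have hs' : ContinuousOn (fun v => g₀ * s (ρ g₀⁻¹ v)) (sphereCap (-e) c) :=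
    continuousOn_const.mul (hs.comp (ρ g₀⁻¹).continuous.continuousOn hmaps)
  have hse' : ∀ v ∈ sphereCap (-e) c, ρ (g₀ * s (ρ g₀⁻¹ v)) e = v := by
    intro v hv
    rw [map_mul, mul_apply_eq_comp, hse _ (hmaps hv), ← mul_apply_eq_comp, ← map_mul,
      mul_inv_cancel, map_one, one_apply_eq_self]
  have hsph : ∀ g, ‖ρ g e‖ = 1 := fun g => by rw [hρ, he]
  have hopen : ∀ a : E, IsOpen {g | ρ g e ∈ sphereCap a c} := by
    intro a
    have : {g | ρ g e ∈ sphereCap a c} = {g | -c < ⟪a, ρ g e⟫} := by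
      ext g; simp [sphereCap, hsph]
    rw [this]
    exact isOpen_lt continuous_const (continuous_const.inner hcont)
  refine SimplyConnectedSpace.of_union (hopen e) (hopen (-e)) ?_ ?_ ?_ ?_
  · have := (isSimplyConnected_sphereCap he hc hc1).simplyConnectedSpace
    exact (orbitTrivialization ρ hcont H hH hs hse).toHomotopyEquiv.simplyConnectedSpace
  · have := (isSimplyConnected_sphereCap (e := -e) (by rwa [norm_neg]) hc hc1).simplyConnectedSpace
    exact (orbitTrivialization ρ hcont H hH hs' hse').toHomotopyEquiv.simplyConnectedSpace
  -- Over the band the preimage is band × H; here path connectedness of H is enough.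
  · have := isPathConnected_iff_pathConnectedSpace.1 (isPathConnected_sphereCap_inter hE he hc hc1)
    have h := orbitTrivialization ρ hcont H hH (hs.mono Set.inter_subset_left)
      (W := sphereCap e c ∩ sphereCap (-e) c) fun v hv => hse v hv.1
    have hpc : PathConnectedSpace {g | ρ g e ∈ sphereCap e c ∩ sphereCap (-e) c} :=
      h.symm.surjective.pathConnectedSpace h.symm.continuous
    exact isPathConnected_iff_pathConnectedSpace.2 hpc
  -- The two caps cover the sphere because c > 0.
  · rw [Set.eq_univ_iff_forall]
    intro g
    by_cases h : -c < ⟪e, ρ g e⟫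
    · exact Or.inl ⟨hsph g, h⟩
    · refine Or.inr ⟨hsph g, ?_⟩
      rw [inner_neg_left]; linarith [not_lt.1 h]

end SphereAction

/-! ### The special unitary groups -/

section SpecialUnitary

open Matrix
open scoped RealInnerProductSpace

instance Matrix.specialUnitaryGroup.instIsTopologicalGroup (n : Type*) [Fintype n]
    [DecidableEq n] : IsTopologicalGroup (specialUnitaryGroup n ℂ) where
  continuous_mul := by
    refine Continuous.subtype_mk ?_ _
    exact (continuous_subtype_val.comp continuous_fst).matrix_mul
      (continuous_subtype_val.comp continuous_snd)
  continuous_inv := by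
    refine Continuous.subtype_mk ?_ _
    exact continuous_subtype_val.matrix_conjTranspose

instance Matrix.specialUnitaryGroup.instCompactSpace (n : Type*) [Fintype n]
    [DecidableEq n] : CompactSpace (specialUnitaryGroup n ℂ) := by
  refine isCompact_iff_compactSpace.1 (IsCompact.of_isClosed_subset
    (isCompact_univ_pi fun _ : n => isCompact_univ_pi fun _ : n =>
      isCompact_closedBall (0 : ℂ) 1) ?_ ?_)
  · have h : ((specialUnitaryGroup n ℂ : Submonoid (Matrix n n ℂ)) : Set (Matrix n n ℂ)) =
        {A | A * star A = 1} ∩ {A | A.det = 1} := by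
      ext A
      simp [mem_specialUnitaryGroup_iff, mem_unitaryGroup_iff]
    rw [h]
    refine (isClosed_eq ?_ continuous_const).inter (isClosed_eq ?_ continuous_const)
    · exact continuous_id.matrix_mul continuous_id.matrix_conjTranspose
    · exact continuous_id.matrix_det
  · intro A hA
    exact fun i _ j _ => mem_closedBall_zero_iff.2
      (entry_norm_bound_of_unitary (specialUnitaryGroup_le_unitaryGroup hA) i j)

variable {n : ℕ}

/-- The standard representation of the special unitary group, as real linear maps. -/
noncomputable def specialUnitaryRep (n : ℕ) :
    specialUnitaryGroup (Fin n) ℂ →* (EuclideanSpace ℂ (Fin n) →L[ℝ] EuclideanSpace ℂ (Fin n)) where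
  toFun A := (toEuclideanCLM (𝕜 := ℂ) (A : Matrix (Fin n) (Fin n) ℂ)).restrictScalars ℝ
  map_one' := by ext1 v; simp
  map_mul' A B := by ext1 v; simp

theorem specialUnitaryRep_apply (A : specialUnitaryGroup (Fin n) ℂ)
    (v : EuclideanSpace ℂ (Fin n)) :
    specialUnitaryRep n A v = WithLp.toLp 2 ((A : Matrix (Fin n) (Fin n) ℂ) *ᵥ v) := rfl

theorem norm_specialUnitaryRep (A : specialUnitaryGroup (Fin n) ℂ)
    (v : EuclideanSpace ℂ (Fin n)) : ‖specialUnitaryRep n A v‖ = ‖v‖ := by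
  have h : inner ℂ (specialUnitaryRep n A v) (specialUnitaryRep n A v) = inner ℂ v v := by
    rw [specialUnitaryRep_apply, EuclideanSpace.inner_eq_star_dotProduct,
      EuclideanSpace.inner_eq_star_dotProduct, star_mulVec, dotProduct_comm,
      ← dotProduct_mulVec, mulVec_mulVec, dotProduct_comm]
    have : (A : Matrix (Fin n) (Fin n) ℂ)ᴴ * A = 1 := mem_unitaryGroup_iff'.1 A.2.1
    rw [this, one_mulVec]
  rw [inner_self_eq_norm_sq_to_K, inner_self_eq_norm_sq_to_K] at h
  have h' : ‖specialUnitaryRep n A v‖ ^ 2 = ‖v‖ ^ 2 := by exact_mod_cast h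
  exact (sq_eq_sq₀ (norm_nonneg _) (norm_nonneg _)).1 h'

/-- Correction of the determinant of a unitary matrix through its last column. -/
noncomputable def Matrix.detCorrection (M : Matrix (Fin (n + 2)) (Fin (n + 2)) ℂ) :
    Matrix (Fin (n + 2)) (Fin (n + 2)) ℂ :=
  M * diagonal (Function.update 1 (Fin.last (n + 1)) (star M.det))

theorem Matrix.detCorrection_mem {M : Matrix (Fin (n + 2)) (Fin (n + 2)) ℂ}
    (hM : M ∈ unitaryGroup (Fin (n + 2)) ℂ) :
    M.detCorrection ∈ specialUnitaryGroup (Fin (n + 2)) ℂ := by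
  have hdet := det_of_mem_unitary hM
  rw [mem_specialUnitaryGroup_iff]
  constructor
  · refine mul_mem hM ?_
    rw [mem_unitaryGroup_iff, star_eq_conjTranspose, diagonal_conjTranspose, diagonal_mul_diagonal,
      ← diagonal_one]
    congr 1
    funext i
    by_cases hi : i = Fin.last (n + 1)
    · subst hi; simpa using (Unitary.mem_iff.1 hdet).1
    · simp [Function.update_of_ne hi]
  · rw [detCorrection, det_mul, det_diagonal, Finset.prod_update_of_mem (Finset.mem_univ _)]
    simpa using (Unitary.mem_iff.1 hdet).2

theorem Matrix.detCorrection_mulVec_single (M : Matrix (Fin (n + 2)) (Fin (n + 2)) ℂ) :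
    M.detCorrection *ᵥ Pi.single 0 1 = M *ᵥ Pi.single 0 1 := by
  rw [detCorrection, ← mulVec_mulVec]
  congr 1
  ext i
  rw [mulVec_diagonal]
  by_cases hi : i = Fin.last (n + 1)
  · subst hi; simp
  · simp [Function.update_of_ne hi]

/-- A complex reflection that takes the first basis vector to the unit vector `v`. -/
noncomputable def complexReflection (v : Fin (n + 2) → ℂ) :
    Matrix (Fin (n + 2)) (Fin (n + 2)) ℂ :=
  (1 + star (v 0))⁻¹ • vecMulVec (Pi.single 0 1 + v) (star (Pi.single 0 1 + v)) - 1

/-- With u = e₀ + v and λ = (1 + v̄₀)⁻¹, the matrix λuu* − 1 is unitary exactly when |λ|²‖u‖² = λ +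
λ̄. This holds since ‖u‖² = (1 + v₀) + (1 + v̄₀). The complex scalar λ is what allows v₀ to be
non-real. -/
theorem complexReflection_mem {v : Fin (n + 2) → ℂ} (hv : star v ⬝ᵥ v = 1)
    (h : 1 + v 0 ≠ 0) : complexReflection v ∈ unitaryGroup (Fin (n + 2)) ℂ := by
  have h' : 1 + star (v 0) ≠ 0 := by
    intro h0; apply h
    simpa using congrArg star h0
  set u : Fin (n + 2) → ℂ := Pi.single 0 1 + v with hu
  have huu : star u ⬝ᵥ u = (1 + v 0) + (1 + star (v 0)) := by
    simp only [hu, star_add, add_dotProduct, dotProduct_add, hv]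
    simp [Pi.star_single]
    ring
  rw [mem_unitaryGroup_iff, star_eq_conjTranspose, complexReflection, ← hu]
  simp only [conjTranspose_sub, conjTranspose_smul, conjTranspose_one, conjTranspose_vecMulVec,
    star_star, sub_mul, mul_sub, mul_one, one_mul, smul_mul_smul_comm, vecMulVec_mul_vecMulVec, huu]
  simp only [vecMulVec_smul, smul_smul, star_inv₀, star_add, star_one, star_star]
  rw [← sub_eq_zero]
  have : (1 + star (v 0))⁻¹ * (1 + v 0)⁻¹ * (1 + v 0 + (1 + star (v 0))) =
      (1 + star (v 0))⁻¹ + (1 + v 0)⁻¹ := by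
    field_simp
  rw [this, add_smul]
  abel

theorem complexReflection_mulVec_single {v : Fin (n + 2) → ℂ} (h : 1 + v 0 ≠ 0) :
    complexReflection v *ᵥ Pi.single 0 1 = v := by
  have h' : 1 + star (v 0) ≠ 0 := by
    intro h0; apply h
    simpa using congrArg star h0
  rw [complexReflection, sub_mulVec, smul_mulVec, vecMulVec_mulVec, one_mulVec]
  have : star (Pi.single 0 1 + v) ⬝ᵥ Pi.single 0 1 = 1 + star (v 0) := by simp
  rw [this]
  rw [op_smul_eq_smul, smul_smul, inv_mul_cancel₀ h', one_smul, add_sub_cancel_left]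

/-- The stabilizer of the first basis vector. -/
def specialUnitaryStabilizer (n : ℕ) : Subgroup (specialUnitaryGroup (Fin (n + 2)) ℂ) where
  carrier := {A | (A : Matrix (Fin (n + 2)) (Fin (n + 2)) ℂ) *ᵥ Pi.single 0 1 = Pi.single 0 1}
  one_mem' := by
    change (1 : Matrix (Fin (n + 2)) (Fin (n + 2)) ℂ) *ᵥ _ = _
    rw [one_mulVec]
  mul_mem' {A B} hA hB := by
    simp only [Set.mem_ofPred_eq] at hA hB ⊢
    rw [Submonoid.coe_mul, ← mulVec_mulVec, hB, hA]
  inv_mem' {A} hA := by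
    simp only [Set.mem_ofPred_eq] at hA ⊢
    conv_lhs => arg 2; rw [← hA]
    rw [mulVec_mulVec, ← Submonoid.coe_mul, inv_mul_cancel, OneMemClass.coe_one, one_mulVec]

/-- The block matrix with diagonal blocks `1` and `A`. -/
def Matrix.oneBlock {m : ℕ} (A : Matrix (Fin m) (Fin m) ℂ) :
    Matrix (Fin (m + 1)) (Fin (m + 1)) ℂ :=
  of (vecCons (vecCons 1 0) fun i => vecCons 0 (A i))

theorem Matrix.oneBlock_mul {m : ℕ} (A B : Matrix (Fin m) (Fin m) ℂ) :
    oneBlock (A * B) = oneBlock A * oneBlock B := by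
  ext i j
  refine Fin.cases ?_ (fun i => ?_) i <;> refine Fin.cases ?_ (fun j => ?_) j <;>
    simp [oneBlock, mul_apply, Fin.sum_univ_succ]

theorem Matrix.oneBlock_one {m : ℕ} : oneBlock (1 : Matrix (Fin m) (Fin m) ℂ) = 1 := by
  ext i j
  refine Fin.cases ?_ (fun i => ?_) i <;> refine Fin.cases ?_ (fun j => ?_) j <;>
    simp [oneBlock, one_apply, Fin.succ_ne_zero, (Fin.succ_ne_zero _).symm]

theorem Matrix.star_oneBlock {m : ℕ} (A : Matrix (Fin m) (Fin m) ℂ) :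
    star (oneBlock A) = oneBlock (star A) := by
  ext i j
  refine Fin.cases ?_ (fun i => ?_) i <;> refine Fin.cases ?_ (fun j => ?_) j <;>
    simp [oneBlock, star_apply]

theorem Matrix.det_oneBlock {m : ℕ} (A : Matrix (Fin m) (Fin m) ℂ) :
    (oneBlock A).det = A.det := by
  rw [det_succ_column_zero, Fin.sum_univ_succ]
  have : (oneBlock A).submatrix (Fin.succAbove 0) Fin.succ = A := by
    ext i j; simp [oneBlock]
  rw [this]
  simp [oneBlock]

theorem Matrix.oneBlock_mem {m : ℕ} {A : Matrix (Fin m) (Fin m) ℂ} :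
    oneBlock A ∈ specialUnitaryGroup (Fin (m + 1)) ℂ ↔ A ∈ specialUnitaryGroup (Fin m) ℂ := by
  have hinj : Function.Injective (oneBlock (m := m)) := fun A B h => by
    ext i j
    simpa [oneBlock] using congrFun₂ h i.succ j.succ
  rw [mem_specialUnitaryGroup_iff, mem_specialUnitaryGroup_iff, det_oneBlock,
    mem_unitaryGroup_iff, mem_unitaryGroup_iff, star_oneBlock, ← oneBlock_mul, ← oneBlock_one,
    hinj.eq_iff]

/-- The first column is e₀ by assumption; the first row is too, because the inverse, which is the
adjoint, also fixes e₀. -/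
theorem eq_oneBlock_of_mem_stabilizer {A : specialUnitaryGroup (Fin (n + 2)) ℂ}
    (hA : A ∈ specialUnitaryStabilizer n) :
    (A : Matrix (Fin (n + 2)) (Fin (n + 2)) ℂ) =
      oneBlock ((A : Matrix (Fin (n + 2)) (Fin (n + 2)) ℂ).submatrix Fin.succ Fin.succ) := by
  have h1 : ∀ i, (A : Matrix (Fin (n + 2)) (Fin (n + 2)) ℂ) i 0 =
      (Pi.single 0 1 : Fin (n + 2) → ℂ) i := fun i => by
    have h : (A : Matrix (Fin (n + 2)) (Fin (n + 2)) ℂ) *ᵥ Pi.single 0 1 = Pi.single 0 1 := hA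
    rw [mulVec_single_one] at h
    exact congrFun h i
  have h2 : ∀ j, star ((A : Matrix (Fin (n + 2)) (Fin (n + 2)) ℂ) 0 j) =
      (Pi.single 0 1 : Fin (n + 2) → ℂ) j := fun j => by
    have h : star (A : Matrix (Fin (n + 2)) (Fin (n + 2)) ℂ) *ᵥ Pi.single 0 1 = Pi.single 0 1 :=
      (specialUnitaryStabilizer n).inv_mem hA
    rw [mulVec_single_one] at h
    exact congrFun h j
  ext i j
  refine Fin.cases ?_ (fun i => ?_) i
  · refine Fin.cases ?_ (fun j => ?_) j
    · simpa [oneBlock] using h1 0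
    · have := congrArg star (h2 j.succ)
      simpa [oneBlock] using this
  · refine Fin.cases ?_ (fun j => ?_) j
    · simpa [oneBlock] using h1 i.succ
    · simp [oneBlock]

/-- The stabilizer of a unit vector in a special unitary group is the special unitary group of one
dimension less. -/
def specialUnitaryStabilizerHomeomorph (n : ℕ) :
    specialUnitaryStabilizer n ≃ₜ specialUnitaryGroup (Fin (n + 1)) ℂ where
  toFun A := ⟨((A : specialUnitaryGroup (Fin (n + 2)) ℂ) :
      Matrix (Fin (n + 2)) (Fin (n + 2)) ℂ).submatrix Fin.succ Fin.succ, by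
    rw [← oneBlock_mem, ← eq_oneBlock_of_mem_stabilizer A.2]
    exact A.1.2⟩
  invFun A := ⟨⟨oneBlock A, oneBlock_mem.2 A.2⟩, by
    change oneBlock (A : Matrix (Fin (n + 1)) (Fin (n + 1)) ℂ) *ᵥ Pi.single 0 1 = Pi.single 0 1
    rw [mulVec_single_one]
    ext i
    refine Fin.cases ?_ (fun i => ?_) i <;> simp [oneBlock]⟩
  left_inv A := Subtype.ext (Subtype.ext (eq_oneBlock_of_mem_stabilizer A.2).symm)
  right_inv A := by
    ext i j; simp [oneBlock]
  continuous_toFun := by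
    refine Continuous.subtype_mk ?_ _
    exact (continuous_subtype_val.comp continuous_subtype_val).matrix_submatrix _ _
  continuous_invFun := by
    refine Continuous.subtype_mk (Continuous.subtype_mk ?_ _) _
    refine continuous_matrix fun i j => ?_
    refine Fin.cases ?_ (fun i => ?_) i <;> refine Fin.cases ?_ (fun j => ?_) j
    · simpa [oneBlock] using continuous_const
    · simpa [oneBlock] using continuous_const
    · simpa [oneBlock] using continuous_const
    · simpa [oneBlock] using continuous_subtype_val.matrix_elem i j

theorem inner_single_zero_eq_re (v : EuclideanSpace ℂ (Fin (n + 2))) :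
    ⟪(EuclideanSpace.single 0 1 : EuclideanSpace ℂ (Fin (n + 2))), v⟫ = (v 0).re := by
  rw [PiLp.inner_apply, Finset.sum_eq_single 0]
  · simp [Complex.inner]
  · intro j _ hj; simp [hj]
  · simp

theorem one_add_ne_zero_of_mem_sphereCap {v : EuclideanSpace ℂ (Fin (n + 2))}
    (hv : v ∈ sphereCap (EuclideanSpace.single 0 1 : EuclideanSpace ℂ (Fin (n + 2))) 1) :
    1 + v 0 ≠ 0 := by
  intro h
  have h2 := hv.2
  rw [inner_single_zero_eq_re] at h2
  have := congrArg Complex.re h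
  simp at this
  linarith

theorem complexReflection_mem_of_mem_sphereCap {v : EuclideanSpace ℂ (Fin (n + 2))}
    (hv : v ∈ sphereCap (EuclideanSpace.single 0 1 : EuclideanSpace ℂ (Fin (n + 2))) 1) :
    complexReflection v.ofLp ∈ unitaryGroup (Fin (n + 2)) ℂ := by
  refine complexReflection_mem ?_ (one_add_ne_zero_of_mem_sphereCap hv)
  have h := inner_self_eq_norm_sq_to_K (𝕜 := ℂ) v
  rw [hv.1, EuclideanSpace.inner_eq_star_dotProduct, dotProduct_comm] at h
  simpa using h

theorem continuousOn_complexReflection :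
    ContinuousOn (fun v : EuclideanSpace ℂ (Fin (n + 2)) => complexReflection v.ofLp)
      (sphereCap (EuclideanSpace.single 0 1 : EuclideanSpace ℂ (Fin (n + 2))) 1) := by
  unfold complexReflection
  have h : Continuous fun v : EuclideanSpace ℂ (Fin (n + 2)) => 1 + star (v 0) := by fun_prop
  refine ContinuousOn.sub (ContinuousOn.smul (ContinuousOn.inv₀ h.continuousOn fun v hv h0 => ?_)
    (Continuous.continuousOn ?_)) continuousOn_const
  · refine one_add_ne_zero_of_mem_sphereCap hv ?_
    simpa using congrArg star h0
  · exact Continuous.matrix_vecMulVec (by fun_prop) (by fun_prop)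

/-- The reflections give a section over the whole sphere minus −e, hence the cap parameter 1.
Correcting the determinant in the last column leaves the image of the first basis vector unchanged,
since there are at least two columns. -/
theorem specialUnitaryGroup_simplyConnected_succ
    [SimplyConnectedSpace (specialUnitaryGroup (Fin (n + 1)) ℂ)] :
    SimplyConnectedSpace (specialUnitaryGroup (Fin (n + 2)) ℂ) := by
  classical
  have : SimplyConnectedSpace (specialUnitaryStabilizer n) :=
    (specialUnitaryStabilizerHomeomorph n).toHomotopyEquiv.simplyConnectedSpace
  set e : EuclideanSpace ℂ (Fin (n + 2)) := EuclideanSpace.single 0 1 with he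
  have hrep : ∀ (M : Matrix (Fin (n + 2)) (Fin (n + 2)) ℂ)
      (hM : M ∈ unitaryGroup (Fin (n + 2)) ℂ),
      specialUnitaryRep (n + 2) ⟨M.detCorrection, detCorrection_mem hM⟩ e =
        WithLp.toLp 2 (M *ᵥ Pi.single 0 1) := fun M hM => by
    rw [← detCorrection_mulVec_single]; rfl
  have hone : (-1 : Matrix (Fin (n + 2)) (Fin (n + 2)) ℂ) ∈ unitaryGroup (Fin (n + 2)) ℂ := by
    rw [mem_unitaryGroup_iff]; simp
  refine SimplyConnectedSpace.of_sphere_action ?_ (specialUnitaryRep (n + 2))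
    norm_specialUnitaryRep (e := e) (by simp [he]) ?_ (specialUnitaryStabilizer n) ?_
    (c := 1) one_pos le_rfl
    (s := fun v => if hv : v ∈ sphereCap e 1 then
      ⟨(complexReflection v.ofLp).detCorrection,
        detCorrection_mem (complexReflection_mem_of_mem_sphereCap hv)⟩ else 1) ?_ ?_
    (g₀ := ⟨(-1 : Matrix (Fin (n + 2)) (Fin (n + 2)) ℂ).detCorrection, detCorrection_mem hone⟩) ?_
  · rw [rank_real_of_complex, rank_eq_card_basis (EuclideanSpace.basisFun (Fin (n + 2)) ℂ).toBasis,
      Fintype.card_fin]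
    exact_mod_cast (by omega : 3 ≤ 2 * (n + 2))
  · refine (PiLp.continuous_toLp 2 _).comp ?_
    exact continuous_subtype_val.matrix_mulVec continuous_const
  · intro g
    rw [specialUnitaryRep_apply]
    exact ⟨fun h => congrArg (WithLp.toLp 2) h, fun h => congrArg WithLp.ofLp h⟩
  · rw [continuousOn_iff_continuous_domRestrict]
    have h := (continuousOn_iff_continuous_domRestrict.1 (continuousOn_complexReflection (n := n)))
    have h2 : Continuous fun v : sphereCap e 1 =>
        (complexReflection (v : EuclideanSpace ℂ (Fin (n + 2))).ofLp).detCorrection := by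
      refine h.matrix_mul (Continuous.matrix_diagonal ?_)
      exact Continuous.update continuous_const _ (Continuous.star h.matrix_det)
    convert h2.subtype_mk fun v => detCorrection_mem (complexReflection_mem_of_mem_sphereCap v.2)
      using 1
    ext1 v
    simp only [Set.domRestrict_apply, v.2, dif_pos]
  · intro v hv
    rw [dif_pos hv, hrep _ (complexReflection_mem_of_mem_sphereCap hv),
      complexReflection_mulVec_single (one_add_ne_zero_of_mem_sphereCap hv)]
  · rw [hrep _ hone, neg_mulVec, one_mulVec]
    rfl

theorem specialUnitaryGroup_simplyConnected (n : ℕ) :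
    SimplyConnectedSpace (specialUnitaryGroup (Fin (n + 1)) ℂ) := by
  induction n with
  | zero =>
    have : Subsingleton (specialUnitaryGroup (Fin 1) ℂ) := by
      refine ⟨fun A B => ?_⟩
      have hA := (mem_specialUnitaryGroup_iff.1 A.2).2
      have hB := (mem_specialUnitaryGroup_iff.1 B.2).2
      rw [det_fin_one] at hA hB
      ext i j
      rw [Subsingleton.elim i 0, Subsingleton.elim j 0, hA, hB]
    infer_instance
  | succ n ih => exact specialUnitaryGroup_simplyConnected_succ

end SpecialUnitary

/-! ### The Lie algebra of a Lie group with a representation -/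

section RepresentationBracket

open VectorField

variable {E : Type*} [NormedAddCommGroup E] [NormedSpace ℝ E]
  {G : Type*} [TopologicalSpace G] [ChartedSpace E G] [Group G]
  {A : Type*} [NormedRing A] [NormedAlgebra ℝ A]

/-- The differential at the identity of a map from a Lie group to an algebra. -/
noncomputable def unitDifferential (ι : G → A) : E →L[ℝ] A :=
  mfderiv 𝓘(ℝ, E) 𝓘(ℝ, A) ι (1 : G)

/-- Differentiate ι(gh) = ι(g)ι(h) in h at the identity: left-invariant fields go to left-invariant
fields on the algebra. -/
theorem mfderiv_mulInvariantVectorField [LieGroup 𝓘(ℝ, E) ∞ G] (ι : G →* A)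
    (hι : ContMDiff 𝓘(ℝ, E) 𝓘(ℝ, A) ∞ ι) (v : GroupLieAlgebra 𝓘(ℝ, E) G) (g : G) :
    @Eq A (mfderiv 𝓘(ℝ, E) 𝓘(ℝ, A) ι g (mulInvariantVectorField v g))
      (ι g * unitDifferential (E := E) ι v) := by
  have hL : MDifferentiableAt 𝓘(ℝ, E) 𝓘(ℝ, E) (g * ·) (1 : G) :=
    (contMDiff_mul_left (I := 𝓘(ℝ, E)) (n := ∞)).mdifferentiable (by simp) 1
  have hι' : ∀ h, MDifferentiableAt 𝓘(ℝ, E) 𝓘(ℝ, A) ι h := hι.mdifferentiable (by simp)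
  have h1 : mfderiv 𝓘(ℝ, E) 𝓘(ℝ, A) (ι ∘ (g * ·)) 1 =
      (mfderiv 𝓘(ℝ, E) 𝓘(ℝ, A) ι (g * 1)).comp (mfderiv 𝓘(ℝ, E) 𝓘(ℝ, E) (g * ·) 1) :=
    mfderiv_comp 1 (hι' _) hL
  let M : A →L[ℝ] A := ContinuousLinearMap.mul ℝ A (ι g)
  have h2 : mfderiv 𝓘(ℝ, E) 𝓘(ℝ, A) (M ∘ ι) 1 =
      (mfderiv 𝓘(ℝ, A) 𝓘(ℝ, A) M (ι 1)).comp (mfderiv 𝓘(ℝ, E) 𝓘(ℝ, A) ι 1) :=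
    mfderiv_comp 1 M.mdifferentiableAt (hι' _)
  have h3 : ι ∘ (g * ·) = M ∘ ι := by
    ext h; simp [M]
  rw [h3, h2, ContinuousLinearMap.mfderiv_eq] at h1
  have h4 := congrArg (fun T => T v) h1
  rw [mul_one] at h4
  exact h4.symm

/-- The differential of a smooth homomorphism from a Lie group to an algebra takes the Lie bracket
to the commutator. -/
theorem mfderiv_bracket_eq_commutator [CompleteSpace E] [LieGroup 𝓘(ℝ, E) ∞ G] (ι : G →* A)
    (hι : ContMDiff 𝓘(ℝ, E) 𝓘(ℝ, A) ∞ ι) (v w : GroupLieAlgebra 𝓘(ℝ, E) G) :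
    unitDifferential (E := E) ι (⁅v, w⁆ : GroupLieAlgebra 𝓘(ℝ, E) G) =
      unitDifferential (E := E) ι v * unitDifferential (E := E) ι w -
      unitDifferential (E := E) ι w * unitDifferential (E := E) ι v := by
  have : LieGroup 𝓘(ℝ, E) (minSmoothness ℝ 3) G := LieGroup.of_infty_minSmoothness _ G
  have hι' : ∀ h, MDifferentiableAt 𝓘(ℝ, E) 𝓘(ℝ, A) ι h := hι.mdifferentiable (by simp)
  set φ := extChartAt 𝓘(ℝ, E) (1 : G) with hφ
  set q : E → A := ι ∘ φ.symm with hq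
  have hopen : IsOpen φ.target := isOpen_extChartAt_target 1
  have hx0 : φ 1 ∈ φ.target := mem_extChartAt_target 1
  have hqs : ∀ x ∈ φ.target, ContDiffAt ℝ ∞ q x := fun x hx => by
    have h1 : ContMDiffAt 𝓘(ℝ, E) 𝓘(ℝ, E) ∞ φ.symm x :=
      (contMDiffOn_extChartAt_symm 1).contMDiffAt (hopen.mem_nhds hx)
    exact ((hι.contMDiffAt (x := φ.symm x)).comp x h1).contDiffAt
  have hq1 : q (φ 1) = 1 := by
    rw [hq, Function.comp_apply, hφ, extChartAt_to_inv, map_one]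
  have hsymm : ∀ x ∈ φ.target, (mfderiv 𝓘(ℝ, E) 𝓘(ℝ, E) φ.symm x).IsInvertible := fun x hx => by
    have := isInvertible_mfderivWithin_extChartAt_symm (I := 𝓘(ℝ, E)) (x := (1 : G)) hx
    simpa only [modelWithCornersSelf_coe, Set.range_id, mfderivWithin_univ] using this
  have hpull : ∀ (u : GroupLieAlgebra 𝓘(ℝ, E) G) (x : E),
      mpullbackWithin 𝓘(ℝ, E) 𝓘(ℝ, E) φ.symm (mulInvariantVectorField u)
        (Set.range 𝓘(ℝ, E)) x = (mfderiv 𝓘(ℝ, E) 𝓘(ℝ, E) φ.symm x).inverse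
          (mulInvariantVectorField u (φ.symm x)) := fun u x => by
    simp only [mpullbackWithin_apply, modelWithCornersSelf_coe, Set.range_id, mfderivWithin_univ]
  set F : GroupLieAlgebra 𝓘(ℝ, E) G → E → E := fun u =>
    mpullbackWithin 𝓘(ℝ, E) 𝓘(ℝ, E) φ.symm (mulInvariantVectorField u) (Set.range 𝓘(ℝ, E))
    with hF
  have hS : φ.symm ⁻¹' Set.univ ∩ Set.range 𝓘(ℝ, E) = Set.univ := by simp
  have hFd : ∀ u, DifferentiableAt ℝ (F u) (φ 1) := fun u => by
    have h := (mdifferentiableAt_mulInvariantVectorField (I := 𝓘(ℝ, E)) (G := G) u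
      (g := 1)).mdifferentiableWithinAt (s := Set.univ)
    have h2 : DifferentiableWithinAt ℝ (F u)
      (φ.symm ⁻¹' Set.univ ∩ Set.range 𝓘(ℝ, E)) (φ 1) :=
      h.differentiableWithinAt_mpullbackWithin_vectorField
    rwa [hS, differentiableWithinAt_univ] at h2
  -- The chart form of left invariance, a first-order equation dq(F u) = q · Dι(u) that holds near
  -- the base point and so can be differentiated again.
  have hqF : ∀ u, ∀ x ∈ φ.target, fderiv ℝ q x (F u x) =
      q x * unitDifferential (E := E) ι u := fun u x hx => by
    have h1 : mfderiv 𝓘(ℝ, E) 𝓘(ℝ, A) (ι ∘ φ.symm) x =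
        (mfderiv 𝓘(ℝ, E) 𝓘(ℝ, A) ι (φ.symm x)).comp (mfderiv 𝓘(ℝ, E) 𝓘(ℝ, E) φ.symm x) :=
      mfderiv_comp x (hι' _) (((contMDiffOn_extChartAt_symm (n := ∞) (1 : G)).contMDiffAt
        (hopen.mem_nhds hx)).mdifferentiableAt (by simp))
    rw [← mfderiv_eq_fderiv, hq, h1]
    refine Eq.trans ?_ (mfderiv_mulInvariantVectorField ι hι u (φ.symm x))
    have h2 := (hsymm x hx).self_apply_inverse (mulInvariantVectorField u (φ.symm x))
    exact congrArg (fun z => mfderiv 𝓘(ℝ, E) 𝓘(ℝ, A) ι (φ.symm x) z)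
      ((congrArg _ (hpull u x)).trans h2)
  have hsym : IsSymmSndFDerivAt ℝ q (φ 1) :=
    (hqs _ hx0).isSymmSndFDerivAt (by simp; norm_cast)
  have hq' : DifferentiableAt ℝ (fderiv ℝ q) (φ 1) :=
    ((hqs _ hx0).fderiv_right (m := 1) (by norm_cast)).differentiableAt (by simp)
  have hqd : DifferentiableAt ℝ q (φ 1) := (hqs _ hx0).differentiableAt (by simp)
  -- Differentiating dq(F u) = q · Dι(u) in the direction z. In the bracket the second derivatives
  -- of q cancel by symmetry, and q = 1 at the base point leaves the commutator.
  have hder : ∀ (u : GroupLieAlgebra 𝓘(ℝ, E) G) (z : E),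
      fderiv ℝ q (φ 1) (fderiv ℝ (F u) (φ 1) z) =
        fderiv ℝ q (φ 1) z * unitDifferential (E := E) ι u -
          fderiv ℝ (fderiv ℝ q) (φ 1) z (F u (φ 1)) := fun u z => by
    have h1 := (hq'.hasFDerivAt.clm_apply (hFd u).hasFDerivAt).fderiv
    have h2 : (fun x => fderiv ℝ q x (F u x)) =ᶠ[nhds (φ 1)]
        fun x => q x * unitDifferential (E := E) ι u :=
      Filter.eventuallyEq_of_mem (hopen.mem_nhds hx0) (hqF u)
    rw [h2.fderiv_eq, (hqd.hasFDerivAt.mul_const' _).fderiv] at h1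
    have h3 := congrArg (fun T => T z) h1
    simp at h3
    rw [h3]
    abel
  -- The manifold bracket is by definition the bracket of the fields pulled back through the chart.
  have hbr : (⁅v, w⁆ : GroupLieAlgebra 𝓘(ℝ, E) G) =
      (mfderiv 𝓘(ℝ, E) 𝓘(ℝ, E) φ 1).inverse (lieBracket ℝ (F v) (F w) (φ 1) : E) := by
    rw [← lieBracketWithin_univ, ← hS]
    rfl
  have hιφ : ∀ z, unitDifferential (E := E) ι z =
      fderiv ℝ q (φ 1) (mfderiv 𝓘(ℝ, E) 𝓘(ℝ, E) φ 1 z) := fun z => by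
    have h1 : mfderiv 𝓘(ℝ, E) 𝓘(ℝ, A) (q ∘ φ) 1 =
        (mfderiv 𝓘(ℝ, E) 𝓘(ℝ, A) q (φ 1)).comp (mfderiv 𝓘(ℝ, E) 𝓘(ℝ, E) φ 1) :=
      mfderiv_comp 1 hqd.mdifferentiableAt
        (mdifferentiableAt_extChartAt (mem_chart_source E (1 : G)))
    have h2 : q ∘ φ =ᶠ[nhds 1] ι := by
      filter_upwards [extChartAt_source_mem_nhds (I := 𝓘(ℝ, E)) (1 : G)] with g hg
      rw [hq, Function.comp_apply, Function.comp_apply, φ.left_inv hg]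
    rw [h2.mfderiv_eq, mfderiv_eq_fderiv] at h1
    exact congrArg (fun T => T z) h1
  have hinv : (mfderiv 𝓘(ℝ, E) 𝓘(ℝ, E) φ 1).IsInvertible :=
    isInvertible_mfderiv_extChartAt (mem_extChartAt_source 1)
  have hfin : unitDifferential (E := E) ι (⁅v, w⁆ : GroupLieAlgebra 𝓘(ℝ, E) G) =
      fderiv ℝ q (φ 1) (lieBracket ℝ (F v) (F w) (φ 1)) := by
    refine (hιφ _).trans (congrArg (fderiv ℝ q (φ 1)) ?_)
    exact (congrArg _ hbr).trans (hinv.self_apply_inverse _)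
  rw [hfin, lieBracket_eq, map_sub, hder, hder, hqF v _ hx0, hqF w _ hx0, hq1, one_mul, one_mul,
    hsym.eq]
  abel

end RepresentationBracket

/-! ### Lie group structures from a chart at the identity -/

section LieGroupOfChart

variable {E : Type*} [NormedAddCommGroup E] [NormedSpace ℝ E]
  {G : Type*} [TopologicalSpace G] [Group G] [IsTopologicalGroup G]
  {A : Type*} [NormedRing A] [NormedAlgebra ℝ A]

/-- The charted space structure on a group whose charts are the left translates of `ψ`. -/
@[reducible] def ChartedSpace.ofTranslates (ψ : OpenPartialHomeomorph G E) (h : 1 ∈ ψ.source) :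
    ChartedSpace E G where
  atlas := Set.range fun g : G => (Homeomorph.mulLeft g⁻¹).transOpenPartialHomeomorph ψ
  chartAt g := (Homeomorph.mulLeft g⁻¹).transOpenPartialHomeomorph ψ
  mem_chart_source g := by simpa using h
  chart_mem_atlas g := ⟨g, rfl⟩

/-- A chart at the identity of a group `G` that is adapted to a homomorphism `ι` to an algebra:
the chart is the restriction of a smooth map, and its inverse is smooth. -/
structure IsAdaptedChart (ι : G →* A) (ψ : OpenPartialHomeomorph G E) (Ψ : A → E) : Prop where
  one_mem : 1 ∈ ψ.source
  eq : ∀ g ∈ ψ.source, ψ g = Ψ (ι g)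
  contDiffAt : ∀ g ∈ ψ.source, ContDiffAt ℝ ∞ Ψ (ι g)
  contDiffOn : ContDiffOn ℝ ∞ (ι ∘ ψ.symm) ψ.target

namespace IsAdaptedChart

variable {ι : G →* A} {ψ : OpenPartialHomeomorph G E} {Ψ : A → E}

/-- The change from the translate by g to the translate by k is x ↦ Ψ(ι(k⁻¹g) · ι(ψ⁻¹x)), and left
multiplication in the algebra is smooth. -/
theorem isManifold (h : IsAdaptedChart ι ψ Ψ) :
    letI := ChartedSpace.ofTranslates ψ h.one_mem
    IsManifold 𝓘(ℝ, E) ∞ G := by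
  let _ := ChartedSpace.ofTranslates ψ h.one_mem
  apply isManifold_of_contDiffOn
  rintro _ _ ⟨g, rfl⟩ ⟨k, rfl⟩
  intro x hx
  simp only [modelWithCornersSelf_coe, modelWithCornersSelf_coe_symm, Set.preimage_id,
    Set.range_id, Set.inter_univ, OpenPartialHomeomorph.trans_source, Set.mem_inter_iff,
    Set.mem_preimage, Function.id_comp, Function.comp_id] at hx ⊢
  have hx1 : x ∈ ψ.target := hx.1
  have hx2 : k⁻¹ * (g * ψ.symm x) ∈ ψ.source := by simpa [Homeomorph.mulLeft_symm] using hx.2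
  have h1 : ContDiffAt ℝ ∞ (ι ∘ ψ.symm) x :=
    (h.contDiffOn x hx1).contDiffAt (ψ.open_target.mem_nhds hx1)
  have h2 : ContDiffAt ℝ ∞ (fun y => Ψ (ι (k⁻¹ * g) * (ι ∘ ψ.symm) y)) x := by
    refine ContDiffAt.comp x ?_ (contDiffAt_const.mul h1)
    have := h.contDiffAt _ hx2
    rwa [← mul_assoc, map_mul] at this
  refine (h2.contDiffWithinAt).congr ?_ ?_
  · intro y hy
    have hy2 : k⁻¹ * (g * ψ.symm y) ∈ ψ.source := by simpa [Homeomorph.mulLeft_symm] using hy.2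
    have := h.eq _ hy2
    rw [← mul_assoc, map_mul] at this
    simpa [mul_assoc, Homeomorph.mulLeft_symm] using this
  · have := h.eq _ hx2
    rw [← mul_assoc, map_mul] at this
    simpa [mul_assoc, Homeomorph.mulLeft_symm] using this

/-- Near g, the map ι is left multiplication by ι(g) applied to ι ∘ ψ⁻¹ in the chart centred at g.
-/
theorem contMDiff (h : IsAdaptedChart ι ψ Ψ) :
    letI := ChartedSpace.ofTranslates ψ h.one_mem
    ContMDiff 𝓘(ℝ, E) 𝓘(ℝ, A) ∞ ι := by
  let _ := ChartedSpace.ofTranslates ψ h.one_mem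
  have := h.isManifold
  intro g
  have h1 : ContMDiffAt 𝓘(ℝ, E) 𝓘(ℝ, E) ∞ (chartAt E g) g :=
    (contMDiffOn_chart (I := 𝓘(ℝ, E)) (x := g)).contMDiffAt
      ((chartAt E g).open_source.mem_nhds (mem_chart_source E g))
  have hmem : chartAt E g g ∈ ψ.target := by
    change ψ (g⁻¹ * g) ∈ ψ.target
    rw [inv_mul_cancel]
    exact ψ.map_source h.one_mem
  have h2 : ContMDiffAt 𝓘(ℝ, E) 𝓘(ℝ, A) ∞ (fun x => ι g * (ι ∘ ψ.symm) x) (chartAt E g g) :=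
    (contDiffAt_const.mul ((h.contDiffOn _ hmem).contDiffAt
      (ψ.open_target.mem_nhds hmem))).contMDiffAt
  refine (h2.comp g h1).congr_of_eventuallyEq ?_
  filter_upwards [(chartAt E g).open_source.mem_nhds (mem_chart_source E g)] with k hk
  have hk' : g⁻¹ * k ∈ ψ.source := hk
  have : (chartAt E g) k = ψ (g⁻¹ * k) := rfl
  rw [Function.comp_apply, Function.comp_apply, this, ψ.left_inv hk', ← map_mul,
    mul_inv_cancel_left]

/-- The group behaves like an embedded submanifold: the chart at f x is the restriction of the
smooth map a ↦ Ψ(ι(f x)⁻¹a), so smoothness of a continuous map can be tested after ι. -/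
theorem contMDiffAt_of_comp (h : IsAdaptedChart ι ψ Ψ) {E' H' M : Type*} [NormedAddCommGroup E']
    [NormedSpace ℝ E'] [TopologicalSpace H'] {I : ModelWithCorners ℝ E' H'} [TopologicalSpace M]
    [ChartedSpace H' M] {f : M → G} {x : M} (hf : ContinuousAt f x)
    (hf' : ContMDiffAt I 𝓘(ℝ, A) ∞ (ι ∘ f) x) :
    letI := ChartedSpace.ofTranslates ψ h.one_mem
    ContMDiffAt I 𝓘(ℝ, E) ∞ f x := by
  let _ := ChartedSpace.ofTranslates ψ h.one_mem
  rw [contMDiffAt_iff_target]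
  refine ⟨hf, ?_⟩
  have hΨ : ContDiffAt ℝ ∞ (fun a => Ψ (ι (f x)⁻¹ * a)) (ι (f x)) := by
    refine ContDiffAt.comp (g := Ψ) _ ?_ (contDiffAt_const.mul contDiffAt_id)
    rw [← map_mul, inv_mul_cancel]
    exact h.contDiffAt _ h.one_mem
  refine (hΨ.contMDiffAt.comp x hf').congr_of_eventuallyEq ?_
  have hmem : ∀ᶠ y in nhds x, (f x)⁻¹ * f y ∈ ψ.source := by
    have hc : ContinuousAt (fun y => (f x)⁻¹ * f y) x := continuousAt_const.mul hf
    refine hc.preimage_mem_nhds (ψ.open_source.mem_nhds ?_)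
    rw [inv_mul_cancel]
    exact h.one_mem
  filter_upwards [hmem] with y hy
  have : (extChartAt 𝓘(ℝ, E) (f x)) (f y) = ψ ((f x)⁻¹ * f y) := rfl
  rw [Function.comp_apply, this, h.eq _ hy, map_mul]
  rfl

/-- After composition with ι, the group operations become multiplication and `Ring.inverse` of the
algebra, which are smooth where they are needed. -/
theorem lieGroup [CompleteSpace A] (h : IsAdaptedChart ι ψ Ψ) :
    letI := ChartedSpace.ofTranslates ψ h.one_mem
    LieGroup 𝓘(ℝ, E) ∞ G := by
  let _ := ChartedSpace.ofTranslates ψ h.one_mem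
  have := h.isManifold
  have hι := h.contMDiff
  refine { contMDiff_mul := fun p => ?_, contMDiff_inv := fun g => ?_ }
  · refine h.contMDiffAt_of_comp continuous_mul.continuousAt ?_
    have h1 : ContMDiff (𝓘(ℝ, E).prod 𝓘(ℝ, E)) 𝓘(ℝ, A) ∞ fun p : G × G => ι p.1 :=
      hι.comp contMDiff_fst
    have h2 : ContMDiff (𝓘(ℝ, E).prod 𝓘(ℝ, E)) 𝓘(ℝ, A) ∞ fun p : G × G => ι p.2 :=
      hι.comp contMDiff_snd
    have h3 : ContDiff ℝ ∞ fun q : A × A => q.1 * q.2 := contDiff_fst.mul contDiff_snd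
    have h4 := h3.contMDiff.comp (h1.prodMk_space h2)
    refine (h4 p).congr_of_eventuallyEq (Filter.Eventually.of_forall fun q => ?_)
    simp
  · refine h.contMDiffAt_of_comp continuous_inv.continuousAt ?_
    let u : Aˣ := Units.map ι (toUnits g)
    have hu : (u : A) = ι g := rfl
    have h3 : ContDiffAt ℝ ∞ Ring.inverse (ι g) := hu ▸ contDiffAt_ringInverse ℝ u
    refine (h3.contMDiffAt.comp g (hι g)).congr_of_eventuallyEq
      (Filter.Eventually.of_forall fun k => ?_)
    have hk : ι k = (Units.map ι (toUnits k) : A) := rfl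
    rw [Function.comp_apply, Function.comp_apply, hk, Ring.inverse_unit, ← map_inv]
    rfl

theorem unitDifferential_eq (h : IsAdaptedChart ι ψ Ψ) :
    letI := ChartedSpace.ofTranslates ψ h.one_mem
    unitDifferential (E := E) ι = fderiv ℝ (ι ∘ ψ.symm) (ψ 1) := by
  let _ := ChartedSpace.ofTranslates ψ h.one_mem
  have := h.isManifold
  have h1 : MDifferentiableAt 𝓘(ℝ, E) 𝓘(ℝ, A) ι 1 := h.contMDiff.mdifferentiable (by simp) 1
  have h2 : (extChartAt 𝓘(ℝ, E) (1 : G)) 1 = ψ 1 := by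
    change ψ (1⁻¹ * 1) = ψ 1
    simp
  have h3 : ι ∘ (extChartAt 𝓘(ℝ, E) (1 : G)).symm = ι ∘ ψ.symm := by
    funext x
    change ι ((1⁻¹ : G)⁻¹ * ψ.symm x) = ι (ψ.symm x)
    simp
  rw [unitDifferential, h1.mfderiv]
  change fderivWithin ℝ (ι ∘ (extChartAt 𝓘(ℝ, E) (1 : G)).symm) (Set.range 𝓘(ℝ, E))
    ((extChartAt 𝓘(ℝ, E) (1 : G)) 1) = _
  rw [h2, h3, modelWithCornersSelf_coe, Set.range_id, fderivWithin_univ]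

end IsAdaptedChart

open NormedSpace in
/-- A group that is embedded in a Banach algebra and that is, near the identity, the exponential of
a finite-dimensional subspace, is a Lie group with that subspace as Lie algebra. -/
theorem exists_lieGroup_of_exp [CompleteSpace A] (ι : G →* A) (hι : Topology.IsEmbedding ι)
    (𝔤 : Submodule ℝ A) [FiniteDimensional ℝ 𝔤] (hexp : ∀ X ∈ 𝔤, ∃ g, ι g = exp X)
    (hlog : ∀ᶠ X in nhds (0 : A), exp X ∈ Set.range ι → X ∈ 𝔤) :
    ∃ (n : ℕ) (_ : ChartedSpace (EuclideanSpace ℝ (Fin n)) G)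
      (_ : LieGroup 𝓘(ℝ, EuclideanSpace ℝ (Fin n)) ∞ G)
      (L : EuclideanSpace ℝ (Fin n) ≃L[ℝ] 𝔤),
      ContMDiff 𝓘(ℝ, EuclideanSpace ℝ (Fin n)) 𝓘(ℝ, A) ∞ ι ∧
      ∀ v : EuclideanSpace ℝ (Fin n), unitDifferential (E := EuclideanSpace ℝ (Fin n)) ι v = L v := by
  let _ : NormedAlgebra ℚ A := NormedAlgebra.restrictScalars ℚ ℝ A
  let L : EuclideanSpace ℝ (Fin (Module.finrank ℝ 𝔤)) ≃L[ℝ] 𝔤 :=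
    ContinuousLinearEquiv.ofFinrankEq (by simp)
  have hexpω : ∀ x : A, ContDiffAt ℝ ω exp x := fun x => (exp_analytic (𝕂 := ℝ) x).contDiffAt
  have hd0 : HasFDerivAt exp ((ContinuousLinearEquiv.refl ℝ A : A ≃L[ℝ] A) : A →L[ℝ] A) (0 : A) :=
    hasFDerivAt_exp_zero
  -- A projection onto 𝔤 extends the logarithmic coordinates from the image of ι to an open set of
  -- the algebra, as an adapted chart requires.
  obtain ⟨P, hP⟩ : ∃ P : A →L[ℝ] 𝔤, ∀ x : 𝔤, P x = x :=
    Submodule.ClosedComplemented.of_finiteDimensional 𝔤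
  obtain ⟨e, hec, h0s, he𝔤, hes⟩ : ∃ e : OpenPartialHomeomorph A A, (∀ x, e x = exp x) ∧
      0 ∈ e.source ∧ (∀ x ∈ e.source, exp x ∈ Set.range ι → x ∈ 𝔤) ∧
      ∀ y ∈ e.target, ContDiffAt ℝ ∞ e.symm y := by
    set e₀ := (hexpω 0).toOpenPartialHomeomorph exp hd0 (by simp)
    have h0s : (0 : A) ∈ e₀.source := (hexpω 0).mem_toOpenPartialHomeomorph_source hd0 (by simp)
    -- Regularity ω, unlike ∞, spreads from a point to a neighbourhood; this makes the local
    -- logarithm smooth on an open set.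
    have hsymmω : ContDiffAt ℝ ω e₀.symm 1 := by
      have := (hexpω 0).to_localInverse hd0 (by simp)
      rwa [exp_zero] at this
    have hsm : ∀ᶠ y in nhds (1 : A), ContDiffAt ℝ ∞ e₀.symm y :=
      (hsymmω.eventually (by simp)).mono fun y hy => hy.of_le (by simp)
    have hsm' : ∀ᶠ x in nhds (0 : A), ContDiffAt ℝ ∞ e₀.symm (exp x) := by
      have hc : Filter.Tendsto exp (nhds (0 : A)) (nhds 1) := by
        have := (exp_continuous (𝔸 := A)).tendsto 0
        rwa [exp_zero] at this
      exact hc.eventually hsm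
    obtain ⟨N, hN, hNo, h0N⟩ := eventually_nhds_iff.1 (hlog.and hsm')
    refine ⟨e₀.restrOpen N hNo, fun x => rfl, ⟨h0s, h0N⟩, fun x hx => (hN x hx.2).1,
      fun y hy => ?_⟩
    have hx := (e₀.restrOpen N hNo).map_target hy
    have hy' : exp (e₀.symm y) = y := (e₀.restrOpen N hNo).right_inv hy
    have := (hN _ hx.2).2
    change ContDiffAt ℝ ∞ e₀.symm (exp (e₀.symm y)) at this
    rwa [hy'] at this
  choose γ hγ using fun X : 𝔤 => hexp X X.2
  -- Logarithms of group elements already lie in 𝔤, so the projection does not change them.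
  have hcoe : ∀ {g}, ι g ∈ e.target → (P (e.symm (ι g)) : A) = e.symm (ι g) := fun {g} hg => by
    have h1 : exp (e.symm (ι g)) = ι g := by rw [← hec, e.right_inv hg]
    exact congrArg Subtype.val (hP ⟨_, he𝔤 _ (e.map_target hg) ⟨g, h1.symm⟩⟩)
  let ψ : OpenPartialHomeomorph G (EuclideanSpace ℝ (Fin (Module.finrank ℝ 𝔤))) :=
    { toFun := fun g => L.symm (P (e.symm (ι g)))
      invFun := fun x => γ (L x)
      source := ι ⁻¹' e.target
      target := {x | (L x : A) ∈ e.source}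
      map_source' := fun g hg => by
        change ((L (L.symm (P (e.symm (ι g)))) : 𝔤) : A) ∈ e.source
        rw [L.apply_symm_apply, hcoe hg]
        exact e.map_target hg
      map_target' := fun x hx => by
        change ι (γ (L x)) ∈ e.target
        rw [hγ, ← hec]
        exact e.map_source hx
      left_inv' := fun g hg => hι.injective (by
        rw [hγ, L.apply_symm_apply, hcoe hg, ← hec, e.right_inv hg])
      right_inv' := fun x hx => by
        rw [hγ, ← hec, e.left_inv hx, hP, L.symm_apply_apply]
      open_source := e.open_target.preimage hι.continuous
      open_target := e.open_source.preimage (continuous_subtype_val.comp L.continuous)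
      continuousOn_toFun := by
        refine (L.symm.continuous.comp P.continuous).comp_continuousOn ?_
        exact e.symm.continuousOn.comp hι.continuous.continuousOn fun g hg => hg
      continuousOn_invFun := by
        -- The chosen lifts γ are continuous because ι is an embedding and ι ∘ γ is the exponential.
        refine Continuous.continuousOn (hι.continuous_iff.2 ?_)
        have : ι ∘ (fun x => γ (L x)) = fun x => exp ((L x : 𝔤) : A) := funext fun x => hγ _
        rw [this]
        exact exp_continuous.comp (continuous_subtype_val.comp L.continuous) }
  let M : EuclideanSpace ℝ (Fin (Module.finrank ℝ 𝔤)) →L[ℝ] A :=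
    𝔤.subtypeL ∘L L.toContinuousLinearMap
  have hιψ : ι ∘ ψ.symm = exp ∘ M := funext fun x => hγ _
  have h1t : ι 1 ∈ e.target := by
    have := e.map_source h0s
    rwa [hec, exp_zero, ← map_one ι] at this
  have hψ : IsAdaptedChart ι ψ (fun a => L.symm (P (e.symm a))) :=
    { one_mem := h1t
      eq := fun g _ => rfl
      contDiffAt := fun g hg => (L.symm.contDiff.comp P.contDiff).contDiffAt.comp _ (hes _ hg)
      contDiffOn := by
        rw [hιψ]
        intro x _
        exact (((hexpω _).of_le (by simp)).comp x
          (ContinuousLinearMap.contDiff _).contDiffAt).contDiffWithinAt }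
  have hψ1 : ψ 1 = 0 := by
    change L.symm (P (e.symm (ι 1))) = 0
    rw [map_one, ← exp_zero (𝔸 := A), ← hec, e.left_inv h0s, map_zero, map_zero]
  refine ⟨_, ChartedSpace.ofTranslates ψ hψ.one_mem, hψ.lieGroup, L, hψ.contMDiff, fun v => ?_⟩
  rw [hψ.unitDifferential_eq, hψ1, hιψ]
  have hd : HasFDerivAt exp (1 : A →L[ℝ] A) (M 0) := by
    rw [map_zero]; exact hasFDerivAt_exp_zero
  rw [(hd.comp 0 (ContinuousLinearMap.hasFDerivAt _)).fderiv]
  rfl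

end LieGroupOfChart

/-! ### Automorphisms and derivations of a bilinear product -/

section ExpDerivation

open NormedSpace

variable {E : Type*} [NormedAddCommGroup E] [NormedSpace ℝ E]

/-- The failure of a linear map to be a derivation of a product. -/
noncomputable def derivationDefect (B : E →L[ℝ] E →L[ℝ] E) (X : E →L[ℝ] E) :
    E →L[ℝ] E →L[ℝ] E :=
  (ContinuousLinearMap.compL ℝ E E E X).comp B - B.comp X -
    ((ContinuousLinearMap.compL ℝ E E E).flip X).comp B

theorem derivationDefect_apply (B : E →L[ℝ] E →L[ℝ] E) (X : E →L[ℝ] E) (x y : E) :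
    derivationDefect B X x y = X (B x y) - B (X x) y - B x (X y) := rfl

variable [CompleteSpace E]

/-- Transport the product B along the flow of X: the velocity of the transported product is the
derivation defect, transported in the same way. Both directions of the correspondence between
derivations and automorphisms use this formula. -/
theorem hasDerivAt_conj_exp (B : E →L[ℝ] E →L[ℝ] E) (X : E →L[ℝ] E) (x y : E) (t : ℝ) :
    HasDerivAt (fun t : ℝ => exp (t • X) (B (exp (t • -X) x) (exp (t • -X) y)))
      (exp (t • X) (derivationDefect B X (exp (t • -X) x) (exp (t • -X) y))) t := by
  have h1 := hasDerivAt_exp_smul_const (𝕂 := ℝ) X t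
  have h2 := fun z => (hasDerivAt_exp_smul_const' (𝕂 := ℝ) (-X) t).clm_apply
    (hasDerivAt_const t z)
  have h3 : HasDerivAt (fun t : ℝ => B (exp (t • -X) x)) (B ((-X * exp (t • -X)) x)) t := by
    have := B.hasFDerivAt.comp_hasDerivAt t (h2 x)
    rw [map_zero, add_zero] at this
    exact this
  have h4 := h1.clm_apply (h3.clm_apply (h2 y))
  convert h4 using 1
  simp [derivationDefect_apply, mul_apply_eq_comp]
  abel

theorem exp_neg_apply_exp_apply (X : E →L[ℝ] E) (x : E) : exp (-X) (exp X x) = x := by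
  let _ : NormedAlgebra ℚ (E →L[ℝ] E) := NormedAlgebra.restrictScalars ℚ ℝ _
  rw [← mul_apply_eq_comp, ← exp_add_of_commute (Commute.neg_left (Commute.refl X)),
    neg_add_cancel, exp_zero, one_apply_eq_self]

/-- The exponential of a derivation is an automorphism. -/
theorem exp_apply_of_derivation {B : E →L[ℝ] E →L[ℝ] E} {X : E →L[ℝ] E}
    (hX : derivationDefect B X = 0) (x y : E) : exp X (B x y) = B (exp X x) (exp X y) := by
  have h := hasDerivAt_conj_exp B X (exp X x) (exp X y)
  simp only [hX, zero_apply, map_zero] at h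
  -- Zero defect makes the transported product constant; compare times 0 and 1.
  have h' := is_const_of_deriv_eq_zero (fun t => (h t).differentiableAt) (fun t => (h t).deriv) 0 1
  simpa [exp_zero, exp_neg_apply_exp_apply] using h'.symm

/-- The logarithm of an automorphism close to the identity is a derivation. -/
theorem eventually_derivationDefect_eq_zero (B : E →L[ℝ] E →L[ℝ] E) :
    ∀ᶠ X : E →L[ℝ] E in nhds 0, (∀ x y, exp X (B x y) = B (exp X x) (exp X y)) →
      derivationDefect B X = 0 := by
  let _ : NormedAlgebra ℚ (E →L[ℝ] E) := NormedAlgebra.restrictScalars ℚ ℝ _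
  have hc : ∀ᶠ X : E →L[ℝ] E in nhds 0, ‖exp X - 1‖ < 1 / 8 := by
    have h : Filter.Tendsto (fun X : E →L[ℝ] E => ‖exp X - 1‖) (nhds 0) (nhds 0) := by
      have h2 : Continuous fun X : E →L[ℝ] E => ‖exp X - 1‖ :=
        (exp_continuous.sub continuous_const).norm
      have := h2.tendsto 0
      simpa [exp_zero] using this
    exact h.eventually_lt_const (by norm_num)
  obtain ⟨r, hr, hball⟩ := Metric.eventually_nhds_iff_ball.1 hc
  filter_upwards [Metric.ball_mem_nhds 0 hr] with X hX haut
  rw [mem_ball_zero_iff] at hX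
  have hsmall : ∀ Y : E →L[ℝ] E, ‖Y‖ = ‖X‖ → ∀ t ∈ Set.Icc (0 : ℝ) 1, ‖exp (t • Y) - 1‖ ≤ 1 / 8 := by
    intro Y hY t ht
    refine (hball _ ?_).le
    rw [mem_ball_zero_iff, norm_smul, Real.norm_of_nonneg ht.1, hY]
    exact (mul_le_of_le_one_left (norm_nonneg _) ht.2).trans_lt hX
  set W := derivationDefect B X
  have hpt : ∀ x y, ‖W x y‖ ≤ 1 / 2 * ‖W‖ * ‖x‖ * ‖y‖ := by
    intro x y
    -- An automorphism exp X makes the transported product agree at times 0 and 1, so the average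
    -- velocity is 0. If the velocity stays within ½‖W‖ of its initial value W, then ‖W‖ ≤ ½‖W‖.
    -- Subtracting tW turns this into a mean value estimate.
    have hd := fun t => (hasDerivAt_conj_exp B X x y t).sub ((hasDerivAt_id t).smul_const (W x y))
    have hmv := norm_image_sub_le_of_norm_deriv_le_segment_01' (C := 1 / 2 * ‖W‖ * ‖x‖ * ‖y‖)
      (fun t _ => (hd t).hasDerivWithinAt) ?_
    · have h1 : exp X (B (exp (-X) x) (exp (-X) y)) = B x y := by
        have h2 := fun z => exp_neg_apply_exp_apply (-X) z
        rw [neg_neg] at h2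
        rw [haut, h2, h2]
      simpa [h1, exp_zero] using hmv
    · intro t ht
      have ht' := Set.Ico_subset_Icc_self ht
      set a := exp (t • X)
      set b := exp (t • -X)
      have ha : ‖a - 1‖ ≤ 1 / 8 := hsmall X rfl t ht'
      have hb : ‖b - 1‖ ≤ 1 / 8 := hsmall (-X) (norm_neg X) t ht'
      have hb' : ∀ z, ‖(b - 1) z‖ ≤ 1 / 8 * ‖z‖ := fun z => (b - 1).le_of_opNorm_le hb z
      have hb2 : ∀ z, ‖b z‖ ≤ 9 / 8 * ‖z‖ := fun z => by
        have : b z = (b - 1) z + z := by simp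
        rw [this]
        refine (norm_add_le _ _).trans ?_
        linarith [hb' z]
      have hdec : a (W (b x) (b y)) - (1 : ℝ) • W x y =
          (a - 1) (W (b x) (b y)) + W ((b - 1) x) (b y) + W x ((b - 1) y) := by
        simp
      rw [hdec]
      have hW : ∀ u v, ‖W u v‖ ≤ ‖W‖ * ‖u‖ * ‖v‖ := fun u v => W.le_opNorm₂ u v
      have e1 : ‖(a - 1) (W (b x) (b y))‖ ≤ 1 / 8 * (‖W‖ * (9 / 8 * ‖x‖) * (9 / 8 * ‖y‖)) := by
        refine ((a - 1).le_of_opNorm_le ha _).trans ?_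
        refine mul_le_mul_of_nonneg_left ((hW _ _).trans ?_) (by norm_num)
        gcongr <;> apply hb2
      have e2 : ‖W ((b - 1) x) (b y)‖ ≤ ‖W‖ * (1 / 8 * ‖x‖) * (9 / 8 * ‖y‖) := by
        refine (hW _ _).trans ?_
        gcongr
        · exact hb' x
        · exact hb2 y
      have e3 : ‖W x ((b - 1) y)‖ ≤ ‖W‖ * ‖x‖ * (1 / 8 * ‖y‖) := by
        refine (hW _ _).trans ?_
        gcongr
        exact hb' y
      have hnn : 0 ≤ ‖W‖ * ‖x‖ * ‖y‖ := by positivity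
      -- The three bounds add up to (81/512 + 9/64 + 1/8) = 217/512 < 1/2; this is what the choice
      -- of 1/8 provides.
      refine (norm_add₃_le).trans ?_
      nlinarith
  have hle : ‖W‖ ≤ 1 / 2 * ‖W‖ := W.opNorm_le_bound₂ (by positivity) hpt
  have h0 : ‖W‖ = 0 := le_antisymm (by linarith) W.opNorm_nonneg
  exact W.opNorm_zero_iff.1 h0

end ExpDerivation

/-! ### Algebra of the octonions -/

section Octonion

/-- The eight coordinate formulas turn octonion identities into polynomial identities in real
coordinates. -/
theorem octMul_apply_0 (x y : Octonion) : octMul x y 0 =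
    x 0 * y 0 - x 1 * y 1 - x 2 * y 2 - x 3 * y 3 - x 4 * y 4 - x 5 * y 5
      - x 6 * y 6 - x 7 * y 7 := by
  simp [octMul, Fin.sum_univ_eight, octCoeff, FanoOriented, fanoLines]
  ring

theorem octMul_apply_1 (x y : Octonion) : octMul x y 1 =
    x 0 * y 1 + x 1 * y 0 + x 2 * y 3 - x 3 * y 2 + x 4 * y 5 - x 5 * y 4
      + x 6 * y 7 - x 7 * y 6 := by
  simp [octMul, Fin.sum_univ_eight, octCoeff, FanoOriented, fanoLines]
  ring

theorem octMul_apply_2 (x y : Octonion) : octMul x y 2 =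
    x 0 * y 2 - x 1 * y 3 + x 2 * y 0 + x 3 * y 1 - x 4 * y 6 + x 5 * y 7
      + x 6 * y 4 - x 7 * y 5 := by
  simp [octMul, Fin.sum_univ_eight, octCoeff, FanoOriented, fanoLines]
  ring

theorem octMul_apply_3 (x y : Octonion) : octMul x y 3 =
    x 0 * y 3 + x 1 * y 2 - x 2 * y 1 + x 3 * y 0 + x 4 * y 7 + x 5 * y 6
      - x 6 * y 5 - x 7 * y 4 := by
  simp [octMul, Fin.sum_univ_eight, octCoeff, FanoOriented, fanoLines]
  ring

theorem octMul_apply_4 (x y : Octonion) : octMul x y 4 =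
    x 0 * y 4 - x 1 * y 5 + x 2 * y 6 - x 3 * y 7 + x 4 * y 0 + x 5 * y 1
      - x 6 * y 2 + x 7 * y 3 := by
  simp [octMul, Fin.sum_univ_eight, octCoeff, FanoOriented, fanoLines]
  ring

theorem octMul_apply_5 (x y : Octonion) : octMul x y 5 =
    x 0 * y 5 + x 1 * y 4 - x 2 * y 7 - x 3 * y 6 - x 4 * y 1 + x 5 * y 0
      + x 6 * y 3 + x 7 * y 2 := by
  simp [octMul, Fin.sum_univ_eight, octCoeff, FanoOriented, fanoLines]
  ring

theorem octMul_apply_6 (x y : Octonion) : octMul x y 6 =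
    x 0 * y 6 - x 1 * y 7 - x 2 * y 4 + x 3 * y 5 + x 4 * y 2 - x 5 * y 3
      + x 6 * y 0 + x 7 * y 1 := by
  simp [octMul, Fin.sum_univ_eight, octCoeff, FanoOriented, fanoLines]
  ring

theorem octMul_apply_7 (x y : Octonion) : octMul x y 7 =
    x 0 * y 7 + x 1 * y 6 + x 2 * y 5 + x 3 * y 4 - x 4 * y 3 - x 5 * y 2
      - x 6 * y 1 + x 7 * y 0 := by
  simp [octMul, Fin.sum_univ_eight, octCoeff, FanoOriented, fanoLines]
  ring

/-- The two Moufang identities replace associativity when conjugation is shown to be multiplicative.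
-/
theorem octMul_leftMoufang (a x z : Octonion) :
    octMul a (octMul x (octMul a z)) = octMul (octMul (octMul a x) a) z := by
  ext k
  fin_cases k <;> simp only [octMul_apply_0, octMul_apply_1, octMul_apply_2, octMul_apply_3,
    octMul_apply_4, octMul_apply_5, octMul_apply_6, octMul_apply_7, Fin.zero_eta, Fin.mk_one, Fin.reduceFinMk]  <;> ring

theorem octMul_rightMoufang (a x z : Octonion) :
    octMul (octMul (octMul z a) x) a = octMul z (octMul (octMul a x) a) := by
  ext k
  fin_cases k <;> simp only [octMul_apply_0, octMul_apply_1, octMul_apply_2, octMul_apply_3,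
    octMul_apply_4, octMul_apply_5, octMul_apply_6, octMul_apply_7, Fin.zero_eta, Fin.mk_one, Fin.reduceFinMk]  <;> ring

end Octonion

/-! ### Bilinearity, alternativity and norm of the octonions; compactness of G₂. -/

section OctonionAlgebra

theorem octBasis_apply (i j : Fin 8) : octBasis i j = if j = i then 1 else 0 := by
  simp [octBasis]

theorem octMul_add_left (x y z : Octonion) : octMul (x + y) z = octMul x z + octMul y z := by
  ext k
  simp only [octMul, PiLp.add_apply, ← Finset.sum_add_distrib]
  exact Finset.sum_congr rfl fun i _ => Finset.sum_congr rfl fun j _ => by ring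

theorem octMul_add_right (x y z : Octonion) : octMul x (y + z) = octMul x y + octMul x z := by
  ext k
  simp only [octMul, PiLp.add_apply, ← Finset.sum_add_distrib]
  exact Finset.sum_congr rfl fun i _ => Finset.sum_congr rfl fun j _ => by ring

theorem octMul_smul_left (c : ℝ) (x y : Octonion) : octMul (c • x) y = c • octMul x y := by
  ext k
  simp only [octMul, PiLp.smul_apply, smul_eq_mul, Finset.mul_sum]
  exact Finset.sum_congr rfl fun i _ => Finset.sum_congr rfl fun j _ => by ring

theorem octMul_smul_right (c : ℝ) (x y : Octonion) : octMul x (c • y) = c • octMul x y := by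
  ext k
  simp only [octMul, PiLp.smul_apply, smul_eq_mul, Finset.mul_sum]
  exact Finset.sum_congr rfl fun i _ => Finset.sum_congr rfl fun j _ => by ring

/-- The multiplication of the octonions as a continuous bilinear map. -/
noncomputable def octMulL : Octonion →L[ℝ] Octonion →L[ℝ] Octonion :=
  (LinearMap.mk₂ ℝ octMul octMul_add_left octMul_smul_left octMul_add_right
    octMul_smul_right).toContinuousBilinearMap

theorem octMulL_apply (x y : Octonion) : octMulL x y = octMul x y := rfl

theorem octMul_neg_left (x y : Octonion) : octMul (-x) y = -octMul x y := by
  simp only [← octMulL_apply, map_neg, neg_apply]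

theorem octMul_neg_right (x y : Octonion) : octMul x (-y) = -octMul x y := by
  simp only [← octMulL_apply, map_neg]

theorem octMul_sub_left (x y z : Octonion) : octMul (x - y) z = octMul x z - octMul y z := by
  simp only [← octMulL_apply, map_sub, sub_apply]

theorem octMul_sub_right (x y z : Octonion) : octMul x (y - z) = octMul x y - octMul x z := by
  simp only [← octMulL_apply, map_sub]

theorem octMul_zero_left (x : Octonion) : octMul 0 x = 0 := by
  simp only [← octMulL_apply, map_zero, zero_apply]

theorem octMul_zero_right (x : Octonion) : octMul x 0 = 0 := by
  simp only [← octMulL_apply, map_zero]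

theorem one_octMul (x : Octonion) : octMul (octBasis 0) x = x := by
  ext k
  fin_cases k <;> simp [octMul_apply_0, octMul_apply_1, octMul_apply_2, octMul_apply_3,
    octMul_apply_4, octMul_apply_5, octMul_apply_6, octMul_apply_7, octBasis_apply]

theorem octMul_one (x : Octonion) : octMul x (octBasis 0) = x := by
  ext k
  fin_cases k <;> simp [octMul_apply_0, octMul_apply_1, octMul_apply_2, octMul_apply_3,
    octMul_apply_4, octMul_apply_5, octMul_apply_6, octMul_apply_7, octBasis_apply]

theorem octMul_leftAlternative (x y : Octonion) :
    octMul x (octMul x y) = octMul (octMul x x) y := by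
  ext k
  fin_cases k <;> simp only [octMul_apply_0, octMul_apply_1, octMul_apply_2, octMul_apply_3,
    octMul_apply_4, octMul_apply_5, octMul_apply_6, octMul_apply_7, Fin.zero_eta, Fin.mk_one,
    Fin.reduceFinMk] <;> ring

theorem octMul_rightAlternative (x y : Octonion) :
    octMul (octMul y x) x = octMul y (octMul x x) := by
  ext k
  fin_cases k <;> simp only [octMul_apply_0, octMul_apply_1, octMul_apply_2, octMul_apply_3,
    octMul_apply_4, octMul_apply_5, octMul_apply_6, octMul_apply_7, Fin.zero_eta, Fin.mk_one,
    Fin.reduceFinMk] <;> ring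

theorem octonion_norm_sq (x : Octonion) : ‖x‖ ^ 2 =
    x 0 ^ 2 + x 1 ^ 2 + x 2 ^ 2 + x 3 ^ 2 + x 4 ^ 2 + x 5 ^ 2 + x 6 ^ 2 + x 7 ^ 2 := by
  rw [EuclideanSpace.real_norm_sq_eq, Fin.sum_univ_eight]

/-- The quadratic equation of an octonion; through it a multiplicative map controls real part and
norm. -/
theorem octMul_self (x : Octonion) :
    octMul x x = (2 * x 0) • x - (‖x‖ ^ 2) • octBasis 0 := by
  rw [octonion_norm_sq]
  ext k
  fin_cases k <;> simp [octMul_apply_0, octMul_apply_1, octMul_apply_2, octMul_apply_3,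
    octMul_apply_4, octMul_apply_5, octMul_apply_6, octMul_apply_7, octBasis_apply] <;> ring

/-- An endomorphism of the octonions takes imaginary elements to imaginary elements of the same
norm. -/
theorem octonionHom_imaginary {T : Octonion →ₗ[ℝ] Octonion}
    (hT : ∀ x y, T (octMul x y) = octMul (T x) (T y)) (h1 : T (octBasis 0) = octBasis 0)
    {x : Octonion} (hx : x 0 = 0) : T x 0 = 0 ∧ ‖T x‖ = ‖x‖ := by
  have h := hT x x
  rw [octMul_self, octMul_self, hx, mul_zero, zero_smul, zero_sub, map_neg, map_smul, h1] at h
  have hk : ∀ k, -(‖x‖ ^ 2 * octBasis 0 k) =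
      2 * T x 0 * T x k - ‖T x‖ ^ 2 * octBasis 0 k := fun k => by
    simpa using congrArg (fun z : Octonion => z k) h
  have hy0 : T x 0 = 0 := by
    -- If the real part of T x were nonzero, the imaginary coordinates of (T x)² = −‖x‖² would force
    -- T x to be real, but a nonzero real has positive square.
    by_contra hne
    have h' : ∀ k, k ≠ 0 → T x k = 0 := fun k hk0 => by
      have := hk k
      simp only [octBasis_apply, hk0, if_false, mul_zero, neg_zero, sub_zero] at this
      simpa [hne] using this.symm
    have h2 := octonion_norm_sq (T x)
    rw [h' 1 (by decide), h' 2 (by decide), h' 3 (by decide), h' 4 (by decide), h' 5 (by decide),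
      h' 6 (by decide), h' 7 (by decide)] at h2
    have h3 := hk 0
    rw [h2, octBasis_apply, if_pos rfl] at h3
    have : 0 < T x 0 ^ 2 := by positivity
    nlinarith [sq_nonneg ‖x‖]
  refine ⟨hy0, ?_⟩
  have h3 := hk 0
  rw [hy0, octBasis_apply, if_pos rfl] at h3
  rw [← sq_eq_sq₀ (norm_nonneg _) (norm_nonneg _)]
  linarith

theorem octonionHom_apply_zero {T : Octonion →ₗ[ℝ] Octonion}
    (hT : ∀ x y, T (octMul x y) = octMul (T x) (T y)) (h1 : T (octBasis 0) = octBasis 0)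
    (x : Octonion) : T x 0 = x 0 := by
  have h := (octonionHom_imaginary hT h1 (x := x - x 0 • octBasis 0) (by simp [octBasis_apply])).1
  rw [map_sub, map_smul, h1] at h
  simp [octBasis_apply] at h
  linarith

/-- A unital endomorphism of the octonions is an isometry. -/
theorem octonionHom_norm {T : Octonion →ₗ[ℝ] Octonion}
    (hT : ∀ x y, T (octMul x y) = octMul (T x) (T y)) (h1 : T (octBasis 0) = octBasis 0)
    (x : Octonion) : ‖T x‖ = ‖x‖ := by
  have key : ∀ z : Octonion, ‖z‖ ^ 2 = z 0 ^ 2 + ‖z - z 0 • octBasis 0‖ ^ 2 := fun z => by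
    rw [octonion_norm_sq, octonion_norm_sq]
    simp [octBasis_apply]
    ring
  have h := (octonionHom_imaginary hT h1 (x := x - x 0 • octBasis 0) (by simp [octBasis_apply])).2
  rw [map_sub, map_smul, h1] at h
  rw [← sq_eq_sq₀ (norm_nonneg _) (norm_nonneg _), key, key x, octonionHom_apply_zero hT h1, h]

/-- A unital endomorphism of the octonions, as an element of `G₂`. -/
noncomputable def G2.ofHom (T : Octonion →ₗ[ℝ] Octonion)
    (hT : ∀ x y, T (octMul x y) = octMul (T x) (T y)) (h1 : T (octBasis 0) = octBasis 0) : G2 :=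
  ⟨(ContinuousLinearEquiv.unitsEquiv ℝ Octonion).symm
    (LinearEquiv.ofInjectiveEndo T ((injective_iff_map_eq_zero T).2 fun x hx => by
      rw [← norm_eq_zero, ← octonionHom_norm hT h1, hx, norm_zero])).toContinuousLinearEquiv,
    fun x y => hT x y⟩

theorem G2.toEnd_ofHom (T : Octonion →ₗ[ℝ] Octonion)
    (hT : ∀ x y, T (octMul x y) = octMul (T x) (T y)) (h1 : T (octBasis 0) = octBasis 0)
    (x : Octonion) : G2.toEnd (G2.ofHom T hT h1) x = T x := rfl

namespace G2

theorem toEnd_octMul (α : G2) (x y : Octonion) :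
    toEnd α (octMul x y) = octMul (toEnd α x) (toEnd α y) := α.2 x y

theorem toEnd_mul_apply (α β : G2) (x : Octonion) : toEnd (α * β) x = toEnd α (toEnd β x) := rfl

/-- The inclusion of `G₂` into the endomorphisms, as a homomorphism. -/
def toEndHom : G2 →* (Octonion →L[ℝ] Octonion) where
  toFun := toEnd
  map_one' := rfl
  map_mul' _ _ := rfl

theorem toEnd_apply_inv (α : G2) (x : Octonion) : toEnd α (toEnd α⁻¹ x) = x := by
  rw [← toEnd_mul_apply, mul_inv_cancel]; rfl

/-- By surjectivity the image of the unit is a left unit for all octonions, hence equal to e₀. -/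
theorem toEnd_basis_zero (α : G2) : toEnd α (octBasis 0) = octBasis 0 := by
  have h : octMul (toEnd α (octBasis 0)) (toEnd α (toEnd α⁻¹ (octBasis 0))) =
      toEnd α (toEnd α⁻¹ (octBasis 0)) := by
    rw [← toEnd_octMul, one_octMul]
  rwa [toEnd_apply_inv, octMul_one] at h

theorem norm_toEnd (α : G2) (x : Octonion) : ‖toEnd α x‖ = ‖x‖ :=
  octonionHom_norm (T := (toEnd α).toLinearMap) (toEnd_octMul α) (toEnd_basis_zero α) x

theorem toEnd_apply_zero (α : G2) (x : Octonion) : toEnd α x 0 = x 0 :=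
  octonionHom_apply_zero (T := (toEnd α).toLinearMap) (toEnd_octMul α) (toEnd_basis_zero α) x

theorem isEmbedding_toEnd : Topology.IsEmbedding toEnd :=
  (Units.isOpenEmbedding_val (R := Octonion →L[ℝ] Octonion)).isEmbedding.comp
    Topology.IsEmbedding.subtypeVal

theorem toEnd_injective : Function.Injective toEnd := isEmbedding_toEnd.injective

theorem continuous_toEnd_apply (x : Octonion) : Continuous fun α : G2 => toEnd α x :=
  (ContinuousLinearMap.apply ℝ Octonion x).continuous.comp isEmbedding_toEnd.continuous

/-- Closed conditions for the image: invertibility is automatic, since unital endomorphisms are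
isometries. The unit condition excludes the zero map. -/
theorem range_toEnd : Set.range toEnd = {T : Octonion →L[ℝ] Octonion |
    T (octBasis 0) = octBasis 0 ∧ ∀ x y, T (octMul x y) = octMul (T x) (T y)} := by
  ext T
  constructor
  · rintro ⟨α, rfl⟩
    exact ⟨toEnd_basis_zero α, toEnd_octMul α⟩
  · rintro ⟨h1, hT⟩
    exact ⟨ofHom T.toLinearMap hT h1, rfl⟩

theorem isCompact_range_toEnd : IsCompact (Set.range toEnd) := by
  have : ProperSpace (Octonion →L[ℝ] Octonion) := FiniteDimensional.proper ℝ _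
  have hc : ∀ x, Continuous fun T : Octonion →L[ℝ] Octonion => T x := fun x =>
    (ContinuousLinearMap.apply ℝ Octonion x).continuous
  refine Metric.isCompact_of_isClosed_isBounded ?_ ?_
  · rw [range_toEnd, Set.ofPred_and]
    refine (isClosed_eq (hc _) continuous_const).inter ?_
    simp only [Set.ofPred_forall]
    refine isClosed_iInter fun x => isClosed_iInter fun y => isClosed_eq (hc _) ?_
    exact (octMulL.continuous.comp (hc x)).clm_apply (hc y)
  · refine (Metric.isBounded_closedBall (x := (0 : Octonion →L[ℝ] Octonion)) (r := 1)).subset ?_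
    rintro _ ⟨α, rfl⟩
    rw [mem_closedBall_zero_iff]
    refine ContinuousLinearMap.opNorm_le_bound _ zero_le_one fun x => ?_
    rw [norm_toEnd, one_mul]

instance instCompactSpace : CompactSpace G2 := by
  rw [← isCompact_univ_iff, isEmbedding_toEnd.isCompact_iff, Set.image_univ]
  exact isCompact_range_toEnd

instance instT2Space : T2Space G2 := isEmbedding_toEnd.t2Space

end G2

end OctonionAlgebra

/-! ### The action of `G₂` on the six-sphere -/

section SixSphere

/-- The hypothesis says a(1 − a) = 1, so 1 − a is the inverse of a; alternativity gives the
cancellation. -/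
theorem octMul_sub_one_cancel {a : Octonion} (ha : octMul a a = a - octBasis 0) (x : Octonion) :
    octMul a (octMul (octBasis 0 - a) x) = x ∧ octMul (octMul x (octBasis 0 - a)) a = x := by
  constructor
  · rw [octMul_sub_left, octMul_sub_right, one_octMul, octMul_leftAlternative, ha,
      octMul_sub_left, one_octMul]
    abel
  · rw [octMul_sub_right, octMul_sub_left, octMul_one, octMul_rightAlternative, ha,
      octMul_sub_right, octMul_one]
    abel

/-- Conjugation by a sixth root of unity is an automorphism of the octonions. -/
theorem octConj_octMul {a : Octonion} (ha : octMul a a = a - octBasis 0) (x y : Octonion) :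
    octMul (octMul a (octMul x y)) (octBasis 0 - a) =
      octMul (octMul (octMul a x) (octBasis 0 - a)) (octMul (octMul a y) (octBasis 0 - a)) := by
  set b := octBasis 0 - a with hb
  have hb2 : octMul b b = b - octBasis 0 := by
    simp only [hb, octMul_sub_left, octMul_sub_right, one_octMul, octMul_one, ha]
    abel
  have hab : a = octBasis 0 - b := by rw [hb]; abel
  have hb' := octMul_sub_one_cancel hb2
  rw [← hab] at hb'
  have ha' := octMul_sub_one_cancel ha
  rw [← hb] at ha'
  -- With b = a⁻¹, the left Moufang identity gives a(xy) = (axa)(by), and the right one gives (pq)b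
  -- = (pa)(bqb). The product becomes ((axa)a)((b(by))b); now a² = −b and b² = −a, and the two signs
  -- cancel.
  have h1 : octMul a (octMul x y) = octMul (octMul (octMul a x) a) (octMul b y) := by
    rw [← octMul_leftMoufang, (ha' y).1]
  have h2 : ∀ p q, octMul (octMul p q) b = octMul (octMul p a) (octMul (octMul b q) b) :=
    fun p q => by rw [← octMul_rightMoufang, (hb' p).2]
  have h3 : octMul (octMul (octMul a x) a) a = -octMul (octMul a x) b := by
    rw [octMul_rightAlternative, ha, hb, octMul_sub_right, octMul_sub_right]
    abel
  have h4 : octMul b (octMul b y) = -octMul a y := by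
    have hba : b - octBasis 0 = -a := by rw [hb]; abel
    rw [octMul_leftAlternative, hb2, hba, octMul_neg_left]
  rw [h1, h2, h3, h4, octMul_neg_left, octMul_neg_left, octMul_neg_right, neg_neg]

/-- The sixth root of unity in the direction of `u`. -/
noncomputable def octRoot (u : Octonion) : Octonion :=
  (1 / 2 : ℝ) • octBasis 0 + (√3 / 2) • u

theorem octRoot_octMul_self {u : Octonion} (hu0 : u 0 = 0) (hu : ‖u‖ = 1) :
    octMul (octRoot u) (octRoot u) = octRoot u - octBasis 0 := by
  have h3 : (√3 / 2) * (√3 / 2) = 3 / 4 := by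
    rw [div_mul_div_comm, Real.mul_self_sqrt (by norm_num)]; norm_num
  have huu : octMul u u = -octBasis 0 := by rw [octMul_self, hu0, hu]; module
  simp only [octRoot, octMul_add_left, octMul_add_right, octMul_smul_left, octMul_smul_right,
    one_octMul, octMul_one, huu, smul_smul, smul_add, smul_neg, h3]
  module

/-- Conjugation by the sixth root of unity in the direction of `u`. -/
noncomputable def octConj (u : Octonion) : Octonion →L[ℝ] Octonion :=
  (octMulL.flip (octBasis 0 - octRoot u)).comp (octMulL (octRoot u))

theorem octConj_apply (u x : Octonion) :
    octConj u x = octMul (octMul (octRoot u) x) (octBasis 0 - octRoot u) := rfl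

/-- Conjugation by a sixth root of unity as an element of `G₂`. -/
noncomputable def G2.conj (u : Octonion) (hu0 : u 0 = 0) (hu : ‖u‖ = 1) : G2 :=
  G2.ofHom (octConj u).toLinearMap (octConj_octMul (octRoot_octMul_self hu0 hu)) (by
    change octMul (octMul (octRoot u) (octBasis 0)) (octBasis 0 - octRoot u) = octBasis 0
    rw [octMul_one, octMul_sub_right, octMul_one, octRoot_octMul_self hu0 hu]
    abel)

/-- Rodrigues' formula for the rotation of e₁ by 120° about u, with cos = −1/2, sin = √3/2 and cross
product ½[u, e₁]. -/
theorem octConj_basis_one {u : Octonion} (hu0 : u 0 = 0) (hu : ‖u‖ = 1) :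
    octConj u (octBasis 1) = (-1 / 2 : ℝ) • octBasis 1 + (3 / 2 * u 1) • u +
      (√3 / 4) • (octMul u (octBasis 1) - octMul (octBasis 1) u) := by
  have h3 : (√3 / 2) * (√3 / 2) = 3 / 4 := by
    rw [div_mul_div_comm, Real.mul_self_sqrt (by norm_num)]; norm_num
  have h4 : octMul (octMul u (octBasis 1)) u = octBasis 1 - (2 * u 1) • u := by
    have hn := octonion_norm_sq u
    rw [hu, hu0] at hn
    ext k
    fin_cases k <;> simp [octMul_apply_0, octMul_apply_1, octMul_apply_2, octMul_apply_3,
      octMul_apply_4, octMul_apply_5, octMul_apply_6, octMul_apply_7, octBasis_apply, hu0] <;>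
      first | ring1 | linear_combination -hn
  have h5 : octBasis 0 - octRoot u = (1 / 2 : ℝ) • octBasis 0 - (√3 / 2) • u := by
    rw [octRoot]; module
  rw [octConj_apply, h5, octRoot]
  simp only [octMul_add_left, octMul_sub_right, octMul_smul_left, octMul_smul_right, one_octMul,
    octMul_one, h4, smul_sub, smul_add, smul_smul, h3, ← mul_assoc]
  module

/-- The imaginary octonion with given coordinates. -/
noncomputable def octIm : EuclideanSpace ℝ (Fin 7) →L[ℝ] Octonion :=
  LinearMap.toContinuousLinearMap
    { toFun := fun v => !₂[0, v 0, v 1, v 2, v 3, v 4, v 5, v 6]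
      map_add' := fun v w => by ext k; fin_cases k <;> simp
      map_smul' := fun c v => by ext k; fin_cases k <;> simp }

/-- The coordinates of the imaginary part of an octonion. -/
noncomputable def imPart : Octonion →L[ℝ] EuclideanSpace ℝ (Fin 7) :=
  LinearMap.toContinuousLinearMap
    { toFun := fun x => WithLp.toLp 2 fun i => x i.succ
      map_add' := fun v w => by ext k; simp
      map_smul' := fun c v => by ext k; simp }

theorem octIm_apply (v : EuclideanSpace ℝ (Fin 7)) :
    octIm v = !₂[0, v 0, v 1, v 2, v 3, v 4, v 5, v 6] := rfl

theorem imPart_apply (x : Octonion) (i : Fin 7) : imPart x i = x i.succ := rfl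

theorem octIm_apply_zero (v : EuclideanSpace ℝ (Fin 7)) : octIm v 0 = 0 := rfl

theorem octIm_imPart {x : Octonion} (hx : x 0 = 0) : octIm (imPart x) = x := by
  ext k
  fin_cases k <;> simp [octIm_apply, imPart_apply, hx]

theorem imPart_octIm (v : EuclideanSpace ℝ (Fin 7)) : imPart (octIm v) = v := by
  ext k
  fin_cases k <;> simp [octIm_apply, imPart_apply]

theorem norm_octIm (v : EuclideanSpace ℝ (Fin 7)) : ‖octIm v‖ = ‖v‖ := by
  rw [← sq_eq_sq₀ (norm_nonneg _) (norm_nonneg _), octonion_norm_sq,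
    EuclideanSpace.real_norm_sq_eq, Fin.sum_univ_seven]
  simp [octIm_apply]

theorem octIm_single_zero : octIm (EuclideanSpace.single 0 1) = octBasis 1 := by
  ext k
  fin_cases k <;> simp [octIm_apply, octBasis_apply]

namespace G2

/-- The representation of `G₂` on the imaginary octonions. -/
noncomputable def imRep : G2 →* (EuclideanSpace ℝ (Fin 7) →L[ℝ] EuclideanSpace ℝ (Fin 7)) where
  toFun α := imPart.comp ((toEnd α).comp octIm)
  map_one' := by ext1 v; exact imPart_octIm v
  map_mul' α β := by
    ext1 v
    change imPart (toEnd (α * β) (octIm v)) =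
      imPart (toEnd α (octIm (imPart (toEnd β (octIm v)))))
    rw [octIm_imPart (by rw [toEnd_apply_zero, octIm_apply_zero]), toEnd_mul_apply]

theorem imRep_apply (α : G2) (v : EuclideanSpace ℝ (Fin 7)) :
    imRep α v = imPart (toEnd α (octIm v)) := rfl

theorem octIm_imRep (α : G2) (v : EuclideanSpace ℝ (Fin 7)) :
    octIm (imRep α v) = toEnd α (octIm v) := by
  rw [imRep_apply, octIm_imPart (by rw [toEnd_apply_zero, octIm_apply_zero])]

theorem norm_imRep (α : G2) (v : EuclideanSpace ℝ (Fin 7)) : ‖imRep α v‖ = ‖v‖ := by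
  rw [← norm_octIm, octIm_imRep, norm_toEnd, norm_octIm]

theorem octIm_injective : Function.Injective octIm := fun v w h => by
  rw [← imPart_octIm v, h, imPart_octIm]

theorem mem_isotropy_iff (α : G2) : α ∈ isotropy ↔
    imRep α (EuclideanSpace.single 0 1) = EuclideanSpace.single 0 1 := by
  rw [← octIm_injective.eq_iff, octIm_imRep, octIm_single_zero]
  rfl

theorem continuous_imRep_apply (v : EuclideanSpace ℝ (Fin 7)) :
    Continuous fun α : G2 => imRep α v :=
  imPart.continuous.comp (continuous_toEnd_apply _)

/-- The direction of the rotation by a third of a turn that takes `e₁` to `v`. -/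
noncomputable def axis (v : EuclideanSpace ℝ (Fin 7)) : Octonion :=
  -- Solving `octConj_basis_one` for u: the e₁-coordinate reads v₀ = −1/2 + (3/2)c², which is why
  -- the section lives above height −1/2. On each remaining coordinate pair, p + iq is the inverse
  -- of the complex number (3c − i√3)/2.
  let c := √((2 * v 0 + 1) / 3)
  let p := c / (v 0 + 1)
  let q := √3 / (3 * (v 0 + 1))
  !₂[0, c, p * v 1 - q * v 2, p * v 2 + q * v 1, p * v 3 - q * v 4, p * v 4 + q * v 3,
    p * v 5 - q * v 6, p * v 6 + q * v 5]

theorem apply_zero_of_mem_sphereCap {v : EuclideanSpace ℝ (Fin 7)}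
    (hv : v ∈ sphereCap (EuclideanSpace.single 0 1 : EuclideanSpace ℝ (Fin 7)) (1 / 2)) :
    -(1 / 2) < v 0 := by
  have := hv.2
  rw [EuclideanSpace.inner_single_left] at this
  simpa using this

theorem norm_axis {v : EuclideanSpace ℝ (Fin 7)}
    (hv : v ∈ sphereCap (EuclideanSpace.single 0 1 : EuclideanSpace ℝ (Fin 7)) (1 / 2)) :
    ‖axis v‖ = 1 := by
  have h0 := apply_zero_of_mem_sphereCap hv
  have hn := EuclideanSpace.real_norm_sq_eq v
  rw [hv.1, Fin.sum_univ_seven] at hn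
  have hc : √((2 * v 0 + 1) / 3) ^ 2 = (2 * v 0 + 1) / 3 := Real.sq_sqrt (by linarith)
  have h3 : √3 ^ 2 = (3 : ℝ) := Real.sq_sqrt (by norm_num)
  have hd : v 0 + 1 ≠ 0 := by linarith
  rw [← sq_eq_sq₀ (norm_nonneg _) zero_le_one, octonion_norm_sq]
  set c := √((2 * v 0 + 1) / 3) with hcdef
  simp [axis, ← hcdef]
  have hpq : (c / (v 0 + 1)) ^ 2 + (√3 / (3 * (v 0 + 1))) ^ 2 = 2 / 3 / (v 0 + 1) := by
    rw [div_pow, div_pow, hc, h3]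
    field_simp
    ring
  have hfin : 2 / 3 / (v 0 + 1) * (1 - v 0 ^ 2) = 2 / 3 * (1 - v 0) := by
    field_simp
    ring
  linear_combination hc + hpq * (1 - v 0 ^ 2) + hfin -
    ((c / (v 0 + 1)) ^ 2 + (√3 / (3 * (v 0 + 1))) ^ 2) * hn

theorem octConj_axis {v : EuclideanSpace ℝ (Fin 7)}
    (hv : v ∈ sphereCap (EuclideanSpace.single 0 1 : EuclideanSpace ℝ (Fin 7)) (1 / 2)) :
    octConj (axis v) (octBasis 1) = octIm v := by
  have h0 := apply_zero_of_mem_sphereCap hv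
  have hc : √((2 * v 0 + 1) / 3) ^ 2 = (2 * v 0 + 1) / 3 := Real.sq_sqrt (by linarith)
  have h3 : √3 ^ 2 = (3 : ℝ) := Real.sq_sqrt (by norm_num)
  have hd : v 0 + 1 ≠ 0 := by linarith
  rw [octConj_basis_one rfl (norm_axis hv)]
  set c := √((2 * v 0 + 1) / 3) with hcdef
  have e1 : 3 / 2 * c * (c / (v 0 + 1)) + √3 / 2 * (√3 / (3 * (v 0 + 1))) = 1 := by
    field_simp
    linear_combination 9 * hc + h3
  have e2 : 3 / 2 * c * (√3 / (3 * (v 0 + 1))) - √3 / 2 * (c / (v 0 + 1)) = 0 := by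
    field_simp
    ring
  ext k
  fin_cases k <;> simp [octMul_apply_0, octMul_apply_1, octMul_apply_2, octMul_apply_3,
      octMul_apply_4, octMul_apply_5, octMul_apply_6, octMul_apply_7, octBasis_apply, axis,
      octIm_apply, ← hcdef]
  · linear_combination 3 / 2 * hc
  · linear_combination v 1 * e1 - v 2 * e2
  · linear_combination v 2 * e1 + v 1 * e2
  · linear_combination v 3 * e1 - v 4 * e2
  · linear_combination v 4 * e1 + v 3 * e2
  · linear_combination v 5 * e1 - v 6 * e2
  · linear_combination v 6 * e1 + v 5 * e2

theorem continuousOn_octConj_axis :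
    ContinuousOn (fun v => octConj (axis v))
      (sphereCap (EuclideanSpace.single 0 1 : EuclideanSpace ℝ (Fin 7)) (1 / 2)) := by
  have hc : Continuous octConj := by
    have h : Continuous octRoot := by unfold octRoot; fun_prop
    exact (octMulL.flip.continuous.comp (continuous_const.sub h)).clm_comp
      (octMulL.continuous.comp h)
  refine hc.comp_continuousOn ?_
  have hd : ∀ v ∈ sphereCap (EuclideanSpace.single 0 1 : EuclideanSpace ℝ (Fin 7)) (1 / 2),
      v 0 + 1 ≠ 0 := fun v hv => by linarith [apply_zero_of_mem_sphereCap hv]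
  have hv : ∀ i, ContinuousOn (fun v : EuclideanSpace ℝ (Fin 7) => v i)
      (sphereCap (EuclideanSpace.single 0 1 : EuclideanSpace ℝ (Fin 7)) (1 / 2)) := fun i =>
    Continuous.continuousOn (by fun_prop)
  have hcc : ContinuousOn (fun v : EuclideanSpace ℝ (Fin 7) => √((2 * v 0 + 1) / 3))
      (sphereCap (EuclideanSpace.single 0 1 : EuclideanSpace ℝ (Fin 7)) (1 / 2)) :=
    Continuous.continuousOn (by fun_prop)
  have hp : ContinuousOn (fun v : EuclideanSpace ℝ (Fin 7) => √((2 * v 0 + 1) / 3) / (v 0 + 1))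
      (sphereCap (EuclideanSpace.single 0 1 : EuclideanSpace ℝ (Fin 7)) (1 / 2)) :=
    hcc.div (Continuous.continuousOn (by fun_prop)) hd
  have hq : ContinuousOn (fun v : EuclideanSpace ℝ (Fin 7) => √3 / (3 * (v 0 + 1)))
      (sphereCap (EuclideanSpace.single 0 1 : EuclideanSpace ℝ (Fin 7)) (1 / 2)) :=
    continuousOn_const.div (Continuous.continuousOn (by fun_prop)) fun v hv =>
      mul_ne_zero (by norm_num) (hd v hv)
  refine (PiLp.continuous_toLp 2 _).comp_continuousOn (continuousOn_pi.2 fun k => ?_)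
  fin_cases k
  · exact continuousOn_const
  · exact hcc
  · exact (hp.mul (hv 1)).sub (hq.mul (hv 2))
  · exact (hp.mul (hv 2)).add (hq.mul (hv 1))
  · exact (hp.mul (hv 3)).sub (hq.mul (hv 4))
  · exact (hp.mul (hv 4)).add (hq.mul (hv 3))
  · exact (hp.mul (hv 5)).sub (hq.mul (hv 6))
  · exact (hp.mul (hv 6)).add (hq.mul (hv 5))

/-- The automorphism that changes the sign of `e₁, e₃, e₅, e₇`. -/
noncomputable def signChange : G2 :=
  ofHom
    { toFun := fun x => !₂[x 0, -x 1, x 2, -x 3, x 4, -x 5, x 6, -x 7]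
      map_add' := fun x y => by ext k; fin_cases k <;> simp <;> ring
      map_smul' := fun c x => by ext k; fin_cases k <;> simp }
    (fun x y => by
      ext k
      fin_cases k <;> simp [octMul_apply_0, octMul_apply_1, octMul_apply_2, octMul_apply_3,
        octMul_apply_4, octMul_apply_5, octMul_apply_6, octMul_apply_7] <;> ring)
    (by ext k; fin_cases k <;> simp [octBasis_apply])

theorem imRep_signChange :
    imRep signChange (EuclideanSpace.single 0 1) = -EuclideanSpace.single 0 1 := by
  rw [← octIm_injective.eq_iff, octIm_imRep, map_neg, octIm_single_zero, signChange, toEnd_ofHom]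
  ext k
  fin_cases k <;> simp [octBasis_apply]

open Classical in
/-- A section of the orbit map of `e₁` over the cap of height more than `-1/2`. -/
noncomputable def capSection (v : EuclideanSpace ℝ (Fin 7)) : G2 :=
  if hv : v ∈ sphereCap (EuclideanSpace.single 0 1 : EuclideanSpace ℝ (Fin 7)) (1 / 2) then
    conj (axis v) rfl (norm_axis hv) else 1

theorem toEnd_capSection {v : EuclideanSpace ℝ (Fin 7)}
    (hv : v ∈ sphereCap (EuclideanSpace.single 0 1 : EuclideanSpace ℝ (Fin 7)) (1 / 2)) :
    toEnd (capSection v) = octConj (axis v) := by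
  rw [capSection, dif_pos hv]
  rfl

theorem imRep_capSection {v : EuclideanSpace ℝ (Fin 7)}
    (hv : v ∈ sphereCap (EuclideanSpace.single 0 1 : EuclideanSpace ℝ (Fin 7)) (1 / 2)) :
    imRep (capSection v) (EuclideanSpace.single 0 1) = v := by
  rw [← octIm_injective.eq_iff, octIm_imRep, octIm_single_zero, toEnd_capSection hv,
    octConj_axis hv]

theorem continuousOn_capSection : ContinuousOn capSection
    (sphereCap (EuclideanSpace.single 0 1 : EuclideanSpace ℝ (Fin 7)) (1 / 2)) := by
  rw [isEmbedding_toEnd.continuousOn_iff]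
  exact continuousOn_octConj_axis.congr fun v hv => toEnd_capSection hv

/-- Outside the cap of the section, −v lies in the cap, and `signChange` turns e₁ into −e₁. -/
theorem exists_imRep_eq {v : EuclideanSpace ℝ (Fin 7)} (hv : ‖v‖ = 1) :
    ∃ α, imRep α (EuclideanSpace.single 0 1) = v := by
  have hmem : ∀ w : EuclideanSpace ℝ (Fin 7), ‖w‖ = 1 → -(1 / 2) < w 0 →
      w ∈ sphereCap (EuclideanSpace.single 0 1 : EuclideanSpace ℝ (Fin 7)) (1 / 2) :=
    fun w hw h => ⟨hw, by rw [EuclideanSpace.inner_single_left]; simpa using h⟩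
  by_cases h : -(1 / 2) < v 0
  · exact ⟨_, imRep_capSection (hmem v hv h)⟩
  · have h2 := imRep_capSection (hmem (-v) (by rwa [norm_neg]) (by simp; linarith))
    refine ⟨capSection (-v) * signChange, ?_⟩
    rw [map_mul, mul_apply_eq_comp, imRep_signChange, map_neg, h2, neg_neg]

/-- The orbit map of `e₁`. -/
noncomputable def orbitMap (α : G2) : Metric.sphere (0 : EuclideanSpace ℝ (Fin 7)) 1 :=
  ⟨imRep α (EuclideanSpace.single 0 1), by
    rw [mem_sphere_zero_iff_norm, norm_imRep]; simp⟩

theorem orbitMap_eq_iff (α β : G2) : orbitMap α = orbitMap β ↔ α⁻¹ * β ∈ isotropy := by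
  rw [mem_isotropy_iff, map_mul, mul_apply_eq_comp, orbitMap, orbitMap, Subtype.mk.injEq]
  constructor
  · intro h
    rw [← h, ← mul_apply_eq_comp, ← map_mul, inv_mul_cancel, map_one, one_apply_eq_self]
  · intro h
    conv_lhs => rw [← h]
    rw [← mul_apply_eq_comp, ← map_mul, mul_inv_cancel, map_one, one_apply_eq_self]

theorem exists_quotient_homeomorph :
    ∃ h : G2 ⧸ isotropy ≃ₜ Metric.sphere (0 : EuclideanSpace ℝ (Fin 7)) 1,
      ∀ (α : G2) (i : Fin 7),
        (h (QuotientGroup.mk α) : EuclideanSpace ℝ (Fin 7)) i =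
          toEnd α (octBasis 1) i.succ := by
  let f : G2 ⧸ isotropy → Metric.sphere (0 : EuclideanSpace ℝ (Fin 7)) 1 :=
    Quotient.lift orbitMap fun α β h => (orbitMap_eq_iff α β).2 (QuotientGroup.leftRel_apply.1 h)
  have hf : Function.Bijective f := by
    constructor
    · rintro ⟨α⟩ ⟨β⟩ h
      exact QuotientGroup.eq.2 ((orbitMap_eq_iff α β).1 h)
    · rintro ⟨v, hv⟩
      obtain ⟨α, hα⟩ := exists_imRep_eq (mem_sphere_zero_iff_norm.1 hv)
      exact ⟨QuotientGroup.mk α, Subtype.ext hα⟩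
  have hc : Continuous (Equiv.ofBijective f hf) :=
    Continuous.quotient_lift ((continuous_imRep_apply _).subtype_mk _) _
  -- A continuous bijection from a compact space to a Hausdorff space is a homeomorphism.
  have : CompactSpace (G2 ⧸ isotropy) := Quotient.compactSpace
  refine ⟨hc.homeoOfEquivCompactToT2, fun α i => ?_⟩
  change imRep α (EuclideanSpace.single 0 1) i = _
  rw [imRep_apply, octIm_single_zero, imPart_apply]

end G2

end SixSphere

/-! ### The isotropy subgroup of `e₁` -/

section Isotropy

open Matrix

/-- The bridge to SU(3): besides complex scalars, only the Hermitian form and the conjugated cross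
product enter. -/
theorem octMul_octOfComplex (a b : ℂ) (m n : Fin 3 → ℂ) :
    octMul (octOfComplex a m) (octOfComplex b n) =
      octOfComplex (a * b - star n ⬝ᵥ m) (a • n + star b • m - star (crossProduct m n)) := by
  ext k
  fin_cases k <;> simp [octMul_apply_0, octMul_apply_1, octMul_apply_2, octMul_apply_3,
    octMul_apply_4, octMul_apply_5, octMul_apply_6, octMul_apply_7, octOfComplex, cross_apply,
    dotProduct, Fin.sum_univ_three] <;> ring

theorem octOfComplex_add (a b : ℂ) (m n : Fin 3 → ℂ) :
    octOfComplex (a + b) (m + n) = octOfComplex a m + octOfComplex b n := by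
  ext k
  fin_cases k <;> simp [octOfComplex]

theorem octOfComplex_zero_right (a : ℂ) :
    octOfComplex a 0 = a.re • octBasis 0 + a.im • octBasis 1 := by
  ext k
  fin_cases k <;> simp [octOfComplex, octBasis_apply]

/-- The component in `ℂ` of an octonion. -/
def octFst (x : Octonion) : ℂ := ⟨x 0, x 1⟩

/-- The component in `ℂ³` of an octonion. -/
def octSnd (x : Octonion) : Fin 3 → ℂ := ![⟨x 2, x 3⟩, ⟨x 4, x 5⟩, ⟨x 6, x 7⟩]

theorem octOfComplex_octFst_octSnd (x : Octonion) : octOfComplex (octFst x) (octSnd x) = x := by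
  ext k
  fin_cases k <;> rfl

theorem octFst_octOfComplex (a : ℂ) (m : Fin 3 → ℂ) : octFst (octOfComplex a m) = a := rfl

theorem octSnd_octOfComplex (a : ℂ) (m : Fin 3 → ℂ) : octSnd (octOfComplex a m) = m := by
  ext i
  fin_cases i <;> rfl

theorem octOfComplex_inj {a b : ℂ} {m n : Fin 3 → ℂ} (h : octOfComplex a m = octOfComplex b n) :
    a = b ∧ m = n :=
  ⟨by rw [← octFst_octOfComplex a m, h, octFst_octOfComplex],
    by rw [← octSnd_octOfComplex a m, h, octSnd_octOfComplex]⟩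

/-- Paired with a third vector l, this is det[Am, An, Al] = det A · det[m, n, l]. -/
theorem transpose_mulVec_crossProduct {R : Type*} [CommRing R] (A : Matrix (Fin 3) (Fin 3) R)
    (m n : Fin 3 → R) :
    Aᵀ *ᵥ crossProduct (A *ᵥ m) (A *ᵥ n) = A.det • crossProduct m n := by
  ext i
  fin_cases i <;> simp [cross_apply, mulVec, dotProduct, Fin.sum_univ_three, det_fin_three] <;>
    ring

theorem det_eq_crossProduct_dotProduct {R : Type*} [CommRing R] (A : Matrix (Fin 3) (Fin 3) R) :
    A.det = crossProduct (A.col 0) (A.col 1) ⬝ᵥ A.col 2 := by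
  simp [cross_apply, dotProduct, Fin.sum_univ_three, det_fin_three]
  ring

/-- For a unitary A, the transpose is inverse to the entrywise conjugate Ā; with det A = 1 the
cofactor identity becomes Am × An = Ā(m × n). -/
theorem star_crossProduct_mulVec {A : Matrix (Fin 3) (Fin 3) ℂ}
    (hA : A ∈ specialUnitaryGroup (Fin 3) ℂ) (m n : Fin 3 → ℂ) :
    star (crossProduct (A *ᵥ m) (A *ᵥ n)) = A *ᵥ star (crossProduct m n) := by
  obtain ⟨hU, hdet⟩ := mem_specialUnitaryGroup_iff.1 hA
  have h := transpose_mulVec_crossProduct A m n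
  rw [hdet, one_smul] at h
  have hU' : A * Aᵀᴴᵀ = 1 := mem_unitaryGroup_iff.1 hU
  rw [← h, star_mulVec, mulVec_vecMul, hU', one_mulVec]

theorem star_dotProduct_mulVec {A : Matrix (Fin 3) (Fin 3) ℂ}
    (hA : A ∈ unitaryGroup (Fin 3) ℂ) (m n : Fin 3 → ℂ) :
    star (A *ᵥ n) ⬝ᵥ (A *ᵥ m) = star n ⬝ᵥ m := by
  have h : Aᴴ * A = 1 := mem_unitaryGroup_iff'.1 hA
  rw [star_mulVec, ← dotProduct_mulVec, mulVec_mulVec, h, one_mulVec]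

/-- The action of a matrix on `ℂ ⊕ ℂ³`, trivial on the first summand. -/
noncomputable def octMulVec (A : Matrix (Fin 3) (Fin 3) ℂ) : Octonion →ₗ[ℝ] Octonion where
  toFun x := octOfComplex (octFst x) (A *ᵥ octSnd x)
  map_add' x y := by
    rw [← octOfComplex_add, ← mulVec_add]
    congr 2
    ext i
    fin_cases i <;> simp [octSnd] <;> rfl
  map_smul' c x := by
    have h1 : octSnd (c • x) = (c : ℂ) • octSnd x := by
      ext i
      fin_cases i <;> simp [octSnd, Complex.ext_iff]
    rw [h1, mulVec_smul]
    ext k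
    fin_cases k <;> simp [octOfComplex, octFst]

theorem octMulVec_octOfComplex (A : Matrix (Fin 3) (Fin 3) ℂ) (a : ℂ) (m : Fin 3 → ℂ) :
    octMulVec A (octOfComplex a m) = octOfComplex a (A *ᵥ m) := by
  change octOfComplex _ (A *ᵥ octSnd _) = _
  rw [octSnd_octOfComplex, octFst_octOfComplex]

theorem octMulVec_octMul {A : Matrix (Fin 3) (Fin 3) ℂ}
    (hA : A ∈ specialUnitaryGroup (Fin 3) ℂ) (x y : Octonion) :
    octMulVec A (octMul x y) = octMul (octMulVec A x) (octMulVec A y) := by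
  rw [← octOfComplex_octFst_octSnd x, ← octOfComplex_octFst_octSnd y]
  rw [octMul_octOfComplex]
  simp only [octMulVec_octOfComplex]
  rw [octMul_octOfComplex, mulVec_sub, mulVec_add, mulVec_smul, mulVec_smul,
    star_crossProduct_mulVec hA, star_dotProduct_mulVec hA.1]

namespace G2

/-- `SU(3)` acts on the octonions by automorphisms. -/
noncomputable def ofSpecialUnitary (A : specialUnitaryGroup (Fin 3) ℂ) : G2 :=
  ofHom (octMulVec A) (octMulVec_octMul A.2) (by
    have h : octBasis 0 = octOfComplex 1 0 := by simp [octOfComplex_zero_right]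
    rw [h, octMulVec_octOfComplex, mulVec_zero])

theorem toEnd_ofSpecialUnitary (A : specialUnitaryGroup (Fin 3) ℂ) (a : ℂ) (m : Fin 3 → ℂ) :
    toEnd (ofSpecialUnitary A) (octOfComplex a m) =
      octOfComplex a ((A : Matrix (Fin 3) (Fin 3) ℂ) *ᵥ m) :=
  octMulVec_octOfComplex _ _ _

theorem ofSpecialUnitary_mem (A : specialUnitaryGroup (Fin 3) ℂ) :
    ofSpecialUnitary A ∈ isotropy := by
  have h : octBasis 1 = octOfComplex Complex.I 0 := by simp [octOfComplex_zero_right]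
  change toEnd _ (octBasis 1) = _
  rw [h, toEnd_ofSpecialUnitary, mulVec_zero]

theorem ext_octOfComplex {α β : G2}
    (h : ∀ a m, toEnd α (octOfComplex a m) = toEnd β (octOfComplex a m)) : α = β := by
  refine toEnd_injective (ContinuousLinearMap.ext fun x => ?_)
  rw [← octOfComplex_octFst_octSnd x, h]

/-- The homomorphism from `SU(3)` to the isotropy subgroup of `e₁`. -/
noncomputable def specialUnitaryHom : specialUnitaryGroup (Fin 3) ℂ →* isotropy where
  toFun A := ⟨ofSpecialUnitary A, ofSpecialUnitary_mem A⟩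
  map_one' := Subtype.ext (ext_octOfComplex fun a m => by
    rw [toEnd_ofSpecialUnitary]
    change octOfComplex a ((1 : Matrix (Fin 3) (Fin 3) ℂ) *ᵥ m) = octOfComplex a m
    rw [one_mulVec])
  map_mul' A B := Subtype.ext (ext_octOfComplex fun a m => by
    change _ = toEnd (ofSpecialUnitary A * ofSpecialUnitary B) (octOfComplex a m)
    rw [toEnd_mul_apply, toEnd_ofSpecialUnitary, toEnd_ofSpecialUnitary, toEnd_ofSpecialUnitary,
      mulVec_mulVec]
    rfl)

theorem toEnd_specialUnitaryHom (A : specialUnitaryGroup (Fin 3) ℂ) (a : ℂ) (m : Fin 3 → ℂ) :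
    toEnd (specialUnitaryHom A : G2) (octOfComplex a m) =
      octOfComplex a ((A : Matrix (Fin 3) (Fin 3) ℂ) *ᵥ m) :=
  toEnd_ofSpecialUnitary A a m

theorem specialUnitaryHom_injective : Function.Injective specialUnitaryHom := fun A B h => by
  refine Subtype.ext (Matrix.ext_of_mulVec_single fun i => ?_)
  exact (octOfComplex_inj (by rw [← toEnd_specialUnitaryHom, h, toEnd_specialUnitaryHom] :
    octOfComplex 0 ((A : Matrix (Fin 3) (Fin 3) ℂ) *ᵥ Pi.single i 1) =
      octOfComplex 0 ((B : Matrix (Fin 3) (Fin 3) ℂ) *ᵥ Pi.single i 1))).2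

/-- The real part is always preserved, and the e₁-coordinate of x is minus the real part of x e₁. -/
theorem octFst_toEnd {α : G2} (hα : α ∈ isotropy) (x : Octonion) : octFst (toEnd α x) = octFst x := by
  have h0 := toEnd_apply_zero α
  have hα' : toEnd α (octBasis 1) = octBasis 1 := hα
  have h1 := h0 (octMul x (octBasis 1))
  rw [toEnd_octMul, hα'] at h1
  simp [octMul_apply_0, octBasis_apply] at h1
  rw [octFst, h0, h1]
  rfl

theorem toEnd_octOfComplex_zero {α : G2} (hα : α ∈ isotropy) (a : ℂ) : toEnd α (octOfComplex a 0) = octOfComplex a 0 := by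
  have hα' : toEnd α (octBasis 1) = octBasis 1 := hα
  rw [octOfComplex_zero_right, map_add, map_smul, map_smul, toEnd_basis_zero, hα']

theorem toEnd_octOfComplex_octSnd {α : G2} (hα : α ∈ isotropy) (m : Fin 3 → ℂ) :
    toEnd α (octOfComplex 0 m) = octOfComplex 0 (octSnd (toEnd α (octOfComplex 0 m))) := by
  conv_lhs => rw [← octOfComplex_octFst_octSnd (toEnd α (octOfComplex 0 m)), octFst_toEnd hα]
  rfl

/-- The complex linear map of `ℂ³` induced by an automorphism that fixes `e₁`. -/
noncomputable def isotropyLinearMap {α : G2} (hα : α ∈ isotropy) : (Fin 3 → ℂ) →ₗ[ℂ] (Fin 3 → ℂ) where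
  toFun m := octSnd (toEnd α (octOfComplex 0 m))
  map_add' m n := by
    refine (octOfComplex_inj (a := 0) (b := 0 + 0) ?_).2
    rw [octOfComplex_add, ← toEnd_octOfComplex_octSnd hα, ← toEnd_octOfComplex_octSnd hα,
      ← toEnd_octOfComplex_octSnd hα, ← map_add, ← octOfComplex_add, add_zero]
  map_smul' c m := by
    -- Complex scalars act on ℂ³ by left multiplication with elements of ℂ, which the automorphism
    -- fixes.
    have h : ∀ n : Fin 3 → ℂ,
        octOfComplex 0 (c • n) = octMul (octOfComplex c 0) (octOfComplex 0 n) := fun n => by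
      rw [octMul_octOfComplex]; simp
    refine (octOfComplex_inj (a := 0) (b := 0) ?_).2
    rw [← toEnd_octOfComplex_octSnd hα, RingHom.id_apply, h, h, toEnd_octMul,
      ← toEnd_octOfComplex_octSnd hα, toEnd_octOfComplex_zero hα]

theorem toEnd_octOfComplex {α : G2} (hα : α ∈ isotropy) (a : ℂ) (m : Fin 3 → ℂ) :
    toEnd α (octOfComplex a m) = octOfComplex a (isotropyLinearMap hα m) := by
  have h : ∀ n : Fin 3 → ℂ, octOfComplex a n = octOfComplex a 0 + octOfComplex 0 n := fun n => by
    rw [← octOfComplex_add, add_zero, zero_add]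
  rw [h m, h (isotropyLinearMap hα m), map_add, toEnd_octOfComplex_zero hα, toEnd_octOfComplex_octSnd hα]
  rfl

theorem isotropyLinearMap_mul {α : G2} (hα : α ∈ isotropy) (m n : Fin 3 → ℂ) :
    star (isotropyLinearMap hα n) ⬝ᵥ isotropyLinearMap hα m = star n ⬝ᵥ m ∧
      isotropyLinearMap hα (star (crossProduct m n)) =
        star (crossProduct (isotropyLinearMap hα m) (isotropyLinearMap hα n)) := by
  have h := toEnd_octMul α (octOfComplex 0 m) (octOfComplex 0 n)
  rw [octMul_octOfComplex, toEnd_octOfComplex hα, toEnd_octOfComplex hα, toEnd_octOfComplex hα,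
    octMul_octOfComplex] at h
  simpa [eq_comm] using octOfComplex_inj h

theorem exists_specialUnitaryHom_eq {α : G2} (hα : α ∈ isotropy) : ∃ A, (specialUnitaryHom A : G2) = α := by
  set f := isotropyLinearMap hα with hf
  have hA : ∀ m, LinearMap.toMatrix' f *ᵥ m = f m := fun m => by
    rw [← Matrix.toLin'_apply, Matrix.toLin'_toMatrix']
  set A := LinearMap.toMatrix' f
  have hcol : ∀ i, A.col i = f (Pi.single i 1) := fun i => by rw [← hA, mulVec_single_one]
  have hU : A ∈ unitaryGroup (Fin 3) ℂ := by
    rw [mem_unitaryGroup_iff']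
    ext i j
    have h := (isotropyLinearMap_mul hα (Pi.single j 1) (Pi.single i 1)).1
    rw [← hf, ← hcol, ← hcol] at h
    change star (A.col i) ⬝ᵥ A.col j = _
    rw [h]
    simp [Matrix.one_apply, Pi.single_apply, eq_comm]
  -- Applying α to the conjugated cross product of the first two basis vectors gives the third
  -- column as the conjugate of the cross product of the first two. The determinant is then the
  -- squared norm of the third column.
  have hdet : A.det = 1 := by
    have h := (isotropyLinearMap_mul hα (Pi.single 0 1) (Pi.single 1 1)).2
    have h2 := (isotropyLinearMap_mul hα (Pi.single 2 1) (Pi.single 2 1)).1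
    have h01 : star (crossProduct (Pi.single 0 1) (Pi.single 1 1 : Fin 3 → ℂ)) =
        Pi.single 2 1 := by
      ext i
      fin_cases i <;> simp [cross_apply]
    rw [h01, ← hf, ← hcol, ← hcol, ← hcol] at h
    rw [← hf, ← hcol] at h2
    rw [det_eq_crossProduct_dotProduct, ← star_star (crossProduct (A.col 0) (A.col 1)), ← h, h2]
    simp
  refine ⟨⟨A, mem_specialUnitaryGroup_iff.2 ⟨hU, hdet⟩⟩, ext_octOfComplex fun a m => ?_⟩
  rw [toEnd_specialUnitaryHom, toEnd_octOfComplex hα]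
  exact congrArg _ (hA m)

theorem continuous_specialUnitaryHom : Continuous specialUnitaryHom := by
  refine Continuous.subtype_mk (isEmbedding_toEnd.continuous_iff.2 ?_) _
  refine continuous_clm_apply.2 fun x => ?_
  obtain ⟨a, m, rfl⟩ : ∃ a m, x = octOfComplex a m := ⟨_, _, (octOfComplex_octFst_octSnd x).symm⟩
  simp only [Function.comp_apply, toEnd_ofSpecialUnitary]
  have h : ∀ i, Continuous fun A : specialUnitaryGroup (Fin 3) ℂ =>
      ((A : Matrix (Fin 3) (Fin 3) ℂ) *ᵥ m) i := fun i =>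
    (continuous_apply i).comp (continuous_subtype_val.matrix_mulVec continuous_const)
  refine (PiLp.continuous_toLp 2 _).comp (continuous_pi fun k => ?_)
  fin_cases k
  · exact continuous_const
  · exact continuous_const
  · exact Complex.continuous_re.comp (h 0)
  · exact Complex.continuous_im.comp (h 0)
  · exact Complex.continuous_re.comp (h 1)
  · exact Complex.continuous_im.comp (h 1)
  · exact Complex.continuous_re.comp (h 2)
  · exact Complex.continuous_im.comp (h 2)

/-- The isotropy subgroup of `e₁` is `SU(3)`. -/
noncomputable def specialUnitaryEquiv : specialUnitaryGroup (Fin 3) ℂ ≃ₜ* isotropy :=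
  let e := MulEquiv.ofBijective specialUnitaryHom ⟨specialUnitaryHom_injective, fun α =>
    (exists_specialUnitaryHom_eq α.2).imp fun _ h => Subtype.ext h⟩
  { e with
    continuous_toFun := continuous_specialUnitaryHom
    continuous_invFun := (Continuous.homeoOfEquivCompactToT2 (f := e.toEquiv)
      continuous_specialUnitaryHom).symm.continuous }

theorem toEnd_specialUnitaryEquiv (A : specialUnitaryGroup (Fin 3) ℂ) (a : ℂ) (m : Fin 3 → ℂ) :
    toEnd (specialUnitaryEquiv A : G2) (octOfComplex a m) =
      octOfComplex a ((A : Matrix (Fin 3) (Fin 3) ℂ) *ᵥ m) :=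
  toEnd_ofSpecialUnitary A a m

end G2

end Isotropy

/-- `G₂` is simply connected. -/
instance G2.instSimplyConnectedSpace : SimplyConnectedSpace G2 := by
  have h3 := specialUnitaryGroup_simplyConnected 2
  have : SimplyConnectedSpace G2.isotropy :=
    G2.specialUnitaryEquiv.toHomeomorph.symm.toHomotopyEquiv.simplyConnectedSpace
  refine SimplyConnectedSpace.of_sphere_action (E := EuclideanSpace ℝ (Fin 7)) ?_ G2.imRep
    G2.norm_imRep (e := EuclideanSpace.single 0 1) (by simp) (G2.continuous_imRep_apply _)
    G2.isotropy G2.mem_isotropy_iff (c := 1 / 2) (by norm_num) (by norm_num)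
    G2.continuousOn_capSection (fun v hv => G2.imRep_capSection hv) G2.imRep_signChange
  rw [rank_eq_card_basis (EuclideanSpace.basisFun (Fin 7) ℝ).toBasis, Fintype.card_fin]
  norm_num

/-! ### Derivations of the octonions -/

section Derivations

open scoped InnerProductSpace

theorem octonion_inner (x y : Octonion) : ⟪x, y⟫_ℝ =
    x 0 * y 0 + x 1 * y 1 + x 2 * y 2 + x 3 * y 3 + x 4 * y 4 + x 5 * y 5 + x 6 * y 6 +
      x 7 * y 7 := by
  rw [PiLp.inner_apply, Fin.sum_univ_eight]
  simp [mul_comm]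

/-- Polarization of the quadratic equation `octMul_self`. -/
theorem octMul_add_swap (x y : Octonion) : octMul x y + octMul y x =
    (2 * x 0) • y + (2 * y 0) • x - (2 * ⟪x, y⟫_ℝ) • octBasis 0 := by
  rw [octonion_inner]
  ext k
  fin_cases k <;> simp [octMul_apply_0, octMul_apply_1, octMul_apply_2, octMul_apply_3,
    octMul_apply_4, octMul_apply_5, octMul_apply_6, octMul_apply_7, octBasis_apply] <;> ring

theorem inner_octMul_left (x y : Octonion) : ⟪x, octMul x y⟫_ℝ = ‖x‖ ^ 2 * y 0 := by
  rw [octonion_inner, octonion_norm_sq]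
  simp only [octMul_apply_0, octMul_apply_1, octMul_apply_2, octMul_apply_3,
    octMul_apply_4, octMul_apply_5, octMul_apply_6, octMul_apply_7]
  ring

theorem inner_octMul_right (x y : Octonion) : ⟪y, octMul x y⟫_ℝ = ‖y‖ ^ 2 * x 0 := by
  rw [octonion_inner, octonion_norm_sq]
  simp only [octMul_apply_0, octMul_apply_1, octMul_apply_2, octMul_apply_3,
    octMul_apply_4, octMul_apply_5, octMul_apply_6, octMul_apply_7]
  ring

theorem norm_octMul (x y : Octonion) : ‖octMul x y‖ = ‖x‖ * ‖y‖ := by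
  rw [← sq_eq_sq₀ (norm_nonneg _) (by positivity), mul_pow, octonion_norm_sq, octonion_norm_sq,
    octonion_norm_sq]
  simp only [octMul_apply_0, octMul_apply_1, octMul_apply_2, octMul_apply_3,
    octMul_apply_4, octMul_apply_5, octMul_apply_6, octMul_apply_7]
  ring

theorem octMul_apply_zero (x y : Octonion) : octMul x y 0 = 2 * (x 0 * y 0) - ⟪x, y⟫_ℝ := by
  rw [octonion_inner, octMul_apply_0]
  ring

/-- The derivations of the octonions. -/
def octDer : Submodule ℝ (Octonion →L[ℝ] Octonion) where
  carrier := {X | ∀ x y, X (octMul x y) = octMul (X x) y + octMul x (X y)}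
  add_mem' {X Y} hX hY x y := by
    simp only [add_apply, hX x y, hY x y, octMul_add_left, octMul_add_right]
    abel
  zero_mem' x y := by simp [octMul_zero_left, octMul_zero_right]
  smul_mem' c X hX x y := by
    simp only [smul_apply, hX x y, octMul_smul_left, octMul_smul_right, smul_add]

theorem mem_octDer_iff_derivationDefect {X : Octonion →L[ℝ] Octonion} :
    X ∈ octDer ↔ derivationDefect octMulL X = 0 := by
  constructor
  · intro h
    ext1 x
    ext1 y
    rw [derivationDefect_apply, octMulL_apply, octMulL_apply, octMulL_apply, h x y]
    simp
  · intro h x y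
    have := derivationDefect_apply octMulL X x y
    rw [h, octMulL_apply, octMulL_apply, octMulL_apply] at this
    have h0 : X (octMul x y) - octMul (X x) y - octMul x (X y) = 0 := this.symm
    rw [sub_sub, sub_eq_zero] at h0
    exact h0

namespace octDer

variable {X : Octonion →L[ℝ] Octonion}

theorem apply_basis_zero (hX : X ∈ octDer) : X (octBasis 0) = 0 := by
  have h := hX (octBasis 0) (octBasis 0)
  rw [one_octMul, one_octMul, octMul_one] at h
  simpa using h

/-- Apply X to x² = −‖x‖²: the right side is killed, and the left side x · Xx + Xx · x is evaluated
by polarization. -/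
theorem apply_imaginary (hX : X ∈ octDer) {x : Octonion} (hx : x 0 = 0) :
    X x 0 = 0 ∧ ⟪x, X x⟫_ℝ = 0 := by
  have h := hX x x
  rw [octMul_self, hx, add_comm, octMul_add_swap, hx] at h
  simp only [mul_zero, zero_smul, zero_sub, zero_add, map_neg, map_smul, apply_basis_zero hX,
    smul_zero, neg_zero] at h
  have hk : ∀ k, 2 * X x 0 * x k - 2 * ⟪x, X x⟫_ℝ * octBasis 0 k = 0 := fun k => by
    simpa using (congrArg (fun z : Octonion => z k) h).symm
  have h0 : ⟪x, X x⟫_ℝ = 0 := by simpa [hx, octBasis_apply] using hk 0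
  refine ⟨?_, h0⟩
  by_contra hne
  have hx0 : x = 0 := by
    ext k
    simpa [h0, hne] using hk k
  rw [hx0, map_zero] at hne
  exact hne rfl

theorem apply_zero (hX : X ∈ octDer) (x : Octonion) : X x 0 = 0 := by
  have h := (apply_imaginary hX (x := x - x 0 • octBasis 0) (by simp [octBasis_apply])).1
  simpa [apply_basis_zero hX] using h

theorem inner_apply_self (hX : X ∈ octDer) (x : Octonion) : ⟪x, X x⟫_ℝ = 0 := by
  have h := (apply_imaginary hX (x := x - x 0 • octBasis 0) (by simp [octBasis_apply])).2
  have h2 : ⟪octBasis 0, X x⟫_ℝ = 0 := by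
    rw [octBasis, EuclideanSpace.inner_single_left, apply_zero hX]; simp
  simpa [apply_basis_zero hX, inner_sub_left, inner_smul_left, h2] using h

theorem inner_apply (hX : X ∈ octDer) (x y : Octonion) : ⟪X x, y⟫_ℝ = -⟪x, X y⟫_ℝ := by
  have h := inner_apply_self hX (x + y)
  rw [map_add, inner_add_left, inner_add_right, inner_add_right, inner_apply_self hX,
    inner_apply_self hX] at h
  linarith [real_inner_comm (X x) y]

/-- A derivation of the octonions annihilates some imaginary unit. -/
theorem exists_apply_eq_zero (hX : X ∈ octDer) :
    ∃ b : Octonion, b 0 = 0 ∧ ‖b‖ = 1 ∧ X b = 0 := by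
  let M : Matrix (Fin 7) (Fin 7) ℝ := Matrix.of fun i j => X (octBasis j.succ) i.succ
  have hM : M.transpose = -M := by
    ext i j
    have h := inner_apply hX (octBasis i.succ) (octBasis j.succ)
    rw [real_inner_comm, octBasis, octBasis, EuclideanSpace.inner_single_left,
      EuclideanSpace.inner_single_left] at h
    simpa [M, octBasis] using h
  -- A skew-symmetric matrix of odd size 7 is singular.
  have hdet : M.det = 0 := by
    have h := Matrix.det_transpose M
    rw [hM, Matrix.det_neg, Fintype.card_fin] at h
    linarith
  obtain ⟨v, hv, hMv⟩ := Matrix.exists_mulVec_eq_zero_iff.2 hdet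
  have hb : ∀ k, octIm (WithLp.toLp 2 v) k = ∑ j : Fin 7, v j * octBasis j.succ k := fun k => by
    fin_cases k <;> simp [octIm_apply, octBasis_apply, Fin.sum_univ_seven]
  have hb' : octIm (WithLp.toLp 2 v) = ∑ j : Fin 7, v j • octBasis j.succ := by
    ext k
    rw [hb]
    simp
  have hXb : X (octIm (WithLp.toLp 2 v)) = 0 := by
    ext k
    refine Fin.cases (apply_zero hX _) (fun i => ?_) k
    have h := congrFun hMv i
    rw [hb', map_sum]
    simpa [Matrix.mulVec, dotProduct, M, mul_comm] using h
  have hne : ‖octIm (WithLp.toLp 2 v)‖ ≠ 0 := by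
    rw [norm_octIm, norm_ne_zero_iff]
    exact fun h => hv (congrArg WithLp.ofLp h)
  refine ⟨‖octIm (WithLp.toLp 2 v)‖⁻¹ • octIm (WithLp.toLp 2 v), ?_, ?_, ?_⟩
  · rw [PiLp.smul_apply, octIm_apply_zero, smul_zero]
  · rw [norm_smul, norm_inv, norm_norm, inv_mul_cancel₀ hne]
  · rw [map_smul, hXb, smul_zero]

/-- For a derivation `X`, the sum of the products `X(eᵢ) eᵢ` vanishes. -/
theorem sum_octMul_apply_basis (hX : X ∈ octDer) :
    ∑ i : Fin 8, (octMul (X (octBasis i)) (octBasis i) -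
      octMul (octBasis i) (X (octBasis i))) = 0 := by
  have hs : ∀ i j, X (octBasis i) j = -X (octBasis j) i := fun i j => by
    have h := inner_apply hX (octBasis i) (octBasis j)
    rw [real_inner_comm, octBasis, octBasis, EuclideanSpace.inner_single_left,
      EuclideanSpace.inner_single_left] at h
    simpa [octBasis] using h
  have h0 := apply_basis_zero hX
  -- Leibniz on a basis product gives linear relations between matrix entries of X. Seven of them,
  -- with skew-symmetry, imply all coordinates of the claim.
  have key : ∀ i j k l : Fin 8, ∀ c : ℝ, octMul (octBasis i) (octBasis j) = c • octBasis k →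
      c * X (octBasis k) l = octMul (X (octBasis i)) (octBasis j) l +
        octMul (octBasis i) (X (octBasis j)) l := fun i j k l c h => by
    have h2 := hX (octBasis i) (octBasis j)
    rw [h, map_smul] at h2
    simpa using congrArg (fun z : Octonion => z l) h2
  have h1 := key 2 4 6 7 (-1) (by
    ext k
    fin_cases k <;> simp [octMul_apply_0, octMul_apply_1, octMul_apply_2, octMul_apply_3,
    octMul_apply_4, octMul_apply_5, octMul_apply_6, octMul_apply_7, octBasis_apply])
  have h2 := key 3 6 5 7 (-1) (by
    ext k
    fin_cases k <;> simp [octMul_apply_0, octMul_apply_1, octMul_apply_2, octMul_apply_3,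
    octMul_apply_4, octMul_apply_5, octMul_apply_6, octMul_apply_7, octBasis_apply])
  have h3 := key 1 4 5 6 (1) (by
    ext k
    fin_cases k <;> simp [octMul_apply_0, octMul_apply_1, octMul_apply_2, octMul_apply_3,
    octMul_apply_4, octMul_apply_5, octMul_apply_6, octMul_apply_7, octBasis_apply])
  have h4 := key 5 7 2 6 (1) (by
    ext k
    fin_cases k <;> simp [octMul_apply_0, octMul_apply_1, octMul_apply_2, octMul_apply_3,
    octMul_apply_4, octMul_apply_5, octMul_apply_6, octMul_apply_7, octBasis_apply])
  have h5 := key 6 1 7 2 (-1) (by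
    ext k
    fin_cases k <;> simp [octMul_apply_0, octMul_apply_1, octMul_apply_2, octMul_apply_3,
    octMul_apply_4, octMul_apply_5, octMul_apply_6, octMul_apply_7, octBasis_apply])
  have h6 := key 7 4 3 5 (-1) (by
    ext k
    fin_cases k <;> simp [octMul_apply_0, octMul_apply_1, octMul_apply_2, octMul_apply_3,
    octMul_apply_4, octMul_apply_5, octMul_apply_6, octMul_apply_7, octBasis_apply])
  have h7 := key 1 3 2 5 (-1) (by
    ext k
    fin_cases k <;> simp [octMul_apply_0, octMul_apply_1, octMul_apply_2, octMul_apply_3,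
    octMul_apply_4, octMul_apply_5, octMul_apply_6, octMul_apply_7, octBasis_apply])
  simp [octMul_apply_2, octMul_apply_5, octMul_apply_6, octMul_apply_7, octBasis_apply] at h1 h2 h3 h4 h5 h6 h7
  rw [Fin.sum_univ_eight, h0, octMul_zero_left, octMul_zero_right]
  ext k
  fin_cases k <;> simp [octMul_apply_0, octMul_apply_1, octMul_apply_2, octMul_apply_3,
    octMul_apply_4, octMul_apply_5, octMul_apply_6, octMul_apply_7, octBasis_apply] <;> linarith [
      hs 1 2, hs 1 3, hs 1 4, hs 1 5, hs 1 6, hs 1 7, hs 2 3, hs 2 4, hs 2 5, hs 2 6, hs 2 7,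
      hs 3 4, hs 3 5, hs 3 6, hs 3 7, hs 4 5, hs 4 6, hs 4 7, hs 5 6, hs 5 7, hs 6 7]

end octDer

/-- For imaginary `a` and `b`, the derivation `x ↦ 12 (⟨a, x⟩ b - ⟨b, x⟩ a) - [[a, b], x]`. -/
noncomputable def innerDer (a b : Octonion) : Octonion →L[ℝ] Octonion :=
  (12 : ℝ) • ((innerSL ℝ a).smulRight b - (innerSL ℝ b).smulRight a) -
    (octMulL (octMul a b - octMul b a) - octMulL.flip (octMul a b - octMul b a))

theorem innerDer_apply (a b x : Octonion) : innerDer a b x =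
    (12 : ℝ) • (⟪a, x⟫_ℝ • b - ⟪b, x⟫_ℝ • a) -
      (octMul (octMul a b - octMul b a) x - octMul x (octMul a b - octMul b a)) := rfl

/-- For imaginary a and b, `innerDer a b` is twice the classical derivation x ↦ [[a, b], x] −
3((ab)x − a(bx)). Only a = e₁ is checked in coordinates; symmetry gives the rest. -/
theorem innerDer_basis_one_mem {b : Octonion} (hb : b 0 = 0) :
    innerDer (octBasis 1) b ∈ octDer := fun x y => by
  have h : ∀ x k, innerDer (octBasis 1) b x k =
      12 * (x 1 * b k - (b 1 * x 1 + b 2 * x 2 + b 3 * x 3 + b 4 * x 4 + b 5 * x 5 + b 6 * x 6 +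
        b 7 * x 7) * octBasis 1 k) -
      (octMul (octMul (octBasis 1) b - octMul b (octBasis 1)) x k -
        octMul x (octMul (octBasis 1) b - octMul b (octBasis 1)) k) := fun x k => by
    rw [innerDer_apply, octonion_inner, octonion_inner]
    simp [octBasis_apply, hb]
  ext k
  fin_cases k <;> simp [octMul_apply_0, octMul_apply_1, octMul_apply_2, octMul_apply_3,
    octMul_apply_4, octMul_apply_5, octMul_apply_6, octMul_apply_7, h, octBasis_apply, hb] <;> ring

end Derivations

/-! ### Inner derivations and simplicity of the derivation algebra. -/

section DerivationsSimple

open scoped InnerProductSpace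

theorem innerDer_add_left (a a' b : Octonion) :
    innerDer (a + a') b = innerDer a b + innerDer a' b := by
  ext1 x
  simp only [add_apply, innerDer_apply, inner_add_left, octMul_add_left, octMul_add_right,
    octMul_sub_left, octMul_sub_right]
  module

theorem innerDer_swap (a b : Octonion) : innerDer a b = -innerDer b a := by
  ext1 x
  simp only [neg_apply, innerDer_apply, octMul_sub_left, octMul_sub_right]
  module

theorem innerDer_smul_left (c : ℝ) (a b : Octonion) :
    innerDer (c • a) b = c • innerDer a b := by
  ext1 x
  simp only [smul_apply, innerDer_apply, real_inner_smul_left, octMul_smul_left,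
    octMul_smul_right, octMul_sub_left, octMul_sub_right]
  module

theorem innerDer_add_right (a b b' : Octonion) :
    innerDer a (b + b') = innerDer a b + innerDer a b' := by
  rw [innerDer_swap, innerDer_add_left, neg_add, ← innerDer_swap, ← innerDer_swap]

theorem innerDer_smul_right (c : ℝ) (a b : Octonion) :
    innerDer a (c • b) = c • innerDer a b := by
  rw [innerDer_swap, innerDer_smul_left, innerDer_swap a b, smul_neg]

theorem innerDer_self (a : Octonion) : innerDer a a = 0 := by
  ext1 x
  simp [innerDer_apply, octMul_zero_left, octMul_zero_right]

theorem innerDer_zero_left (b : Octonion) : innerDer 0 b = 0 := by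
  ext1 x
  simp [innerDer_apply, octMul_zero_left, octMul_zero_right]

namespace G2

theorem inner_toEnd (α : G2) (x y : Octonion) : ⟪toEnd α x, toEnd α y⟫_ℝ = ⟪x, y⟫_ℝ := by
  have h := toEnd_apply_zero α (octMul x y)
  rw [toEnd_octMul, octMul_apply_zero, octMul_apply_zero, toEnd_apply_zero, toEnd_apply_zero] at h
  linarith

theorem innerDer_toEnd (α : G2) (a b x : Octonion) :
    innerDer (toEnd α a) (toEnd α b) (toEnd α x) = toEnd α (innerDer a b x) := by
  simp only [innerDer_apply, inner_toEnd, map_sub, map_smul, toEnd_octMul]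

theorem exists_toEnd_basis_one {v : Octonion} (hv0 : v 0 = 0) (hv : ‖v‖ = 1) :
    ∃ α, toEnd α (octBasis 1) = v := by
  rw [← octIm_imPart hv0, norm_octIm] at hv
  obtain ⟨α, hα⟩ := exists_imRep_eq hv
  refine ⟨α, ?_⟩
  rw [← octIm_single_zero, ← octIm_imRep, hα, octIm_imPart hv0]

end G2

/-- The construction is homogeneous in a and equivariant under G₂, which is transitive on imaginary
units, so a may be taken to be e₁. -/
theorem innerDer_mem {a b : Octonion} (ha : a 0 = 0) (hb : b 0 = 0) : innerDer a b ∈ octDer := by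
  rcases eq_or_ne a 0 with rfl | hne
  · rw [innerDer_zero_left]
    exact octDer.zero_mem
  have hn : ‖a‖ ≠ 0 := norm_ne_zero_iff.2 hne
  obtain ⟨α, hα⟩ := G2.exists_toEnd_basis_one (v := ‖a‖⁻¹ • a) (by simp [ha])
    (by rw [norm_smul, norm_inv, norm_norm, inv_mul_cancel₀ hn])
  have hab : innerDer a b = ‖a‖ • innerDer (‖a‖⁻¹ • a) b := by
    rw [innerDer_smul_left, smul_smul, mul_inv_cancel₀ hn, one_smul]
  rw [hab]
  refine octDer.smul_mem _ fun x y => ?_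
  have key : ∀ z, innerDer (‖a‖⁻¹ • a) b z =
      G2.toEnd α (innerDer (octBasis 1) (G2.toEnd α⁻¹ b) (G2.toEnd α⁻¹ z)) := fun z => by
    rw [← G2.innerDer_toEnd, hα, G2.toEnd_apply_inv, G2.toEnd_apply_inv]
  rw [key, key, key, G2.toEnd_octMul,
    innerDer_basis_one_mem (by rw [G2.toEnd_apply_zero, hb] : G2.toEnd α⁻¹ b 0 = 0), map_add,
    G2.toEnd_octMul, G2.toEnd_octMul, G2.toEnd_apply_inv, G2.toEnd_apply_inv]

/-- Infinitesimal equivariance: X is skew and satisfies Leibniz, and the formula for `innerDer` uses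
only inner product and multiplication. -/
theorem octDer.commutator_innerDer {X : Octonion →L[ℝ] Octonion} (hX : X ∈ octDer)
    (a b : Octonion) :
    X * innerDer a b - innerDer a b * X = innerDer (X a) b + innerDer a (X b) := by
  ext1 x
  simp only [sub_apply, add_apply, mul_apply_eq_comp, innerDer_apply, octDer.inner_apply hX,
    map_sub, map_smul, hX _ _, octMul_sub_left, octMul_sub_right, octMul_add_left,
    octMul_add_right]
  module

/-- Expansion in the orthonormal basis turns the inner product terms into 12(−X − X), and the
commutator terms vanish by `octDer.sum_octMul_apply_basis`. Hence the inner derivations span. -/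
theorem octDer.sum_innerDer {X : Octonion →L[ℝ] Octonion} (hX : X ∈ octDer) :
    ∑ i : Fin 8, innerDer (X (octBasis i)) (octBasis i) = (-24 : ℝ) • X := by
  ext1 x
  have h := octDer.sum_octMul_apply_basis hX
  have h1 : ∑ i : Fin 8, ⟪octBasis i, x⟫_ℝ • octBasis i = x := by
    have := (EuclideanSpace.basisFun (Fin 8) ℝ).sum_repr' x
    simpa [octBasis] using this
  have h2 : ∑ i : Fin 8, ⟪octBasis i, x⟫_ℝ • X (octBasis i) = X x := by
    conv_rhs => rw [← h1]
    simp
  have h3 : ∑ i : Fin 8, ⟪X (octBasis i), x⟫_ℝ • octBasis i = -X x := by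
    have := (EuclideanSpace.basisFun (Fin 8) ℝ).sum_repr' (X x)
    simp only [octDer.inner_apply hX, neg_smul, Finset.sum_neg_distrib]
    simpa [octBasis] using this
  have h4 : ∑ i : Fin 8, (octMul (octMul (X (octBasis i)) (octBasis i) -
      octMul (octBasis i) (X (octBasis i))) x - octMul x (octMul (X (octBasis i)) (octBasis i) -
      octMul (octBasis i) (X (octBasis i)))) = 0 := by
    simp only [← octMulL_apply] at h ⊢
    rw [Finset.sum_sub_distrib, ← map_sum, ← sum_apply, ← map_sum, h]
    simp
  rw [sum_apply]
  simp only [innerDer_apply]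
  rw [Finset.sum_sub_distrib, h4, ← Finset.smul_sum, Finset.sum_sub_distrib, h2, h3, smul_apply]
  module

theorem octMul_octMul_self_left {p : Octonion} (hp : p 0 = 0) (w : Octonion) :
    octMul p (octMul p w) = -(‖p‖ ^ 2) • w := by
  rw [octMul_leftAlternative, octMul_self, hp, mul_zero, zero_smul, zero_sub, octMul_neg_left,
    octMul_smul_left, one_octMul, neg_smul]

theorem octMul_octMul_swap {p w : Octonion} (hp : p 0 = 0) (hw : w 0 = 0) :
    octMul (octMul p w) p = (‖p‖ ^ 2) • w + (2 * octMul p w 0) • p := by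
  have h := octMul_add_swap p (octMul p w)
  rw [octMul_octMul_self_left hp, inner_octMul_left, hp, hw] at h
  rw [← sub_eq_zero] at h ⊢
  rw [← h]
  module

/-- The derivations of the octonions form a simple Lie algebra. -/
theorem octDer_le_of_ideal {I : Submodule ℝ (Octonion →L[ℝ] Octonion)} (hI : I ≤ octDer)
    (hbr : ∀ X ∈ octDer, ∀ Y ∈ I, X * Y - Y * X ∈ I) (hne : I ≠ ⊥) : octDer ≤ I := by
  obtain ⟨X, hXI, hX0⟩ := I.ne_bot_iff.1 hne
  have hX := hI hXI
  have hbr' : ∀ Z ∈ I, ∀ a b : Octonion, a 0 = 0 → b 0 = 0 →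
      innerDer (Z a) b + innerDer a (Z b) ∈ I := fun Z hZ a b ha hb => by
    rw [← octDer.commutator_innerDer (hI hZ), ← neg_sub]
    exact I.neg_mem (hbr _ (innerDer_mem ha hb) _ hZ)
  have hbr'' : ∀ E ∈ octDer, ∀ a b : Octonion, innerDer a b ∈ I →
      innerDer (E a) b + innerDer a (E b) ∈ I := fun E hE a b hab => by
    rw [← octDer.commutator_innerDer hE]
    exact hbr _ hE _ hab
  obtain ⟨b, hb0, hb1, hXb⟩ := octDer.exists_apply_eq_zero hX
  obtain ⟨a, ha0, hXa⟩ : ∃ a : Octonion, a 0 = 0 ∧ X a ≠ 0 := by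
    by_contra! hcon
    refine hX0 (ContinuousLinearMap.ext fun x => ?_)
    have h := hcon (x - x 0 • octBasis 0) (by simp [octBasis_apply])
    simpa [octDer.apply_basis_zero hX] using h
  set v := X a with hv
  have hv0 : v 0 = 0 := octDer.apply_zero hX a
  have hvb : ⟪v, b⟫_ℝ = 0 := by rw [hv, octDer.inner_apply hX, hXb, inner_zero_right, neg_zero]
  have hvn : ‖v‖ ^ 2 ≠ 0 := pow_ne_zero _ (norm_ne_zero_iff.2 hXa)
  -- The vectors v, b and p = vb are orthogonal imaginary generators of a quaternion subalgebra,
  -- which makes the action of Z below explicit.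
  set p := octMul v b with hp
  have hp0 : p 0 = 0 := by rw [hp, octMul_apply_zero, hv0, hvb]; ring
  have hpn : ‖p‖ ^ 2 ≠ 0 := by
    rw [hp, norm_octMul, hb1, mul_one]
    exact hvn
  have hbv : octMul b v = -p := by
    have h := octMul_add_swap v b
    rw [hv0, hb0, hvb] at h
    rw [eq_neg_iff_add_eq_zero, add_comm, h]
    simp
  have hpv : octMul p v = (‖v‖ ^ 2) • b := by
    rw [hp, octMul_octMul_swap hv0 hb0, ← hp, hp0]
    simp
  have hvp : octMul v p = -(‖v‖ ^ 2) • b := octMul_octMul_self_left hv0 b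
  have hbp : octMul b p = v := by
    rw [← neg_eq_iff_eq_neg.2 hbv, octMul_neg_right, octMul_octMul_self_left hb0, hb1]
    simp
  have hpb : octMul p b = -v := by
    have h := octMul_octMul_swap hb0 hv0
    rw [hbv, hb1, PiLp.neg_apply, hp0, octMul_neg_left] at h
    rw [neg_eq_iff_eq_neg.1 h]
    simp
  set Z := innerDer v b with hZ
  -- The bracket of X with `innerDer a b` is `innerDer v b`, since X b = 0.
  have hZI : Z ∈ I := by
    simpa [hXb, innerDer_swap a 0, innerDer_zero_left] using hbr' X hXI a b ha0 hb0
  have hZx : ∀ x, Z x = (12 : ℝ) • (⟪v, x⟫_ℝ • b - ⟪b, x⟫_ℝ • v) -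
      (2 : ℝ) • (octMul p x - octMul x p) := fun x => by
    rw [hZ, innerDer_apply, ← hp, hbv, sub_neg_eq_add, octMul_add_left, octMul_add_right]
    module
  have hZp : Z p = 0 := by
    rw [hZx, hp, inner_octMul_left, inner_octMul_right, hv0, hb0]
    simp
  have hZv : Z v = (8 * ‖v‖ ^ 2) • b := by
    rw [hZx, hpv, hvp, real_inner_self_eq_norm_sq, real_inner_comm, hvb]
    module
  have hZb : Z b = (-8 : ℝ) • v := by
    rw [hZx, hpb, hbp, real_inner_self_eq_norm_sq, hvb, hb1]
    module
  -- Because Z kills p, the same bracket formula yields `innerDer (Z x) p`.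
  have hrange : ∀ x : Octonion, x 0 = 0 → innerDer (Z x) p ∈ I := fun x hx => by
    have h := hbr' Z hZI x p hx hp0
    rwa [hZp, innerDer_swap x 0, innerDer_zero_left, neg_zero, add_zero] at h
  have hbI : innerDer b p ∈ I := by
    have h := hrange v hv0
    rw [hZv, innerDer_smul_left] at h
    exact (I.smul_mem_iff (mul_ne_zero (by norm_num) hvn)).1 h
  have hvI : innerDer v p ∈ I := by
    have h := hrange b hb0
    rw [hZb, innerDer_smul_left] at h
    exact (I.smul_mem_iff (by norm_num)).1 h
  have hpI : ∀ w : Octonion, w 0 = 0 → innerDer w p ∈ I := fun w hw => by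
    -- For x the imaginary part of pw, Z x is 4‖p‖²w plus a combination of b, v and p, whose
    -- contributions are already in I.
    have h := hrange (octMul p w - octMul p w 0 • octBasis 0) (by simp [octBasis_apply])
    rw [map_sub, map_smul, octDer.apply_basis_zero (hI hZI), smul_zero, sub_zero, hZx,
      octMul_octMul_self_left hp0, octMul_octMul_swap hp0 hw] at h
    set s := ⟪v, octMul p w⟫_ℝ
    set t := ⟪b, octMul p w⟫_ℝ
    set r := octMul p w 0
    have h2 : (12 : ℝ) • (s • b - t • v) -
        (2 : ℝ) • (-‖p‖ ^ 2 • w - (‖p‖ ^ 2 • w + (2 * r) • p)) =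
        (12 * s) • b + (-12 * t) • v + (4 * r) • p + (4 * ‖p‖ ^ 2) • w := by module
    have hz : (4 * r) • innerDer p p = 0 := by
      ext1 x
      simp [innerDer_self]
    rw [h2, innerDer_add_left, innerDer_add_left, innerDer_add_left, innerDer_smul_left,
      innerDer_smul_left, innerDer_smul_left, innerDer_smul_left, hz, add_zero] at h
    have h3 := (I.add_mem_iff_right
      (I.add_mem (I.smul_mem _ hbI) (I.smul_mem _ hvI))).1 h
    exact (I.smul_mem_iff (mul_ne_zero (by norm_num) hpn)).1 h3
  have hall : ∀ w c : Octonion, w 0 = 0 → c 0 = 0 → innerDer w c ∈ I := fun w c hw hc => by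
    -- Bracketing with `innerDer p c`, which takes p to 8‖p‖²c plus a multiple of p, replaces the
    -- fixed second argument p by an arbitrary c.
    have hE := innerDer_mem hp0 hc
    have h := hbr'' _ hE w p (hpI w hw)
    have h1 := hpI (innerDer p c w) (octDer.apply_zero hE w)
    have h2 := (I.add_mem_iff_right h1).1 h
    have hcp : octMul c p = -octMul p c - (2 * ⟪p, c⟫_ℝ) • octBasis 0 := by
      have h := octMul_add_swap p c
      rw [hp0, hc] at h
      rw [← sub_eq_zero] at h ⊢
      rw [← h]
      module
    have h3 : innerDer p c p = (8 * ‖p‖ ^ 2) • c + (-12 * ⟪c, p⟫_ℝ - 4 * octMul p c 0) • p := by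
      rw [innerDer_apply, hcp, real_inner_self_eq_norm_sq]
      simp only [octMul_sub_left, octMul_sub_right, octMul_neg_left, octMul_neg_right,
        octMul_smul_left, octMul_smul_right, octMul_one, one_octMul,
        octMul_octMul_self_left hp0, octMul_octMul_swap hp0 hc]
      module
    rw [h3, innerDer_add_right, innerDer_smul_right, innerDer_smul_right] at h2
    have h4 := (I.add_mem_iff_left (I.smul_mem _ (hpI w hw))).1 h2
    exact (I.smul_mem_iff (mul_ne_zero (by norm_num) hpn)).1 h4
  intro Y hY
  have h := octDer.sum_innerDer hY
  refine (I.smul_mem_iff (by norm_num : (-24 : ℝ) ≠ 0)).1 ?_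
  rw [← h, Fin.sum_univ_succ, octDer.apply_basis_zero hY, innerDer_zero_left, zero_add]
  refine I.sum_mem fun i _ => hall _ _ (octDer.apply_zero hY _) ?_
  simp [octBasis_apply, (Fin.succ_ne_zero i).symm]

theorem octDer_not_commutative : ∃ X ∈ octDer, ∃ Y ∈ octDer, X * Y - Y * X ≠ 0 := by
  have h0 : ∀ i : Fin 8, i ≠ 0 → octBasis i 0 = 0 := fun i hi => by
    simp [octBasis_apply, hi.symm]
  refine ⟨innerDer (octBasis 1) (octBasis 2), innerDer_mem (h0 1 (by decide)) (h0 2 (by decide)),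
    innerDer (octBasis 1) (octBasis 4), innerDer_mem (h0 1 (by decide)) (h0 4 (by decide)),
    fun h => ?_⟩
  have h1 := congrArg (fun T : Octonion →L[ℝ] Octonion => T (octBasis 1) 7) h
  have hn : ‖octBasis 1‖ = 1 := by simp [octBasis]
  simp [innerDer_apply, octMul_apply_0, octMul_apply_1, octMul_apply_2, octMul_apply_3,
    octMul_apply_4, octMul_apply_5, octMul_apply_6, octMul_apply_7, octBasis_apply,
    octonion_inner] at h1
  rw [hn] at h1
  norm_num at h1

end DerivationsSimple

/-! ### The Lie algebra of G₂ and the assembly of the theorem. -/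

theorem octDer.exp_apply_basis_zero {X : Octonion →L[ℝ] Octonion} (hX : X ∈ octDer) :
    NormedSpace.exp X (octBasis 0) = octBasis 0 := by
  have h := exp_apply_of_derivation (mem_octDer_iff_derivationDefect.1 hX) (octBasis 0)
    (NormedSpace.exp (-X) (octBasis 0))
  have h2 := exp_neg_apply_exp_apply (-X) (octBasis 0)
  rw [neg_neg] at h2
  rw [octMulL_apply, octMulL_apply, one_octMul, h2, octMul_one] at h
  exact h.symm

/-- A Lie group with a faithful infinitesimal representation by all derivations of the octonions
has a simple Lie algebra. -/
theorem isSimple_groupLieAlgebra_of_octDer {E G : Type*} [NormedAddCommGroup E] [NormedSpace ℝ E]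
    [CompleteSpace E] [TopologicalSpace G] [ChartedSpace E G] [Group G] [LieGroup 𝓘(ℝ, E) ∞ G]
    [LieGroup 𝓘(ℝ, E) (minSmoothness ℝ 3) G] (ι : G →* (Octonion →L[ℝ] Octonion))
    (hι : ContMDiff 𝓘(ℝ, E) 𝓘(ℝ, Octonion →L[ℝ] Octonion) ∞ ι)
    (hinj : Function.Injective (unitDifferential (E := E) ι))
    (hrange : Set.range (unitDifferential (E := E) ι) = octDer) :
    LieAlgebra.IsSimple ℝ (GroupLieAlgebra 𝓘(ℝ, E) G) := by
  let L : GroupLieAlgebra 𝓘(ℝ, E) G →ₗ[ℝ] (Octonion →L[ℝ] Octonion) :=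
    (unitDifferential (E := E) ι).toLinearMap
  have hL : ∀ v w : GroupLieAlgebra 𝓘(ℝ, E) G, L ⁅v, w⁆ = L v * L w - L w * L v :=
    mfderiv_bracket_eq_commutator ι hι
  have hmem : ∀ v, L v ∈ octDer := fun v => by
    rw [← SetLike.mem_coe, ← hrange]
    exact ⟨v, rfl⟩
  have hsurj : ∀ X ∈ octDer, ∃ v, L v = X := fun X hX => by
    rw [← SetLike.mem_coe, ← hrange] at hX
    exact hX
  constructor
  · intro I
    refine or_iff_not_imp_left.2 fun hI => ?_
    -- The differential carries brackets to commutators, so the image of a nonzero ideal is a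
    -- nonzero ideal of `octDer`.
    have hle : octDer ≤ I.toSubmodule.map L := by
      refine octDer_le_of_ideal ?_ ?_ ?_
      · rintro _ ⟨v, -, rfl⟩
        exact hmem v
      · rintro X hX _ ⟨w, hw, rfl⟩
        obtain ⟨v, rfl⟩ := hsurj X hX
        exact ⟨⁅v, w⁆, I.lie_mem hw, hL v w⟩
      · refine fun h => hI ((LieSubmodule.eq_bot_iff _).2 fun v hv => hinj ?_)
        have h2 : L v ∈ I.toSubmodule.map L := ⟨v, hv, rfl⟩
        rw [h, Submodule.mem_bot] at h2
        exact h2.trans (map_zero L).symm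
    rw [eq_top_iff]
    intro v _
    obtain ⟨w, hw, hwv⟩ := hle (hmem v)
    rwa [← hinj hwv]
  · intro hab
    obtain ⟨X, hX, Y, hY, hXY⟩ := octDer_not_commutative
    obtain ⟨v, rfl⟩ := hsurj X hX
    obtain ⟨w, rfl⟩ := hsurj Y hY
    rw [← hL, trivial_lie_zero, map_zero] at hXY
    exact hXY rfl

theorem theorem1p9p3 :
    -- `G₂` is a compact simple Lie group
    CompactSpace G2 ∧
    (∃ (n : ℕ) (_ : ChartedSpace (EuclideanSpace ℝ (Fin n)) G2)
      (_ : LieGroup 𝓘(ℝ, EuclideanSpace ℝ (Fin n)) ∞ G2),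
      ContMDiff 𝓘(ℝ, EuclideanSpace ℝ (Fin n)) 𝓘(ℝ, Octonion →L[ℝ] Octonion) ∞ G2.toEnd ∧
      IsSimpleLieGroup 𝓘(ℝ, EuclideanSpace ℝ (Fin n)) G2) ∧
    -- `G₂` is simply connected
    SimplyConnectedSpace G2 ∧
    -- the isotropy subgroup of `e₁` is `SU(3)`, acting by `a + m ↦ a + A m`
    (∃ φ : Matrix.specialUnitaryGroup (Fin 3) ℂ ≃ₜ* G2.isotropy,
      ∀ (A : Matrix.specialUnitaryGroup (Fin 3) ℂ) (a : ℂ) (m : Fin 3 → ℂ),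
        G2.toEnd (φ A : G2) (octOfComplex a m) =
          octOfComplex a ((A : Matrix (Fin 3) (Fin 3) ℂ).mulVec m)) ∧
    -- `G₂ / SU(3)` is homeomorphic to the unit sphere `S⁶` of the span of `e₁, …, e₇`, through
    -- the orbit map of `e₁`
    (∃ h : G2 ⧸ G2.isotropy ≃ₜ Metric.sphere (0 : EuclideanSpace ℝ (Fin 7)) 1,
      ∀ (α : G2) (i : Fin 7),
        (h (QuotientGroup.mk α) : EuclideanSpace ℝ (Fin 7)) i =
          G2.toEnd α (octBasis 1) i.succ) := by
  refine ⟨inferInstance, ?_, inferInstance,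
    ⟨G2.specialUnitaryEquiv, G2.toEnd_specialUnitaryEquiv⟩, G2.exists_quotient_homeomorph⟩
  obtain ⟨n, hc, hl, L, hs, hL⟩ := exists_lieGroup_of_exp (A := Octonion →L[ℝ] Octonion)
    G2.toEndHom G2.isEmbedding_toEnd octDer
    (fun X hX => by
      have h : NormedSpace.exp X ∈ Set.range G2.toEnd := by
        rw [G2.range_toEnd]
        exact ⟨octDer.exp_apply_basis_zero hX, exp_apply_of_derivation
          (mem_octDer_iff_derivationDefect.1 hX)⟩
      exact h)
    (by
      filter_upwards [eventually_derivationDefect_eq_zero octMulL] with X hX hr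
      rw [mem_octDer_iff_derivationDefect]
      obtain ⟨α, hα⟩ := hr
      refine hX fun x y => ?_
      rw [← hα]
      exact G2.toEnd_octMul α x y)
  refine ⟨n, hc, hl, hs, inferInstance, ?_⟩
  have : LieGroup 𝓘(ℝ, EuclideanSpace ℝ (Fin n)) (minSmoothness ℝ 3) G2 :=
    LieGroup.of_infty_minSmoothness _ _
  refine isSimple_groupLieAlgebra_of_octDer G2.toEndHom hs (fun v w h => ?_) (Set.ext fun X => ?_)
  · rw [hL, hL] at h
    exact L.injective (Subtype.ext h)
  · constructor
    · rintro ⟨v, rfl⟩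
      rw [hL]
      exact (L v).2
    · intro hX
      exact ⟨L.symm ⟨X, hX⟩, by rw [hL, L.apply_symm_apply]⟩
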